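/- **Setting.** Let $d$ be a positive integer and $a,b$ integers with $-d=b^2-4a$, and let $L=\mathbb Q(\sqrt{-d})$. Let $N$ be a squarefree positive integer and let $p$ be an odd prime with $p\nmid N$ and $p \nmid d$ that is inert in $L$. Put $L_p=L\otimes\mathbb Q_p$, $\mathbb Z_{L,p}=\mathbb Z_p[\sqrt{-d}]$, and let $\overline{\phantom{x}}$ be the conjugation of $L$. Let $J_n=\begin{pmatrix}0&I_n\\-I_n&0\end{pmatrix}$, let $GU(n,n)(R)$ (for a commutative ring $R$) be the group of $g\in GL_{2n}(L\otimes R)$ (read as $GL_{2n}(R[\sqrt{-d}])$) with $\overline g^{t}J_ng=\mu(g)J_n$, $\mu(g)\in R^\times$, and let $U(n,n)$ be its subgroup $\mu=1$. *Character.* Let $\Lambda_p$ be a unitary character of $L_p^\times$ which is trivial on $\mathbb Q_p^\times$ and on $\{x+y\sqrt{-d}\in\mathbb Z_{L,p}^\times: p\mid y\}$, but not trivial on $\mathbb Z_{L,p}^\times$. (These are the conditions at a prime $p$ dividing the auxiliary squarefree integer $M$.) *Whittaker function.* Let $f$ be a cusp form of positive even weight $\ell$ for $\Gamma_0(N)$.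 Define $\Psi$ on $GU(1,1)(\mathbb A)$ by $\Psi(a\gamma g_\infty k_0)=\det(g_\infty)^{\ell/2}(ci+e)^{-\ell}f(g_\infty i)$ for $a\in (L\otimes\mathbb A)^\times$, $\gamma\in GL_2(\mathbb Q)$, $g_\infty=\begin{pmatrix}*&*\\c&e\end{pmatrix}\in GL_2^+(\mathbb R)$, $k_0\in\prod_{q\nmid N}GL_2(\mathbb Z_q)\prod_{q\mid N}\{k\in GL_2(\mathbb Z_q): k_{21}\equiv0 \bmod q\}$. Let $\psi$ be the additive character of $\mathbb A/\mathbb Q$ with $\psi_\infty(x)=e^{2\pi i x}$ and with conductor $\mathbb Z_q$ at each prime $q$, and put $W_\Psi(x)=\int_{\mathbb Q\backslash\mathbb A}\Psi\left(\begin{pmatrix}1&t\\0&1\end{pmatrix}x\right)\psi(-t)\,dt$, where $\mathbb Q\backslash\mathbb A$ has volume one. Let $W_{\Psi,p}$ be a local component of $W_\Psi$ at $p$, i.e. $W_\Psi(x)=W_{\Psi,p}(x_p)\,W'(x)$ on $GU(1,1)(\mathbb A)$ with a function $W'\neq0$ that depends only on the components of $x$ away from $p$. (If $f$ is a newform, $W_{\Psi,p}$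 exists by uniqueness of Whittaker models.) *Matrices.* Let $$Q=\begin{pmatrix}0&1&0&0&0&0\\1&0&0&0&0&0\\0&0&0&0&0&-1\\0&0&0&0&1&-1\\0&0&0&1&0&0\\0&1&1&0&0&0\end{pmatrix},\quad \Theta=\begin{pmatrix}1&0&0&0\\\alpha&1&0&0\\0&0&1&-\overline\alpha\\0&0&0&1\end{pmatrix},\ \alpha=\frac{b+\sqrt{-d}}2,$$ $$s_1=\begin{pmatrix}0&1&0&0\\1&0&0&0\\0&0&0&1\\0&0&1&0\end{pmatrix},\ s_2=\begin{pmatrix}0&0&0&1\\0&0&1&0\\0&-1&0&0\\-1&0&0&0\end{pmatrix},\ s_3=\begin{pmatrix}0&0&1&0\\0&0&0&1\\-1&0&0&0\\0&-1&0&0\end{pmatrix},$$ $$s_4=\begin{pmatrix}0&-1&0&0\\-1&0&0&0\\0&0&0&-1\\1&0&-1&0\end{pmatrix},\ s_5=\begin{pmatrix}0&-1&0&0\\-1&0&0&0\\0&1&0&-1\\0&0&-1&0\end{pmatrix},$$ and $Y_p=\{1,s_1,s_2,s_3,\Theta,\Theta s_2,\Theta s_4,\Theta s_5\}$. For $g=\begin{pmatrix}A&B\\C&D\end{pmatrix}\in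 GU(2,2)$ and $h=\begin{pmatrix}x&y\\z&w\end{pmatrix}\in GU(1,1)$ with $\mu(g)=\mu(h)$ put $$\iota(g,h)=\begin{pmatrix}A&&B&\\&x&&-y\\C&&D&\\&-z&&w\end{pmatrix}\in GU(3,3),\qquad \Omega=Q\cdot\iota(\Theta,1).$$ *Section.* Let $P$ be the Siegel parabolic of $GU(3,3)$, consisting of the products $n(B)m(A,v)$ with $n(B)=\begin{pmatrix}1&B\\0&1\end{pmatrix}$, $\overline B^{t}=B$, and $m(A,v)=\begin{pmatrix}A&0\\0&v\,(\overline{A}^{-1})^{t}\end{pmatrix}$. Let $I'_p$ be the group of elements of $GU(3,3)(\mathbb Q_p)\cap GL_6(\mathbb Z_{L,p})$ whose reduction mod $p$ is an element $\begin{pmatrix}A&B\\0&\lambda(A^{t})^{-1}\end{pmatrix}$ of $GSp(6,\mathbb F_p)$ with $A$ lower triangular and $\lambda\in\mathbb F_p^\times$. For $s\in\mathbb C$ let $\Upsilon_p(\cdot,s)$ be the unique right $I_p'$-invariant function on $GU(3,3)(\mathbb Q_p)$ with $$\Upsilon_p(n\,m(A,v)\,t,s)=|v|_p^{-9(s+\frac12)}\,|N_{L/\mathbb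 Q}(\det A)|_p^{3(s+\frac12)}\,\Lambda_p(\det A)\,\Upsilon_p(t,s)$$ for $n\,m(A,v) \in P(\mathbb Q_p)$, with $\Upsilon_p(Q,s)=\Upsilon_p(\Omega,s)=1$, and vanishing outside $P(\mathbb Q_p)QI_p'\sqcup P(\mathbb Q_p)\Omega I_p'$. *Local integral.* For $g_p\in GU(1,1)(\mathbb Q_p)$ and $k_p\in Y_p$ put $$Z_p(g_p,k_p,s)=\int_{U(1,1)(\mathbb Q_p)}\Upsilon_p(Q\cdot\iota(k_p,h),s)\,W_{\Psi,p}(g_ph)\,\Lambda_p^{-1}(\det h)\,dh,$$ with the Haar measure for which $U(1,1)(\mathbb Q_p)\cap GL_2(\mathbb Z_{L,p})$ has volume one. **Proposition.** For all $g_p\in GU(1,1)(\mathbb Q_p)$ and $k_p\in Y_p$, the integral $Z_p(g_p,k_p,s)$ converges absolutely for $\operatorname{Re}(s)>-\frac16$, and for every $s\in\mathbb C$ for which it converges absolutely one has $$Z_p(g_p,k_p,s)=\begin{cases}\dfrac{W_{\Psi,p}(g_p)}{(p+1)^2}&\text{if }k_p=1\text{ or }k_p=\Theta,\\[2mm]0&\text{if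 }k_p\in\{s_1,s_2,s_3,\Theta s_2,\Theta s_4,\Theta s_5\}.\end{cases}$$ -/

import Mathlib

open Matrix MeasureTheory
open scoped RestrictedProduct ComplexConjugate

namespace Pullback

noncomputable section

instance factPrimes (q : Nat.Primes) : Fact (q : ℕ).Prime := ⟨q.2⟩

/-! ### The quadratic algebra `L ⊗ R` for `L = ℚ(√-d)` -/

/-- `L ⊗ R = R[√-d]`, with elements `⟨x, y⟩ = x + y √-d`; `star` is the conjugation of `L`.
For `R = ℚ_[p]` this is `L_p`.  For `p` odd and not dividing `d`, the case `R = ℤ_[p]` is the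
closure of the ring of integers of `L` in `L_p`. -/
abbrev LAlg (d : ℕ) (R : Type*) [CommRing R] : Type _ := QuadraticAlgebra R (-(d : R)) 0

/-- Functoriality of `R ↦ L ⊗ R`. -/
def LAlg.map {d : ℕ} {R S : Type*} [CommRing R] [CommRing S] (φ : R →+* S) :
    LAlg d R →+* LAlg d S where
  toFun z := ⟨φ z.re, φ z.im⟩
  map_one' := by ext <;> simp [QuadraticAlgebra.re_one, QuadraticAlgebra.im_one]
  map_mul' z w := by ext <;> simp
  map_zero' := by ext <;> simp
  map_add' z w := by ext <;> simp

theorem LAlg.map_star {d : ℕ} {R S : Type*} [CommRing R] [CommRing S] (φ : R →+* S)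
    (z : LAlg d R) : LAlg.map φ (star z) = star (LAlg.map φ z) := by
  ext <;> simp [LAlg.map]

theorem LAlg.map_algebraMap {d : ℕ} {R S : Type*} [CommRing R] [CommRing S] (φ : R →+* S)
    (r : R) : LAlg.map φ (algebraMap R (LAlg d R) r) = algebraMap S (LAlg d S) (φ r) := by
  ext <;> simp [LAlg.map]

/-- The product topology on `R ⊕ R √-d`. -/
instance quadraticTopology {R : Type*} [TopologicalSpace R] (a b : R) :
    TopologicalSpace (QuadraticAlgebra R a b) :=
  TopologicalSpace.induced (QuadraticAlgebra.equivProd a b) inferInstance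

/-! ### Unitary similitude groups -/

/-- `J_n`, as a block matrix. -/
def Jmat (n : ℕ) : Matrix (Fin n ⊕ Fin n) (Fin n ⊕ Fin n) ℤ := fromBlocks 0 1 (-1) 0

/-- `J_1`, as a matrix of size two. -/
def J₁ : Matrix (Fin 2) (Fin 2) ℤ := !![0, 1; -1, 0]

/-- The group of `R`-points of the unitary similitude group of the form `J`:
all `g` with `ᵗ(conj g) J g = μ J` for some `μ ∈ Rˣ`. -/
def unitarySimilitude {m : Type*} [Fintype m] [DecidableEq m] (J : Matrix m m ℤ)
    (d : ℕ) (R : Type*) [CommRing R] : Subgroup (GL m (LAlg d R)) where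
  carrier := {g | ∃ μ : Rˣ, (g : Matrix m m (LAlg d R))ᴴ * J.map (Int.cast : ℤ → LAlg d R) * g =
    algebraMap R (LAlg d R) μ • J.map (Int.cast : ℤ → LAlg d R)}
  one_mem' := ⟨1, by simp⟩
  mul_mem' := by
    rintro g h ⟨μ, hμ⟩ ⟨ν, hν⟩
    refine ⟨μ * ν, ?_⟩
    rw [Units.val_mul, conjTranspose_mul]
    calc _ = (h : Matrix m m (LAlg d R))ᴴ *
          ((g : Matrix m m (LAlg d R))ᴴ * J.map (Int.cast : ℤ → LAlg d R) * g) * h := by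
          simp only [Matrix.mul_assoc]
      _ = _ := by
          rw [hμ, Matrix.mul_smul, Matrix.smul_mul, hν, smul_smul, Units.val_mul, map_mul]
  inv_mem' := by
    rintro g ⟨μ, hμ⟩
    refine ⟨μ⁻¹, ?_⟩
    have h1 : (g : Matrix m m (LAlg d R)) * (g⁻¹ : GL m (LAlg d R)) = 1 := by
      rw [← Units.val_mul, mul_inv_cancel, Units.val_one]
    have h2 : ((g⁻¹ : GL m (LAlg d R)) : Matrix m m (LAlg d R))ᴴ *
        (g : Matrix m m (LAlg d R))ᴴ = 1 := by
      rw [← conjTranspose_mul, h1, conjTranspose_one]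
    have h3 : algebraMap R (LAlg d R) (μ⁻¹ : Rˣ) * algebraMap R (LAlg d R) μ = 1 := by
      rw [← map_mul, Units.inv_mul, map_one]
    calc _ = (algebraMap R (LAlg d R) (μ⁻¹ : Rˣ) * algebraMap R (LAlg d R) μ) •
          (((g⁻¹ : GL m (LAlg d R)) : Matrix m m (LAlg d R))ᴴ *
            J.map (Int.cast : ℤ → LAlg d R) * (g⁻¹ : GL m (LAlg d R))) := by rw [h3, one_smul]
      _ = algebraMap R (LAlg d R) (μ⁻¹ : Rˣ) •
          (((g⁻¹ : GL m (LAlg d R)) : Matrix m m (LAlg d R))ᴴ *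
            (algebraMap R (LAlg d R) μ • J.map (Int.cast : ℤ → LAlg d R)) *
              (g⁻¹ : GL m (LAlg d R))) := by
          rw [Matrix.mul_smul, Matrix.smul_mul, smul_smul]
      _ = algebraMap R (LAlg d R) (μ⁻¹ : Rˣ) •
          ((((g⁻¹ : GL m (LAlg d R)) : Matrix m m (LAlg d R))ᴴ *
            (g : Matrix m m (LAlg d R))ᴴ) * J.map (Int.cast : ℤ → LAlg d R) *
              ((g : Matrix m m (LAlg d R)) * (g⁻¹ : GL m (LAlg d R)))) := by
          rw [← hμ]; simp only [Matrix.mul_assoc]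
      _ = _ := by rw [h1, h2, Matrix.one_mul, Matrix.mul_one]

/-- `F̃ = GU(1,1)`. -/
abbrev Ftilde (d : ℕ) (R : Type*) [CommRing R] : Type _ := ↥(unitarySimilitude J₁ d R)

/-- `F̃₁ = U(1,1)`, the elements of `F̃` of similitude one. -/
def Ftilde₁ (d : ℕ) (R : Type*) [CommRing R] : Subgroup (Ftilde d R) where
  carrier := {g | (g.1 : Matrix (Fin 2) (Fin 2) (LAlg d R))ᴴ *
    J₁.map (Int.cast : ℤ → LAlg d R) * g.1 = J₁.map (Int.cast : ℤ → LAlg d R)}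
  one_mem' := by simp
  mul_mem' := by
    rintro ⟨g, _⟩ ⟨h, _⟩ hg hh
    simp only [Set.mem_ofPred_eq, Subgroup.coe_mul, Units.val_mul, conjTranspose_mul] at hg hh ⊢
    calc _ = (h : Matrix (Fin 2) (Fin 2) (LAlg d R))ᴴ *
          ((g : Matrix (Fin 2) (Fin 2) (LAlg d R))ᴴ *
            J₁.map (Int.cast : ℤ → LAlg d R) * g) * h := by simp only [Matrix.mul_assoc]
      _ = _ := by rw [hg, hh]
  inv_mem' := by
    rintro ⟨g, _⟩ hg
    simp only [Set.mem_ofPred_eq, Subgroup.coe_inv] at hg ⊢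
    have h1 : (g : Matrix (Fin 2) (Fin 2) (LAlg d R)) * (g⁻¹ : GL (Fin 2) (LAlg d R)) = 1 := by
      rw [← Units.val_mul, mul_inv_cancel, Units.val_one]
    have h2 : ((g⁻¹ : GL (Fin 2) (LAlg d R)) : Matrix (Fin 2) (Fin 2) (LAlg d R))ᴴ *
        (g : Matrix (Fin 2) (Fin 2) (LAlg d R))ᴴ = 1 := by
      rw [← conjTranspose_mul, h1, conjTranspose_one]
    calc _ = ((g⁻¹ : GL (Fin 2) (LAlg d R)) : Matrix (Fin 2) (Fin 2) (LAlg d R))ᴴ *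
          ((g : Matrix (Fin 2) (Fin 2) (LAlg d R))ᴴ *
            J₁.map (Int.cast : ℤ → LAlg d R) * g) * (g⁻¹ : GL (Fin 2) (LAlg d R)) := by rw [hg]
      _ = (((g⁻¹ : GL (Fin 2) (LAlg d R)) : Matrix (Fin 2) (Fin 2) (LAlg d R))ᴴ *
            (g : Matrix (Fin 2) (Fin 2) (LAlg d R))ᴴ) * J₁.map (Int.cast : ℤ → LAlg d R) *
              ((g : Matrix (Fin 2) (Fin 2) (LAlg d R)) * (g⁻¹ : GL (Fin 2) (LAlg d R))) := by
          simp only [Matrix.mul_assoc]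
      _ = _ := by rw [h1, h2, Matrix.one_mul, Matrix.mul_one]

/-- Functoriality of `R ↦ F̃(R)`. -/
def Ftilde.map {d : ℕ} {R S : Type*} [CommRing R] [CommRing S] (φ : R →+* S) :
    Ftilde d R →* Ftilde d S :=
  ((GeneralLinearGroup.map (LAlg.map φ)).comp (unitarySimilitude J₁ d R).subtype).codRestrict _ <| by
    rintro ⟨g, μ, hμ⟩
    refine ⟨Units.map φ.toMonoidHom μ, ?_⟩
    have hJ : (J₁.map (Int.cast : ℤ → LAlg d R)).map (LAlg.map φ) =
        J₁.map (Int.cast : ℤ → LAlg d S) := by ext1; simp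
    have hs : ((g : Matrix (Fin 2) (Fin 2) (LAlg d R)).map (LAlg.map φ))ᴴ =
        ((g : Matrix (Fin 2) (Fin 2) (LAlg d R))ᴴ).map (LAlg.map φ) := by
      ext1 i j; simp [LAlg.map_star]
    have := congrArg (fun X => X.map (LAlg.map (d := d) φ)) hμ
    simp only [Matrix.map_mul, hJ, ← hs] at this
    refine this.trans ?_
    ext1 i j
    simp only [Matrix.map_apply, Matrix.smul_apply, smul_eq_mul, map_mul, LAlg.map_algebraMap,
      map_intCast]
    rfl

/-! ### Local subgroups at a prime -/

/-- The inclusion `ℤ_{L,p} → L_p`. -/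
def intIncl (d : ℕ) (p : Nat.Primes) : LAlg d ℤ_[p] →+* LAlg d ℚ_[p] :=
  LAlg.map PadicInt.Coe.ringHom

/-- `K_p^{F̃₁}`: the elements of `U(1,1)(ℚ_p)` that lie in `GL₂(ℤ_{L,p})`. -/
def KF₁ (d : ℕ) (p : Nat.Primes) : Set (Ftilde₁ d ℚ_[p]) :=
  {h | ∃ k : GL (Fin 2) (LAlg d ℤ_[p]), GeneralLinearGroup.map (intIncl d p) k = h.1.1}

/-- The Borel subgroup `I(2n, R)` of `GSp(2n, R)`: its elements of the form
`(A, B; 0, λ ᵗA⁻¹)` with `A` lower triangular. -/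
def IsBorel {n : ℕ} {R : Type*} [CommRing R] (g : Matrix (Fin n ⊕ Fin n) (Fin n ⊕ Fin n) R) :
    Prop :=
  (∃ μ : Rˣ, gᵀ * (Jmat n).map (Int.cast : ℤ → R) * g =
      (μ : R) • (Jmat n).map (Int.cast : ℤ → R)) ∧
    ∃ (A : GL (Fin n) R) (B : Matrix (Fin n) (Fin n) R) (l : Rˣ),
      (∀ i j, i < j → (A : Matrix (Fin n) (Fin n) R) i j = 0) ∧
      g = fromBlocks A B 0 ((l : R) • ((A⁻¹ : GL (Fin n) R) : Matrix (Fin n) (Fin n) R)ᵀ)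

/-- `I'_p ⊆ GU(3,3)(ℤ_p)`: the elements whose reduction in `GU(3,3)(𝔽_p)` is an element of the
Borel subgroup `I(6, 𝔽_p)` of `GSp(6, 𝔽_p)`. -/
def IwahoriH (d : ℕ) (p : Nat.Primes) : Set (GL (Fin 3 ⊕ Fin 3) (LAlg d ℤ_[p])) :=
  {k | k ∈ unitarySimilitude (Jmat 3) d ℤ_[p] ∧
    ∃ g : Matrix (Fin 3 ⊕ Fin 3) (Fin 3 ⊕ Fin 3) (ZMod p), IsBorel g ∧
      (k : Matrix (Fin 3 ⊕ Fin 3) (Fin 3 ⊕ Fin 3) (LAlg d ℤ_[p])).map (LAlg.map PadicInt.toZMod) =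
        g.map (algebraMap (ZMod p) (LAlg d (ZMod p)))}

/-! ### The matrices `Q`, `Θ`, `s_i`, the embedding `ι` and the set `Y_p` -/

/-- The element `Q` of `Sp(6)`. -/
def Qmat (R : Type*) [CommRing R] : Matrix (Fin 3 ⊕ Fin 3) (Fin 3 ⊕ Fin 3) R :=
  fromBlocks !![0, 1, 0; 1, 0, 0; 0, 0, 0] !![0, 0, 0; 0, 0, 0; 0, 0, -1]
    !![0, 0, 0; 0, 0, 0; 0, 1, 1] !![0, 1, -1; 1, 0, 0; 0, 0, 0]

def s₁ (R : Type*) [CommRing R] : Matrix (Fin 2 ⊕ Fin 2) (Fin 2 ⊕ Fin 2) R :=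
  fromBlocks !![0, 1; 1, 0] 0 0 !![0, 1; 1, 0]

def s₂ (R : Type*) [CommRing R] : Matrix (Fin 2 ⊕ Fin 2) (Fin 2 ⊕ Fin 2) R :=
  fromBlocks 0 !![0, 1; 1, 0] !![0, -1; -1, 0] 0

def s₃ (R : Type*) [CommRing R] : Matrix (Fin 2 ⊕ Fin 2) (Fin 2 ⊕ Fin 2) R :=
  fromBlocks 0 1 (-1) 0

def s₄ (R : Type*) [CommRing R] : Matrix (Fin 2 ⊕ Fin 2) (Fin 2 ⊕ Fin 2) R :=
  fromBlocks !![0, -1; -1, 0] 0 !![0, 0; 1, 0] !![0, -1; -1, 0]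

def s₅ (R : Type*) [CommRing R] : Matrix (Fin 2 ⊕ Fin 2) (Fin 2 ⊕ Fin 2) R :=
  fromBlocks !![0, -1; -1, 0] 0 !![0, 1; 0, 0] !![0, -1; -1, 0]

/-- `α = (b + √-d) / 2`, as an element of `L_p`. -/
def alpha (d : ℕ) (b : ℤ) (p : Nat.Primes) : LAlg d ℚ_[p] := ⟨(b : ℚ_[p]) / 2, 1 / 2⟩

/-- The element `Θ` of `U(2,2)`. -/
def Theta (d : ℕ) (b : ℤ) (p : Nat.Primes) :
    Matrix (Fin 2 ⊕ Fin 2) (Fin 2 ⊕ Fin 2) (LAlg d ℚ_[p]) :=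
  fromBlocks !![1, 0; alpha d b p, 1] 0 0 !![1, -star (alpha d b p); 0, 1]

/-- The set of representatives `Y_p` for a prime `p` dividing `M`. -/
def Y (d : ℕ) (b : ℤ) (p : Nat.Primes) :
    Set (Matrix (Fin 2 ⊕ Fin 2) (Fin 2 ⊕ Fin 2) (LAlg d ℚ_[p])) :=
  {1, s₁ _, s₂ _, s₃ _, Theta d b p, Theta d b p * s₂ _, Theta d b p * s₄ _, Theta d b p * s₅ _}

/-- The block matrix `(A, 0; 0, a)` of size `2 + 1`. -/
def addCorner {R : Type*} [CommRing R] (A : Matrix (Fin 2) (Fin 2) R) (a : R) :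
    Matrix (Fin 3) (Fin 3) R :=
  !![A 0 0, A 0 1, 0; A 1 0, A 1 1, 0; 0, 0, a]

/-- The embedding `ι` of pairs in `GU(2,2) × GU(1,1)` of equal similitude into `GU(3,3)`. -/
def iota {R : Type*} [CommRing R] (g : Matrix (Fin 2 ⊕ Fin 2) (Fin 2 ⊕ Fin 2) R)
    (h : Matrix (Fin 2) (Fin 2) R) : Matrix (Fin 3 ⊕ Fin 3) (Fin 3 ⊕ Fin 3) R :=
  fromBlocks (addCorner g.toBlocks₁₁ (h 0 0)) (addCorner g.toBlocks₁₂ (-h 0 1))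
    (addCorner g.toBlocks₂₁ (-h 1 0)) (addCorner g.toBlocks₂₂ (h 1 1))

/-- `Ω = Q · ι(Θ, 1)`. -/
def Omega (d : ℕ) (b : ℤ) (p : Nat.Primes) :
    Matrix (Fin 3 ⊕ Fin 3) (Fin 3 ⊕ Fin 3) (LAlg d ℚ_[p]) :=
  Qmat _ * iota (Theta d b p) 1

/-- The number described by a predicate that holds for exactly one complex number
(zero for a predicate that no number, or more than one number, satisfies). -/
def theValue (P : ℂ → Prop) : ℂ :=
  open Classical in if h : ∃! z, P z then h.choose else 0

/-! ### The section `Υ_p` -/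

/-- The element `m(A, v)` of the Levi subgroup of the Siegel parabolic of `GU(3,3)(ℚ_p)`. -/
def siegelLevi {d : ℕ} {p : Nat.Primes} (A : GL (Fin 3) (LAlg d ℚ_[p])) (v : ℚ_[p]ˣ) :
    Matrix (Fin 3 ⊕ Fin 3) (Fin 3 ⊕ Fin 3) (LAlg d ℚ_[p]) :=
  fromBlocks A 0 0 (algebraMap ℚ_[p] (LAlg d ℚ_[p]) v •
    ((A⁻¹ : GL (Fin 3) (LAlg d ℚ_[p])) : Matrix (Fin 3) (Fin 3) (LAlg d ℚ_[p]))ᴴ)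

/-- The value at `m(A, v)` of the character of the Siegel parabolic that defines
`I_p(Λ_p, s)`: `|v|^{-9(s+1/2)} |N(det A)|^{3(s+1/2)} Λ_p(det A)`. -/
def siegelChar {d : ℕ} {p : Nat.Primes} (Λ : (LAlg d ℚ_[p])ˣ →* Circle) (s : ℂ)
    (A : GL (Fin 3) (LAlg d ℚ_[p])) (v : ℚ_[p]ˣ) : ℂ :=
  ((‖(v : ℚ_[p])‖ : ℝ) : ℂ) ^ (-9 * (s + 1 / 2)) *
    ((‖QuadraticAlgebra.norm ((GeneralLinearGroup.det A : (LAlg d ℚ_[p])ˣ) : LAlg d ℚ_[p])‖ : ℝ) :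
      ℂ) ^ (3 * (s + 1 / 2)) * (Λ (GeneralLinearGroup.det A) : ℂ)

/-- `z` is the value at `t` that is forced on a right `I'_p`-invariant element of `I_p(Λ_p, s)`
that equals `1` at `Q` and at `Ω`: here `t = n(B) m(A, v) X κ` with `X ∈ {Q, Ω}`, `κ ∈ I'_p`. -/
def IsUpsilonValue {d : ℕ} (b : ℤ) {p : Nat.Primes} (Λ : (LAlg d ℚ_[p])ˣ →* Circle) (s : ℂ)
    (t : Matrix (Fin 3 ⊕ Fin 3) (Fin 3 ⊕ Fin 3) (LAlg d ℚ_[p])) (z : ℂ) : Prop :=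
  ∃ (B : Matrix (Fin 3) (Fin 3) (LAlg d ℚ_[p])) (A : GL (Fin 3) (LAlg d ℚ_[p])) (v : ℚ_[p]ˣ)
    (X : Matrix (Fin 3 ⊕ Fin 3) (Fin 3 ⊕ Fin 3) (LAlg d ℚ_[p]))
    (κ : GL (Fin 3 ⊕ Fin 3) (LAlg d ℤ_[p])),
    Bᴴ = B ∧ (X = Qmat _ ∨ X = Omega d b p) ∧ κ ∈ IwahoriH d p ∧
    t = fromBlocks 1 B 0 1 * siegelLevi A v * X *
      (κ : Matrix (Fin 3 ⊕ Fin 3) (Fin 3 ⊕ Fin 3) (LAlg d ℤ_[p])).map (intIncl d p) ∧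
    z = siegelChar Λ s A v

/-- The section `Υ_p(·, s)` at a prime dividing `M` but not `N`: the right `I'_p`-invariant
element of `I_p(Λ_p, s)` with `Υ_p(Q, s) = Υ_p(Ω, s) = 1` that vanishes outside
`P(ℚ_p) Q I'_p ⊔ P(ℚ_p) Ω I'_p`. -/
def Upsilon {d : ℕ} (b : ℤ) {p : Nat.Primes} (Λ : (LAlg d ℚ_[p])ˣ →* Circle) (s : ℂ)
    (t : Matrix (Fin 3 ⊕ Fin 3) (Fin 3 ⊕ Fin 3) (LAlg d ℚ_[p])) : ℂ :=
  theValue (IsUpsilonValue b Λ s t)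

/-- The conditions on the local component at a prime `p ∣ M` of the unitary character `Λ`:
trivial on `ℚ_pˣ`, trivial on the units `x + y √-d` of `ℤ_{L,p}` with `p ∣ y`, and
nontrivial on the units of `ℤ_{L,p}`. -/
structure IsAdmissible {d : ℕ} {p : Nat.Primes} (Λ : (LAlg d ℚ_[p])ˣ →* Circle) : Prop where
  trivial_base : ∀ x : ℚ_[p]ˣ,
    Λ (Units.map (algebraMap ℚ_[p] (LAlg d ℚ_[p])).toMonoidHom x) = 1
  trivial_sub : ∀ u : (LAlg d ℤ_[p])ˣ, (p : ℤ_[p]) ∣ (u : LAlg d ℤ_[p]).im →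
    Λ (Units.map (intIncl d p).toMonoidHom u) = 1
  nontrivial : ∃ u : (LAlg d ℤ_[p])ˣ, Λ (Units.map (intIncl d p).toMonoidHom u) ≠ 1

/-! ### Adeles of `ℚ` and the Whittaker function of a cusp form -/

/-- The finite adeles of `ℚ`. -/
abbrev FinAdele : Type := Πʳ q : Nat.Primes, [ℚ_[q], PadicInt.subring q]

/-- The adeles of `ℚ`. -/
abbrev Adele : Type := ℝ × FinAdele

/-- The projection of the adeles to `ℚ_q`. -/
def toPadic (q : Nat.Primes) : Adele →+* ℚ_[q] :=
  (RestrictedProduct.evalRingHom (fun q : Nat.Primes => ℚ_[q]) q).comp (RingHom.snd ℝ FinAdele)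

theorem rat_eventually_integral (r : ℚ) :
    ∀ᶠ q : Nat.Primes in Filter.cofinite, (r : ℚ_[q]) ∈ PadicInt.subring q := by
  have hfin : {q : Nat.Primes | (q : ℕ) ∣ r.den}.Finite := by
    refine Set.Finite.of_finite_image (f := fun q : Nat.Primes => (q : ℕ)) ?_
      (Subtype.val_injective.injOn)
    refine (Set.finite_Iic r.den).subset ?_
    rintro _ ⟨q, hq, rfl⟩
    exact Nat.le_of_dvd r.den_pos hq
  refine (hfin.subset ?_)
  intro q hq
  by_contra hnd
  exact hq (Padic.norm_rat_le_one hnd)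

/-- The diagonal embedding of `ℚ` into the adeles. -/
def ratToAdele : ℚ →+* Adele where
  toFun r := (r, ⟨fun q => (r : ℚ_[q]), rat_eventually_integral r⟩)
  map_one' := by
    refine Prod.ext (by simp) ?_
    ext q; exact Rat.cast_one
  map_mul' x y := by
    refine Prod.ext (by simp) ?_
    ext q; exact Rat.cast_mul x y
  map_zero' := by
    refine Prod.ext (by simp) ?_
    ext q; exact Rat.cast_zero
  map_add' x y := by
    refine Prod.ext (by simp) ?_
    ext q; exact Rat.cast_add x y

/-- The compact quotient of the adeles by `ℚ`. -/
abbrev AdeleQuot : Type := Adele ⧸ (ratToAdele : ℚ →+* Adele).toAddMonoidHom.range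

instance : MeasurableSpace AdeleQuot := borel _

instance : BorelSpace AdeleQuot := ⟨rfl⟩

/-- Cusp forms of weight `ℓ` for `Γ₀(N)`. -/
abbrev CuspForms (N ℓ : ℕ) : Type :=
  CuspForm ((CongruenceSubgroup.Gamma0 N).map (Matrix.SpecialLinearGroup.mapGL ℝ)) (ℓ : ℤ)

/-- `y ∈ GL₂(𝔸)` is of the form `g_∞ k₀` with `g_∞ ∈ GL₂⁺(ℝ)` and `k₀` in the product of the
groups `GL₂(ℤ_q)` for `q ∤ N` and `Γ_{0,q}` for `q ∣ N`. -/
def IsLevel (N : ℕ) (y : GL (Fin 2) Adele) : Prop :=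
  0 < (GeneralLinearGroup.det (GeneralLinearGroup.map (RingHom.fst ℝ FinAdele) y) : ℝ) ∧
  ∀ q : Nat.Primes, ∃ k : GL (Fin 2) ℤ_[q],
    GeneralLinearGroup.map PadicInt.Coe.ringHom k = GeneralLinearGroup.map (toPadic q) y ∧
    ((q : ℕ) ∣ N → (q : ℤ_[q]) ∣ (k : Matrix (Fin 2) (Fin 2) ℤ_[q]) 1 0)

/-- `z` is the number `det(g_∞)^{ℓ/2} (c i + d)^{-ℓ} f(g_∞ i)` for a decomposition
`x = a γ g_∞ k₀` with `a` in the ideles of `L`, `γ ∈ GL₂(ℚ)`, and `y = g_∞ k₀` as above. -/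
def IsLiftValue {N ℓ : ℕ} (f : CuspForms N ℓ) {d : ℕ}
    (x : Matrix (Fin 2) (Fin 2) (LAlg d Adele)) (z : ℂ) : Prop :=
  ∃ (a : (LAlg d Adele)ˣ) (γ : GL (Fin 2) ℚ) (y : GL (Fin 2) Adele), IsLevel N y ∧
    x = (a : LAlg d Adele) • ((GeneralLinearGroup.map ratToAdele γ * y : GL (Fin 2) Adele) :
      Matrix (Fin 2) (Fin 2) Adele).map (algebraMap Adele (LAlg d Adele)) ∧
    z = ((GeneralLinearGroup.det (GeneralLinearGroup.map (RingHom.fst ℝ FinAdele) y) : ℝ) : ℂ) ^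
          (ℓ / 2) *
        UpperHalfPlane.denom (GeneralLinearGroup.map (RingHom.fst ℝ FinAdele) y) Complex.I ^
          (-(ℓ : ℤ)) *
        f (GeneralLinearGroup.map (RingHom.fst ℝ FinAdele) y • UpperHalfPlane.I)

/-- The automorphic form `Ψ` on `GU(1,1)(𝔸)` attached to `f`. -/
def adelicLift {N ℓ : ℕ} (f : CuspForms N ℓ) {d : ℕ}
    (x : Matrix (Fin 2) (Fin 2) (LAlg d Adele)) : ℂ :=
  theValue (IsLiftValue f x)

/-- The standard additive character of the adeles: it is trivial on `ℚ`, is `x ↦ e^{2πix}` at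
the real place, and its component at each prime `q` has conductor `ℤ_q`. -/
structure IsStandardChar (ψ : AddChar Adele Circle) : Prop where
  continuous : Continuous ψ
  trivial_rat : ∀ r : ℚ, ψ (ratToAdele r) = 1
  real : ∀ x : ℝ, ψ (x, 0) = Real.fourierChar x
  trivial_int : ∀ (q : Nat.Primes) (x : Adele), x.1 = 0 →
    (∀ q', q' ≠ q → toPadic q' x = 0) → ‖toPadic q x‖ ≤ 1 → ψ x = 1
  conductor : ∀ q : Nat.Primes, ∃ x : Adele, x.1 = 0 ∧
    (∀ q', q' ≠ q → toPadic q' x = 0) ∧ ‖toPadic q x‖ ≤ (q : ℕ) ∧ ψ x ≠ 1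

/-- The Whittaker function `W_Ψ(x) = ∫_{ℚ \ 𝔸} Ψ((1, t; 0, 1) x) ψ(-t) dt` on `GU(1,1)(𝔸)`. -/
def whittaker {N ℓ : ℕ} (f : CuspForms N ℓ) (ψ : AddChar Adele Circle) (ν : Measure AdeleQuot)
    {d : ℕ} (x : Ftilde d Adele) : ℂ :=
  ∫ t : AdeleQuot, adelicLift f
      (!![1, algebraMap Adele (LAlg d Adele) (Quotient.out t); 0, 1] *
        (x.1 : Matrix (Fin 2) (Fin 2) (LAlg d Adele))) *
    (ψ (-Quotient.out t) : ℂ) ∂ν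

/-- `Wp` is a component at `p` of `W`: one has `W(x) = Wp(x_p) W'(x)` where the function `W'`
is not zero and only depends on the components of `x` away from `p`.  For the function `W_Ψ` of a
newform such a factorization exists and determines `Wp` up to a nonzero constant factor. -/
def IsLocalComponent {d : ℕ} (p : Nat.Primes) (W : Ftilde d Adele → ℂ)
    (Wp : Ftilde d ℚ_[p] → ℂ) : Prop :=
  ∃ W' : Ftilde d Adele → ℂ,
    (∀ x y, Ftilde.map (RingHom.fst ℝ FinAdele) x = Ftilde.map (RingHom.fst ℝ FinAdele) y →
      (∀ q, q ≠ p → Ftilde.map (toPadic q) x = Ftilde.map (toPadic q) y) → W' x = W' y) ∧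
    (∃ x, W' x ≠ 0) ∧
    ∀ x, W x = Wp (Ftilde.map (toPadic p) x) * W' x

/-! ### The local zeta integral -/

instance (d : ℕ) (p : Nat.Primes) : MeasurableSpace (Ftilde₁ d ℚ_[p]) := borel _

instance (d : ℕ) (p : Nat.Primes) : BorelSpace (Ftilde₁ d ℚ_[p]) := ⟨rfl⟩

/-- The integrand `h ↦ Υ_p(Q ι(k, h), s) W_p(g h) Λ_p⁻¹(det h)`. -/
def zetaIntegrand {d : ℕ} (b : ℤ) {p : Nat.Primes} (Λ : (LAlg d ℚ_[p])ˣ →* Circle)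
    (Wp : Ftilde d ℚ_[p] → ℂ) (g : Ftilde d ℚ_[p])
    (k : Matrix (Fin 2 ⊕ Fin 2) (Fin 2 ⊕ Fin 2) (LAlg d ℚ_[p])) (s : ℂ)
    (h : Ftilde₁ d ℚ_[p]) : ℂ :=
  Upsilon b Λ s (Qmat _ * iota k (h.1.1 : Matrix (Fin 2) (Fin 2) (LAlg d ℚ_[p]))) *
    Wp (g * h.1) * ((Λ (GeneralLinearGroup.det h.1.1))⁻¹ : Circle)

/-- The local zeta integral `Z_p(g, k, s)`. -/
def localZeta {d : ℕ} (b : ℤ) {p : Nat.Primes} (Λ : (LAlg d ℚ_[p])ˣ →* Circle)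
    (μ : Measure (Ftilde₁ d ℚ_[p])) (Wp : Ftilde d ℚ_[p] → ℂ) (g : Ftilde d ℚ_[p])
    (k : Matrix (Fin 2 ⊕ Fin 2) (Fin 2 ⊕ Fin 2) (LAlg d ℚ_[p])) (s : ℂ) : ℂ :=
  ∫ h, zetaIntegrand b Λ Wp g k s h ∂μ

end

end Pullback

open Pullback

namespace Pullback

noncomputable section

/-! ### The unramified quadratic algebra -/

/-! Left multiplication by the Siegel parabolic only multiplies the lower half of a matrix on the
left, so a coset `P t` is the Lagrangian spanned by the rows of that lower half. In the chart where
the columns `f₁, f₂, e₃` are invertible, the Lagrangian has a coordinate matrix `S`, Hermitian up to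
signs. The support of `Υ_p` turns out to be the set where `S` is integral, its upper left two-by-two
block vanishes modulo `p` and the residue of `S 2 1` lies in `𝔽_p`. The residue of `S 2 0` is free
and only separates the cells of `Q` and `Ω`. On the support, `Υ_p` is `Λ` times a power of the
absolute value, both taken at the determinant of the three pivot columns
(`pivotForm_of_isUpsilonValue`, `isUpsilonValue_of_pivotForm`, `Upsilon_eq`).

For `h = (x, y; z, w)` in `U(1,1)(ℚ_p)` this becomes explicit. Along `s₂`, `s₃`, `Θ s₂`, `Θ s₄`, `Θ
s₅` the section vanishes identically. Along `s₁` the support is `|x| ≥ 1`, `|y| ≤ |x|`, `|z| < |x|`,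
because `1/x` stands at the unconstrained place `(2,0)`. Along `1` and `Θ` it stands at `(2,1)`,
which adds the condition that `1/x` be rational modulo `p` (`Upsilon_Y`). Since `det h = x / x̄` and
`Λ(x̄) = Λ(x)⁻¹`, the integrand on the support is `Λ(x)⁻¹ |x|^(-6(s+1/2)) W(g h)`.

The prime `p` does not divide `N`, so `W` is right invariant under scalars and `GL₂(ℤ_p)`, hence
under the integral `h` with `p ∣ z`, each of which is a scalar times an element of `GL₂(ℤ_p)`. Right
translation by `diag(u, ū⁻¹)` with `u` a unit therefore multiplies the integrand by `Λ(u)⁻¹`. As `Λ`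
is not trivial on units, every part of the support that is stable under these translations
integrates to zero (`integral_supportIntegrand_eq_zero`). This settles `s₁`. For `1` and `Θ` the
part `|x| > 1` is stable, because there `1/x` is divisible by `p`. The part `|x| = 1` is exactly
`rationalSubgroup`, where the integrand is the constant `W(g)`. The volume of that subgroup is
`1/(p+1)²`: one index `p + 1` counts the points of the projective line over `𝔽_p`, the other counts
`𝔽_{p²}ˣ / 𝔽_pˣ` (`measure_KF₁`, `measure_lowerSubgroup`).

For convergence, `W` is bounded because `f` is a cusp form. The part `|x| = pⁿ` of the support meets
at most `p^(2n+3)` cosets of `rationalSubgroup`, so the integral is dominated by a geometric series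
of ratio `p^(-1-6σ)` with `σ = Re s`, which converges for `σ > -1/6`. -/

/-- The odd prime `p` is inert in `ℚ(√-d)`. -/
class InertAt (d : ℕ) (p : Nat.Primes) : Prop where
  odd : (p : ℕ) ≠ 2
  legendre : legendreSym p (-(d : ℤ)) = -1

theorem toZMod_eq_zero_iff_norm_lt {p : Nat.Primes} (x : ℤ_[p]) :
    PadicInt.toZMod x = 0 ↔ ‖x‖ < 1 := by
  rw [← RingHom.mem_ker, PadicInt.ker_toZMod, IsLocalRing.mem_maximalIdeal,
    PadicInt.mem_nonunits]

section Inert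

variable {d : ℕ} {p : Nat.Primes}

theorem InertAt.sq_add_ne_zero [h : InertAt d p] (r : ZMod p) : r ^ 2 + d ≠ 0 := by
  intro hr
  have hl := (legendreSym.eq_neg_one_iff (p := p) (a := -(d : ℤ))).1 h.legendre
  apply hl
  refine ⟨r, ?_⟩
  push_cast
  linear_combination -hr

theorem InertAt.natCast_ne_zero (h : InertAt d p) : (d : ZMod p) ≠ 0 := by
  have := h.sq_add_ne_zero 0
  simpa using this

theorem InertAt.two_ne_zero (h : InertAt d p) : (2 : ZMod p) ≠ 0 := by
  intro h2
  have : ((2 : ℕ) : ZMod p) = 0 := by exact_mod_cast h2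
  rw [ZMod.natCast_eq_zero_iff, Nat.prime_dvd_prime_iff_eq p.2 Nat.prime_two] at this
  exact h.odd this

theorem norm_intCast_padic_eq_one {p : Nat.Primes} {n : ℕ} (hn : (n : ZMod p) ≠ 0) :
    ‖(n : ℚ_[p])‖ = 1 := by
  have h1 : ‖(n : ℤ_[p])‖ = 1 := by
    by_contra h
    have h2 : ‖(n : ℤ_[p])‖ < 1 := lt_of_le_of_ne (PadicInt.norm_le_one _) h
    rw [← toZMod_eq_zero_iff_norm_lt, map_natCast] at h2
    exact hn h2
  rw [PadicInt.norm_def] at h1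
  simpa using h1

theorem InertAt.norm_natCast (h : InertAt d p) : ‖(d : ℚ_[p])‖ = 1 :=
  norm_intCast_padic_eq_one h.natCast_ne_zero

theorem InertAt.norm_two (h : InertAt d p) : ‖(2 : ℚ_[p])‖ = 1 := by
  have := norm_intCast_padic_eq_one (p := p) (n := 2) (by simpa using h.two_ne_zero)
  simpa using this

/-- As `d` is a unit, the two terms have different absolute values unless `|x| = |y|`. In that case
division by `y²` leaves `r² + d` with `r` integral, a unit because `-d` is not a square modulo `p`.
-/
theorem InertAt.norm_sq_add_mul_sq (h : InertAt d p) (x y : ℚ_[p]) :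
    ‖x ^ 2 + d * y ^ 2‖ = max ‖x‖ ‖y‖ ^ 2 := by
  have hdy : ‖(d : ℚ_[p]) * y ^ 2‖ = ‖y‖ ^ 2 := by rw [norm_mul, h.norm_natCast, one_mul, norm_pow]
  by_cases hne : ‖x‖ = ‖y‖
  · rcases eq_or_ne y 0 with rfl | hy
    · have : x = 0 := by simpa using hne
      simp [this]
    · have hr : ‖x / y‖ = 1 := by rw [norm_div, hne, div_self (norm_ne_zero_iff.2 hy)]
      have hr' : ‖(x / y) ^ 2 + d‖ = 1 := by
        let r : ℤ_[p] := ⟨x / y, hr.le⟩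
        have h1 : ‖r ^ 2 + (d : ℤ_[p])‖ = 1 := by
          by_contra hc
          have h2 : ‖r ^ 2 + (d : ℤ_[p])‖ < 1 := lt_of_le_of_ne (PadicInt.norm_le_one _) hc
          rw [← toZMod_eq_zero_iff_norm_lt, map_add, map_pow, map_natCast] at h2
          exact h.sq_add_ne_zero _ h2
        rw [PadicInt.norm_def] at h1
        exact_mod_cast h1
      have : x ^ 2 + d * y ^ 2 = ((x / y) ^ 2 + d) * y ^ 2 := by field_simp
      rw [this, norm_mul, hr', one_mul, norm_pow, hne, max_self]
  · have hne' : ‖x ^ 2‖ ≠ ‖(d : ℚ_[p]) * y ^ 2‖ := by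
      rw [hdy, norm_pow]
      intro hc
      exact hne ((pow_left_inj₀ (norm_nonneg _) (norm_nonneg _) (by norm_num)).1 hc)
    rw [Padic.add_eq_max_of_ne hne', hdy, norm_pow]
    rcases le_total ‖x‖ ‖y‖ with hxy | hxy
    · rw [max_eq_right hxy, max_eq_right (pow_le_pow_left₀ (norm_nonneg _) hxy 2)]
    · rw [max_eq_left hxy, max_eq_left (pow_le_pow_left₀ (norm_nonneg _) hxy 2)]

/-- A square root `r` of `-d` would make the norm form vanish at `(r, 1)`. In this form the fact
turns `LAlg d ℚ_[p]` into a field. -/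
instance InertAt.fact [h : InertAt d p] :
    Fact (∀ r : ℚ_[p], r ^ 2 ≠ -(d : ℚ_[p]) + 0 * r) := ⟨fun r hr => by
  have h1 := h.norm_sq_add_mul_sq r 1
  have h2 : r ^ 2 + d * 1 ^ 2 = 0 := by linear_combination hr
  rw [h2, norm_zero, norm_one] at h1
  have h3 : (1 : ℝ) ≤ max ‖r‖ 1 := le_max_right _ _
  nlinarith⟩

/-- The absolute value of `L_p` that extends the one of `ℚ_p`. -/
def qabs (x : LAlg d ℚ_[p]) : ℝ := max ‖x.re‖ ‖x.im‖

theorem qabs_nonneg (x : LAlg d ℚ_[p]) : 0 ≤ qabs x := (norm_nonneg _).trans (le_max_left _ _)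

theorem norm_re_le_qabs (x : LAlg d ℚ_[p]) : ‖x.re‖ ≤ qabs x := le_max_left _ _

theorem norm_im_le_qabs (x : LAlg d ℚ_[p]) : ‖x.im‖ ≤ qabs x := le_max_right _ _

/-- `qabs` inherits its multiplicativity from the norm through this identity. -/
theorem norm_norm_eq_qabs_sq [h : InertAt d p] (x : LAlg d ℚ_[p]) :
    ‖QuadraticAlgebra.norm x‖ = qabs x ^ 2 := by
  rw [qabs, ← h.norm_sq_add_mul_sq, QuadraticAlgebra.norm_def]
  congr 1
  ring

theorem qabs_mul [InertAt d p] (x y : LAlg d ℚ_[p]) : qabs (x * y) = qabs x * qabs y := by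
  rw [← pow_left_inj₀ (qabs_nonneg _) (mul_nonneg (qabs_nonneg _) (qabs_nonneg _))
    (two_ne_zero), mul_pow, ← norm_norm_eq_qabs_sq, ← norm_norm_eq_qabs_sq,
    ← norm_norm_eq_qabs_sq, map_mul, norm_mul]

theorem qabs_add_le (x y : LAlg d ℚ_[p]) : qabs (x + y) ≤ max (qabs x) (qabs y) := by
  refine max_le ?_ ?_
  · refine (Padic.nonarchimedean _ _).trans (max_le_max ?_ ?_) <;> exact le_max_left _ _
  · refine (Padic.nonarchimedean _ _).trans (max_le_max ?_ ?_) <;> exact le_max_right _ _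

theorem qabs_neg (x : LAlg d ℚ_[p]) : qabs (-x) = qabs x := by simp [qabs]

theorem qabs_sub_le (x y : LAlg d ℚ_[p]) : qabs (x - y) ≤ max (qabs x) (qabs y) := by
  rw [sub_eq_add_neg, ← qabs_neg y]
  exact qabs_add_le _ _

theorem qabs_star (x : LAlg d ℚ_[p]) : qabs (star x) = qabs x := by simp [qabs]

theorem qabs_one : qabs (1 : LAlg d ℚ_[p]) = 1 := by
  simp [qabs, QuadraticAlgebra.re_one, QuadraticAlgebra.im_one]

theorem qabs_zero : qabs (0 : LAlg d ℚ_[p]) = 0 := by simp [qabs]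

theorem qabs_algebraMap (r : ℚ_[p]) : qabs (algebraMap ℚ_[p] (LAlg d ℚ_[p]) r) = ‖r‖ := by
  simp [qabs]

theorem qabs_eq_zero_iff (x : LAlg d ℚ_[p]) : qabs x = 0 ↔ x = 0 := by
  refine ⟨fun h => ?_, fun h => by rw [h, qabs_zero]⟩
  have h1 := norm_re_le_qabs x
  have h2 := norm_im_le_qabs x
  rw [h] at h1 h2
  ext
  · simpa using h1
  · simpa using h2

theorem qabs_pos {x : LAlg d ℚ_[p]} (hx : x ≠ 0) : 0 < qabs x :=
  lt_of_le_of_ne (qabs_nonneg x) (fun h => hx ((qabs_eq_zero_iff x).1 h.symm))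

theorem qabs_inv [InertAt d p] (x : LAlg d ℚ_[p]) : qabs x⁻¹ = (qabs x)⁻¹ := by
  rcases eq_or_ne x 0 with rfl | hx
  · simp [qabs_zero]
  · refine eq_inv_of_mul_eq_one_left ?_
    rw [← qabs_mul, inv_mul_cancel₀ hx, qabs_one]

theorem qabs_div [InertAt d p] (x y : LAlg d ℚ_[p]) : qabs (x / y) = qabs x / qabs y := by
  rw [div_eq_mul_inv, qabs_mul, qabs_inv, div_eq_mul_inv]

theorem qabs_add_eq_left {x y : LAlg d ℚ_[p]} (h : qabs y < qabs x) : qabs (x + y) = qabs x := by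
  refine le_antisymm ((qabs_add_le x y).trans (max_le le_rfl h.le)) ?_
  have h1 := qabs_sub_le (x + y) y
  rw [add_sub_cancel_right] at h1
  by_contra hc
  rw [not_le] at hc
  exact absurd h1 (not_le.2 (max_lt hc h))

theorem exists_intIncl_eq_iff (x : LAlg d ℚ_[p]) :
    (∃ z : LAlg d ℤ_[p], intIncl d p z = x) ↔ qabs x ≤ 1 := by
  constructor
  · rintro ⟨z, rfl⟩
    exact max_le (PadicInt.norm_le_one z.re) (PadicInt.norm_le_one z.im)
  · intro h
    exact ⟨⟨⟨x.re, (norm_re_le_qabs x).trans h⟩, ⟨x.im, (norm_im_le_qabs x).trans h⟩⟩, rfl⟩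

theorem qabs_intIncl_le (z : LAlg d ℤ_[p]) : qabs (intIncl d p z) ≤ 1 :=
  (exists_intIncl_eq_iff _).1 ⟨z, rfl⟩

theorem intIncl_injective : Function.Injective (intIncl d p) := by
  intro z w h
  have h1 := congrArg QuadraticAlgebra.re h
  have h2 := congrArg QuadraticAlgebra.im h
  ext
  · exact Subtype.ext h1
  · exact Subtype.ext h2

/-- Reduction of `ℤ_{L,p}` modulo `p`. -/
def residue (d : ℕ) (p : Nat.Primes) : LAlg d ℤ_[p] →+* LAlg d (ZMod p) :=
  LAlg.map PadicInt.toZMod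

theorem residue_im (z : LAlg d ℤ_[p]) : (residue d p z).im = PadicInt.toZMod z.im := rfl

theorem residue_im_eq_zero_iff (z : LAlg d ℤ_[p]) :
    (residue d p z).im = 0 ↔ ‖(intIncl d p z).im‖ < 1 :=
  toZMod_eq_zero_iff_norm_lt _

theorem residue_eq_zero_iff (z : LAlg d ℤ_[p]) : residue d p z = 0 ↔ qabs (intIncl d p z) < 1 := by
  rw [qabs, max_lt_iff, QuadraticAlgebra.ext_iff]
  exact and_congr (toZMod_eq_zero_iff_norm_lt _) (toZMod_eq_zero_iff_norm_lt _)

theorem isUnit_iff_qabs_eq_one [InertAt d p] (z : LAlg d ℤ_[p]) :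
    IsUnit z ↔ qabs (intIncl d p z) = 1 := by
  constructor
  · rintro ⟨u, rfl⟩
    have h1 := qabs_intIncl_le (u : LAlg d ℤ_[p])
    have h2 := qabs_intIncl_le ((u⁻¹ : (LAlg d ℤ_[p])ˣ) : LAlg d ℤ_[p])
    have h3 : qabs (intIncl d p u) * qabs (intIncl d p (u⁻¹ : (LAlg d ℤ_[p])ˣ)) = 1 := by
      rw [← qabs_mul, ← map_mul, Units.mul_inv, map_one, qabs_one]
    nlinarith [qabs_nonneg (intIncl d p u), qabs_nonneg (intIncl d p (u⁻¹ : (LAlg d ℤ_[p])ˣ))]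
  · intro h
    have h0 : intIncl d p z ≠ 0 := fun h0 => by rw [h0, qabs_zero] at h; norm_num at h
    have h1 : qabs (intIncl d p z)⁻¹ ≤ 1 := by rw [qabs_inv, h, inv_one]
    obtain ⟨w, hw⟩ := (exists_intIncl_eq_iff _).2 h1
    refine IsUnit.of_mul_eq_one w (intIncl_injective ?_)
    rw [map_mul, hw, mul_inv_cancel₀ h0, map_one]

theorem isUnit_of_residue_ne_zero [InertAt d p] {z : LAlg d ℤ_[p]} (h : residue d p z ≠ 0) :
    IsUnit z := by
  rw [isUnit_iff_qabs_eq_one]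
  rw [Ne, residue_eq_zero_iff, not_lt] at h
  exact le_antisymm (qabs_intIncl_le z) h

/-! ### The character `Λ` as a multiplicative function on `L_p` -/

/-- The character `Λ`, extended by zero. -/
def charFun (Λ : (LAlg d ℚ_[p])ˣ →* Circle) : MulChar (LAlg d ℚ_[p]) ℂ :=
  MulChar.ofUnitHom (Circle.toUnits.comp Λ)

theorem charFun_coe (Λ : (LAlg d ℚ_[p])ˣ →* Circle) (u : (LAlg d ℚ_[p])ˣ) :
    charFun Λ u = (Λ u : ℂ) := by
  rw [charFun, MulChar.ofUnitHom_coe]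
  rfl

variable {Λ : (LAlg d ℚ_[p])ˣ →* Circle}

theorem norm_charFun [InertAt d p] {x : LAlg d ℚ_[p]} (hx : x ≠ 0) : ‖charFun Λ x‖ = 1 := by
  obtain ⟨u, rfl⟩ := hx.isUnit
  rw [charFun_coe]
  exact Circle.norm_coe _

theorem charFun_ne_zero [InertAt d p] {x : LAlg d ℚ_[p]} (hx : x ≠ 0) : charFun Λ x ≠ 0 := by
  rw [← norm_ne_zero_iff, norm_charFun hx]
  exact one_ne_zero

theorem IsAdmissible.charFun_algebraMap (hΛ : IsAdmissible Λ) {r : ℚ_[p]} (hr : r ≠ 0) :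
    charFun Λ (algebraMap _ _ r) = 1 := by
  have h := hΛ.trivial_base (Units.mk0 r hr)
  have h2 := charFun_coe Λ (Units.map (algebraMap ℚ_[p] (LAlg d ℚ_[p])).toMonoidHom
    (Units.mk0 r hr))
  rw [h] at h2
  simpa using h2

/-- The product `x x̄` is a norm and so lies in `ℚ_pˣ`, where `Λ` is trivial. Conjugation thus
inverts `Λ`. -/
theorem IsAdmissible.charFun_mul_star [InertAt d p] (hΛ : IsAdmissible Λ) {x : LAlg d ℚ_[p]}
    (hx : x ≠ 0) : charFun Λ x * charFun Λ (star x) = 1 := by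
  rw [← map_mul, ← QuadraticAlgebra.algebraMap_norm_eq_mul_star]
  refine hΛ.charFun_algebraMap ?_
  rwa [Ne, QuadraticAlgebra.norm_eq_zero_iff_eq_zero]

theorem IsAdmissible.charFun_eq_one [InertAt d p] (hΛ : IsAdmissible Λ) {x : LAlg d ℚ_[p]}
    (hx : qabs x = 1) (him : ‖x.im‖ < 1) : charFun Λ x = 1 := by
  obtain ⟨z, rfl⟩ := (exists_intIncl_eq_iff x).2 hx.le
  obtain ⟨u, rfl⟩ := (isUnit_iff_qabs_eq_one z).2 hx
  have h := hΛ.trivial_sub u (by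
    rw [← Ideal.mem_span_singleton, ← PadicInt.maximalIdeal_eq_span_p,
      IsLocalRing.mem_maximalIdeal, PadicInt.mem_nonunits]
    exact him)
  have h2 := charFun_coe Λ (Units.map (intIncl d p).toMonoidHom u)
  rw [h] at h2
  simpa using h2

theorem IsAdmissible.exists_charFun_ne_one [InertAt d p] (hΛ : IsAdmissible Λ) :
    ∃ x : LAlg d ℚ_[p], qabs x = 1 ∧ charFun Λ x ≠ 1 := by
  obtain ⟨u, hu⟩ := hΛ.nontrivial
  refine ⟨intIncl d p u, (isUnit_iff_qabs_eq_one _).1 u.isUnit, fun h => hu ?_⟩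
  have h2 := charFun_coe Λ (Units.map (intIncl d p).toMonoidHom u)
  rw [Units.coe_map] at h2
  change charFun Λ (intIncl d p u) = _ at h2
  rw [h] at h2
  exact Circle.ext h2.symm

end Inert

/-! ### Pivot columns and the Siegel decomposition -/

section Frames

variable {R S : Type*} [CommRing R] [CommRing S]

/-- The columns `f₁, f₂, e₃` of the lower half of a matrix of size six. -/
def pivotCols (t : Matrix (Fin 3 ⊕ Fin 3) (Fin 3 ⊕ Fin 3) R) : Matrix (Fin 3) (Fin 3) R :=
  t.submatrix Sum.inr ![Sum.inr 0, Sum.inr 1, Sum.inl 2]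

/-- The columns `e₁, e₂, f₃` of the lower half of a matrix of size six. -/
def complCols (t : Matrix (Fin 3 ⊕ Fin 3) (Fin 3 ⊕ Fin 3) R) : Matrix (Fin 3) (Fin 3) R :=
  t.submatrix Sum.inr ![Sum.inl 0, Sum.inl 1, Sum.inr 2]

/-- The common form of `Q` (at `a = 0`) and of `Ω` (at `a = α`). -/
def frame (a a' : R) : Matrix (Fin 3 ⊕ Fin 3) (Fin 3 ⊕ Fin 3) R :=
  fromBlocks !![a, 1, 0; 1, 0, 0; 0, 0, 0] !![0, 0, 0; 0, 0, 0; 0, 0, -1]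
    !![0, 0, 0; 0, 0, 0; a, 1, 1] !![0, 1, -1; 1, -a', 0; 0, 0, 0]

theorem Qmat_eq_frame : Qmat R = frame 0 0 := by
  simp [Qmat, frame]

theorem Omega_eq_frame (d : ℕ) (b : ℤ) (p : Nat.Primes) :
    Omega d b p = frame (alpha d b p) (star (alpha d b p)) := by
  refine Matrix.ext fun i j => ?_
  fin_cases i <;> fin_cases j <;>
    simp [Omega, Qmat, frame, iota, Theta, addCorner, Matrix.mul_apply, Fintype.sum_sum_type,
      Fin.sum_univ_three, toBlocks₁₁, toBlocks₁₂, toBlocks₂₁, toBlocks₂₂]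

theorem frame_map (φ : R →+* S) (a a' : R) : (frame a a').map φ = frame (φ a) (φ a') := by
  ext i j
  fin_cases i <;> fin_cases j <;> simp [frame]

theorem pivotCols_map (φ : R →+* S) (t : Matrix (Fin 3 ⊕ Fin 3) (Fin 3 ⊕ Fin 3) R) :
    pivotCols (t.map φ) = (pivotCols t).map φ := rfl

theorem complCols_map (φ : R →+* S) (t : Matrix (Fin 3 ⊕ Fin 3) (Fin 3 ⊕ Fin 3) R) :
    complCols (t.map φ) = (complCols t).map φ := rfl

/-- The form `J_n` over a commutative ring. -/
abbrev Jform (n : ℕ) (R : Type*) [CommRing R] : Matrix (Fin n ⊕ Fin n) (Fin n ⊕ Fin n) R :=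
  (Jmat n).map (Int.cast : ℤ → R)

theorem Jform_eq (n : ℕ) : Jform n R = fromBlocks 0 1 (-1) 0 := by
  ext i j
  rcases i with i | i <;> rcases j with j | j <;> simp [Jform, Jmat, Matrix.one_apply]

theorem Jform_mul_self (n : ℕ) : Jform n R * Jform n R = -1 := by
  rw [Jform_eq, fromBlocks_multiply, ← fromBlocks_one, fromBlocks_neg]
  simp

theorem Jform_det_isUnit (n : ℕ) : IsUnit (Jform n R).det := by
  rw [← Matrix.isUnit_iff_isUnit_det]
  refine IsUnit.of_mul_eq_one (-Jform n R) ?_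
  rw [Matrix.mul_neg, Jform_mul_self, neg_neg]

variable [StarRing R]

/-- The matrix `t` is unitary for the form `J_n`. -/
def IsJUnitary {n : ℕ} (t : Matrix (Fin n ⊕ Fin n) (Fin n ⊕ Fin n) R) : Prop :=
  tᴴ * Jform n R * t = Jform n R

theorem IsJUnitary.mul {n : ℕ} {t u : Matrix (Fin n ⊕ Fin n) (Fin n ⊕ Fin n) R}
    (ht : IsJUnitary t) (hu : IsJUnitary u) : IsJUnitary (t * u) := by
  unfold IsJUnitary at *
  rw [conjTranspose_mul]
  calc _ = uᴴ * (tᴴ * Jform n R * t) * u := by simp only [Matrix.mul_assoc]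
    _ = _ := by rw [ht, hu]

theorem IsJUnitary.left_inv {n : ℕ} {t : Matrix (Fin n ⊕ Fin n) (Fin n ⊕ Fin n) R}
    (ht : IsJUnitary t) : (-(Jform n R * tᴴ * Jform n R)) * t = 1 := by
  unfold IsJUnitary at ht
  calc _ = -(Jform n R * (tᴴ * Jform n R * t)) := by
        simp only [Matrix.mul_assoc, Matrix.neg_mul]
    _ = _ := by rw [ht, Jform_mul_self, neg_neg]

theorem IsJUnitary.right_inv {n : ℕ} {t : Matrix (Fin n ⊕ Fin n) (Fin n ⊕ Fin n) R}
    (ht : IsJUnitary t) : t * (-(Jform n R * tᴴ * Jform n R)) = 1 :=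
  mul_eq_one_comm.1 ht.left_inv

theorem IsJUnitary.mul_Jform_mul {n : ℕ} {t : Matrix (Fin n ⊕ Fin n) (Fin n ⊕ Fin n) R}
    (ht : IsJUnitary t) : t * Jform n R * tᴴ = Jform n R := by
  have h := ht.right_inv
  calc _ = (t * (-(Jform n R * tᴴ * Jform n R))) * Jform n R := by
        simp only [Matrix.mul_assoc, Matrix.mul_neg, Matrix.neg_mul, Jform_mul_self, neg_neg,
          Matrix.mul_one]
    _ = _ := by rw [h, Matrix.one_mul]

theorem IsJUnitary.star_det_mul_det {n : ℕ} {t : Matrix (Fin n ⊕ Fin n) (Fin n ⊕ Fin n) R}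
    (ht : IsJUnitary t) : star t.det * t.det = 1 := by
  have h := congrArg Matrix.det ht
  rw [det_mul, det_mul, det_conjTranspose] at h
  have hu := Jform_det_isUnit (R := R) n
  refine hu.mul_left_cancel ?_
  linear_combination h

theorem IsJUnitary.exists_GL {n : ℕ} {t : Matrix (Fin n ⊕ Fin n) (Fin n ⊕ Fin n) R}
    (ht : IsJUnitary t) : ∃ k : GL (Fin n ⊕ Fin n) R, (k : Matrix _ _ R) = t :=
  ⟨⟨t, _, ht.right_inv, ht.left_inv⟩, rfl⟩

theorem isJUnitary_fromBlocks_iff {n : ℕ} {A B C D : Matrix (Fin n) (Fin n) R} :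
    IsJUnitary (fromBlocks A B C D) ↔
      Aᴴ * C = Cᴴ * A ∧ Bᴴ * D = Dᴴ * B ∧ Aᴴ * D - Cᴴ * B = 1 := by
  unfold IsJUnitary
  rw [Jform_eq, fromBlocks_conjTranspose, fromBlocks_multiply, fromBlocks_multiply,
    fromBlocks_inj]
  simp only [Matrix.mul_zero, Matrix.mul_one, add_zero,
    zero_add, Matrix.mul_neg, Matrix.neg_mul, neg_add_eq_zero]
  constructor
  · rintro ⟨h1, h2, -, h4⟩
    exact ⟨h1.symm, h4.symm, by rw [← h2]; abel⟩
  · rintro ⟨h1, h2, h3⟩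
    refine ⟨h1.symm, by rw [← h3]; abel, ?_, h2.symm⟩
    have := congrArg conjTranspose h3
    rw [conjTranspose_sub, conjTranspose_mul, conjTranspose_mul, conjTranspose_conjTranspose,
      conjTranspose_conjTranspose, conjTranspose_one] at this
    rw [← this]; abel

theorem isJUnitary_frame (a : R) : IsJUnitary (frame a (star a)) := by
  rw [frame, isJUnitary_fromBlocks_iff]
  simp [← Matrix.ext_iff, Fin.forall_fin_succ, Matrix.mul_apply, Fin.sum_univ_three]

/-- Two unitary matrices whose lower halves span the same Lagrangian differ by an element of the
Siegel parabolic. -/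
theorem IsJUnitary.exists_siegel {n : ℕ} {t Y : Matrix (Fin n ⊕ Fin n) (Fin n ⊕ Fin n) R}
    (ht : IsJUnitary t) (hY : IsJUnitary Y) {D : Matrix (Fin n) (Fin n) R}
    (hD : t.submatrix Sum.inr id = D * Y.submatrix Sum.inr id) :
    ∃ (A : GL (Fin n) R) (B : Matrix (Fin n) (Fin n) R), Bᴴ = B ∧
      ((A⁻¹ : GL (Fin n) R) : Matrix (Fin n) (Fin n) R)ᴴ = D ∧
      t = fromBlocks 1 B 0 1 *
        fromBlocks A 0 0 ((A⁻¹ : GL (Fin n) R) : Matrix (Fin n) (Fin n) R)ᴴ * Y := by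
  set Yi := -(Jform n R * Yᴴ * Jform n R) with hYi
  have hY1 : Yi * Y = 1 := hY.left_inv
  have hY2 : Y * Yi = 1 := hY.right_inv
  have hYiu : IsJUnitary Yi := by
    have h := hY
    unfold IsJUnitary at h ⊢
    have h2 : Yᴴ * Yiᴴ = 1 := by
      have := congrArg conjTranspose hY1
      rwa [conjTranspose_mul, conjTranspose_one] at this
    have h2' : Yiᴴ * Yᴴ = 1 := mul_eq_one_comm.1 h2
    calc _ = Yiᴴ * (Yᴴ * Jform n R * Y) * Yi := by rw [h]
      _ = (Yiᴴ * Yᴴ) * Jform n R * (Y * Yi) := by simp only [Matrix.mul_assoc]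
      _ = _ := by rw [h2', hY2, Matrix.one_mul, Matrix.mul_one]
  -- The matrix `t Y⁻¹` is unitary with lower half `(0, D)`. Unitarity then forces its upper left
  -- block to be the inverse of `Dᴴ`, and makes the unipotent part Hermitian.
  have hT := ht.mul hYiu
  have hb : (t * Yi).submatrix Sum.inr id = D * (1 : Matrix (Fin n ⊕ Fin n) _ R).submatrix
      Sum.inr id := by
    have e1 : (t * Yi).submatrix Sum.inr id = t.submatrix Sum.inr id * Yi := rfl
    have e2 : (Y * Yi).submatrix Sum.inr id = Y.submatrix Sum.inr id * Yi := rfl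
    rw [e1, hD, Matrix.mul_assoc, ← e2, hY2]
  have h21 : (t * Yi).toBlocks₂₁ = 0 := by
    ext i j
    have := congrFun (congrFun hb i) (Sum.inl j)
    simpa [Matrix.mul_apply, toBlocks₂₁] using this
  have h22 : (t * Yi).toBlocks₂₂ = D := by
    ext i j
    have := congrFun (congrFun hb i) (Sum.inr j)
    simpa [Matrix.mul_apply, toBlocks₂₂, Matrix.one_apply] using this
  have hT' := fromBlocks_toBlocks (t * Yi)
  rw [h21, h22] at hT'
  rw [← hT', isJUnitary_fromBlocks_iff] at hT
  obtain ⟨-, hBD, hAD⟩ := hT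
  rw [conjTranspose_zero, Matrix.zero_mul, sub_zero] at hAD
  set A := (t * Yi).toBlocks₁₁ with hA
  set B := (t * Yi).toBlocks₁₂ with hB
  have hDA : Dᴴ * A = 1 := by
    have := congrArg conjTranspose hAD
    rwa [conjTranspose_mul, conjTranspose_one, conjTranspose_conjTranspose] at this
  have hAD' : A * Dᴴ = 1 := mul_eq_one_comm.1 hDA
  have hDA' : D * Aᴴ = 1 := mul_eq_one_comm.1 hAD
  refine ⟨⟨A, Dᴴ, hAD', hDA⟩, B * Aᴴ, ?_, conjTranspose_conjTranspose D, ?_⟩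
  · rw [conjTranspose_mul, conjTranspose_conjTranspose]
    calc A * Bᴴ = A * (Bᴴ * D) * Aᴴ := by
          rw [Matrix.mul_assoc, Matrix.mul_assoc, hDA', Matrix.mul_one]
      _ = (A * Dᴴ) * B * Aᴴ := by rw [hBD]; simp only [Matrix.mul_assoc]
      _ = _ := by rw [hAD', Matrix.one_mul]
  · have e : fromBlocks (1 : Matrix (Fin n) (Fin n) R) (B * Aᴴ) 0 1 * fromBlocks A 0 0 D =
        t * Yi := by
      rw [fromBlocks_multiply, ← hT']
      simp [Matrix.mul_assoc, hAD]
    calc t = t * (Yi * Y) := by rw [hY1, Matrix.mul_one]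
      _ = (t * Yi) * Y := by rw [Matrix.mul_assoc]
      _ = fromBlocks 1 (B * Aᴴ) 0 1 * fromBlocks A 0 0 D * Y := by rw [e]
      _ = _ := by
        congr 3
        exact (conjTranspose_conjTranspose D).symm

end Frames

/-! ### Values of the section -/

section Values

/-- The entries of an element of the Borel subgroup of `GSp(6)` over a field. -/
theorem IsBorel.entries {F : Type*} [Field F] {g : Matrix (Fin 3 ⊕ Fin 3) (Fin 3 ⊕ Fin 3) F}
    (hg : IsBorel g) :
    (∀ i j, g (Sum.inr i) (Sum.inl j) = 0) ∧
    (∀ i j, i < j → g (Sum.inl i) (Sum.inl j) = 0) ∧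
    (∀ i j, j < i → g (Sum.inr i) (Sum.inr j) = 0) ∧
    (∀ i, g (Sum.inl i) (Sum.inl i) ≠ 0) ∧ (∀ i, g (Sum.inr i) (Sum.inr i) ≠ 0) := by
  obtain ⟨-, A, B, l, hA, rfl⟩ := hg
  set C : Matrix (Fin 3) (Fin 3) F := ((A⁻¹ : GL (Fin 3) F) : Matrix (Fin 3) (Fin 3) F) with hC
  have hAC : (A : Matrix (Fin 3) (Fin 3) F) * C = 1 := by
    rw [hC, ← Units.val_mul, mul_inv_cancel, Units.val_one]
  have hbt : Matrix.BlockTriangular (A : Matrix (Fin 3) (Fin 3) F) OrderDual.toDual :=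
    fun i j hij => hA i j hij
  have hCt : Matrix.BlockTriangular C OrderDual.toDual := by
    have := Matrix.blockTriangular_inv_of_blockTriangular hbt
    rwa [← Matrix.coe_units_inv] at this
  have hdiag : ∀ i, (A : Matrix (Fin 3) (Fin 3) F) i i * C i i = 1 := by
    intro i
    have h := congrFun (congrFun hAC i) i
    rw [Matrix.mul_apply, Finset.sum_eq_single i, Matrix.one_apply_eq] at h
    · exact h
    · intro j _ hj
      rcases lt_or_gt_of_ne hj with h | h
      · rw [hCt (show OrderDual.toDual i < OrderDual.toDual j from h), mul_zero]
      · rw [hA _ _ h, zero_mul]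
    · simp
  refine ⟨fun i j => rfl, fun i j hij => hA i j hij, fun i j hij => ?_, fun i => ?_, fun i => ?_⟩
  · simp only [fromBlocks_apply₂₂, Matrix.smul_apply, transpose_apply]
    rw [hCt (show OrderDual.toDual i < OrderDual.toDual j from hij), smul_zero]
  · exact left_ne_zero_of_mul_eq_one (hdiag i)
  · simp only [fromBlocks_apply₂₂, Matrix.smul_apply, transpose_apply, smul_eq_mul]
    exact mul_ne_zero l.ne_zero (right_ne_zero_of_mul_eq_one (hdiag i))

variable {d : ℕ} {p : Nat.Primes}

/-- The condition on `t = (*, *; C, D)` under which `t` lies in the support of `Υ_p`: its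
lower half is `E · (pivots | S)`, with `S` integral and reduced modulo `p` as stated. -/
structure HasPivotForm (t : Matrix (Fin 3 ⊕ Fin 3) (Fin 3 ⊕ Fin 3) (LAlg d ℚ_[p]))
    (S : Matrix (Fin 3) (Fin 3) (LAlg d ℤ_[p])) : Prop where
  compl : complCols t = pivotCols t * S.map (intIncl d p)
  det_ne_zero : (pivotCols t).det ≠ 0
  zero₀₀ : residue d p (S 0 0) = 0
  zero₀₁ : residue d p (S 0 1) = 0
  zero₁₀ : residue d p (S 1 0) = 0
  zero₁₁ : residue d p (S 1 1) = 0
  rational : (residue d p (S 2 1)).im = 0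

/-- The value of `Υ_p` at an element `t` of its support. -/
def pivotValue (Λ : (LAlg d ℚ_[p])ˣ →* Circle) (s : ℂ)
    (t : Matrix (Fin 3 ⊕ Fin 3) (Fin 3 ⊕ Fin 3) (LAlg d ℚ_[p])) : ℂ :=
  charFun Λ (pivotCols t).det * (qabs (pivotCols t).det : ℂ) ^ (-6 * (s + 1 / 2))

/-- Matches the power of `|N(det A)|` in the definition of the section with the power of the
absolute value of the pivot determinant, which is `|det A|⁻¹`. -/
theorem cpow_sq_eq_inv_cpow {r : ℝ} (hr : 0 < r) (w : ℂ) :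
    ((r ^ 2 : ℝ) : ℂ) ^ (3 * w) = ((r⁻¹ : ℝ) : ℂ) ^ (-6 * w) := by
  obtain ⟨u, rfl⟩ : ∃ u, r = Real.exp u := ⟨Real.log r, (Real.exp_log hr).symm⟩
  rw [← Real.exp_nat_mul, ← Real.exp_neg, Complex.cpow_def_of_ne_zero (by simp),
    Complex.cpow_def_of_ne_zero (by simp), ← Complex.ofReal_log (Real.exp_pos _).le,
    ← Complex.ofReal_log (Real.exp_pos _).le, Real.log_exp, Real.log_exp]
  congr 1
  push_cast
  ring

theorem IsJUnitary.qabs_det [InertAt d p] {n : ℕ}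
    {t : Matrix (Fin n ⊕ Fin n) (Fin n ⊕ Fin n) (LAlg d ℚ_[p])} (ht : IsJUnitary t) :
    qabs t.det = 1 := by
  have h := congrArg qabs ht.star_det_mul_det
  rw [qabs_mul, qabs_star, qabs_one] at h
  nlinarith [qabs_nonneg t.det]

/-- The reduction modulo `p` of the lower half of an element of `X · I'_p`. -/
theorem residue_frame_mul {κ : GL (Fin 3 ⊕ Fin 3) (LAlg d ℤ_[p])} (hκ : κ ∈ IwahoriH d p)
    (a a' : LAlg d ℤ_[p]) :
    ∃ u₀ u₁ u₂ r : ZMod p, u₀ ≠ 0 ∧ u₁ ≠ 0 ∧ u₂ ≠ 0 ∧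
      ∃ E N, (pivotCols (frame a a' * (κ : Matrix _ _ (LAlg d ℤ_[p])))).map (residue d p) = E ∧
        (complCols (frame a a' * (κ : Matrix _ _ (LAlg d ℤ_[p])))).map (residue d p) = N ∧
        (E 0 0 = 0 ∧ E 0 1 = algebraMap _ _ u₁ ∧ E 0 2 = 0 ∧ E 1 0 = algebraMap _ _ u₀ ∧
          E 1 2 = 0 ∧ E 2 2 = algebraMap _ _ u₂) ∧
        (N 0 0 = 0 ∧ N 0 1 = 0 ∧ N 1 0 = 0 ∧ N 1 1 = 0 ∧ N 2 1 = algebraMap _ _ r) := by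
  obtain ⟨-, g, hg, hkg⟩ := hκ
  obtain ⟨h21, hlow, hup, hl, hr⟩ := hg.entries
  have key : (frame a a' * (κ : Matrix _ _ (LAlg d ℤ_[p]))).map (residue d p) =
      frame (residue d p a) (residue d p a') * g.map (algebraMap (ZMod p) (LAlg d (ZMod p))) := by
    rw [Matrix.map_mul, frame_map]
    exact congrArg _ hkg
  -- The third row of the lower half of the frame is `(a, 1, 1 | 0, 0, 0)`. In column `e₂` the
  -- coefficient of `a` is an entry above the diagonal of the lower triangular block, hence zero, so
  -- only a rational number is left. In column `e₁` the term with `a` survives.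
  refine ⟨g (Sum.inr 0) (Sum.inr 0), g (Sum.inr 1) (Sum.inr 1), g (Sum.inl 2) (Sum.inl 2),
    g (Sum.inl 1) (Sum.inl 1) + g (Sum.inl 2) (Sum.inl 1), hr 0, hr 1, hl 2, _, _, rfl, rfl, ?_, ?_⟩
  · rw [← pivotCols_map, key]
    simp [pivotCols, frame, Matrix.mul_apply, Fintype.sum_sum_type, Fin.sum_univ_three, h21,
      hlow, hup]
  · rw [← complCols_map, key]
    simp [complCols, frame, Matrix.mul_apply, Fintype.sum_sum_type, Fin.sum_univ_three, h21,
      hlow]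

theorem pivotCols_mul_submatrix {R : Type*} [CommRing R]
    (M N : Matrix (Fin 3 ⊕ Fin 3) (Fin 3 ⊕ Fin 3) R)
    {D : Matrix (Fin 3) (Fin 3) R} (h : M.submatrix Sum.inr id = D * N.submatrix Sum.inr id) :
    pivotCols M = D * pivotCols N ∧ complCols M = D * complCols N :=
  ⟨congrArg (fun X => X.submatrix id ![Sum.inr 0, Sum.inr 1, Sum.inl 2]) h,
    congrArg (fun X => X.submatrix id ![Sum.inl 0, Sum.inl 1, Sum.inr 2]) h⟩

theorem submatrix_inr_eq_of_cols {R : Type*} [CommRing R]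
    {M N : Matrix (Fin 3 ⊕ Fin 3) (Fin 3 ⊕ Fin 3) R} {D : Matrix (Fin 3) (Fin 3) R}
    (h₁ : pivotCols M = D * pivotCols N) (h₂ : complCols M = D * complCols N) :
    M.submatrix Sum.inr id = D * N.submatrix Sum.inr id := by
  ext1 i j
  have e₁ := fun k => congrFun (congrFun h₁ i) k
  have e₂ := fun k => congrFun (congrFun h₂ i) k
  rcases j with j | j <;> fin_cases j
  · exact e₂ 0
  · exact e₂ 1
  · exact e₁ 2
  · exact e₁ 0
  · exact e₁ 1
  · exact e₂ 2

/-- The element `α`, as an integral element. -/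
theorem exists_intIncl_eq_alpha [h : InertAt d p] (b : ℤ) :
    ∃ a : LAlg d ℤ_[p], intIncl d p a = alpha d b p ∧ 2 * a.im = 1 ∧ a.re = b * a.im := by
  have h2 : ‖(1 / 2 : ℚ_[p])‖ ≤ 1 := by rw [norm_div, h.norm_two]; simp
  have h20 : (2 : ℚ_[p]) ≠ 0 := fun h0 => by have := h.norm_two; rw [h0] at this; simp at this
  refine ⟨⟨b * ⟨1 / 2, h2⟩, ⟨1 / 2, h2⟩⟩, ?_, ?_, rfl⟩
  · refine QuadraticAlgebra.ext ?_ rfl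
    have hmul : ∀ x : ℤ_[p], (((b : ℤ_[p]) * x : ℤ_[p]) : ℚ_[p]) = b * (x : ℚ_[p]) := by
      intro x
      push_cast
      rfl
    exact (hmul ⟨1 / 2, h2⟩).trans (mul_one_div _ _)
  · apply Subtype.ext
    change (2 : ℚ_[p]) * (1 / 2) = 1
    field_simp

theorem intIncl_star (z : LAlg d ℤ_[p]) : intIncl d p (star z) = star (intIncl d p z) :=
  LAlg.map_star _ _

theorem exists_frame_of_mem [InertAt d p] (b : ℤ)
    {X : Matrix (Fin 3 ⊕ Fin 3) (Fin 3 ⊕ Fin 3) (LAlg d ℚ_[p])}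
    (hX : X = Qmat _ ∨ X = Omega d b p) :
    ∃ a : LAlg d ℤ_[p], X = (frame a (star a)).map (intIncl d p) := by
  rcases hX with rfl | rfl
  · exact ⟨0, by rw [frame_map, Qmat_eq_frame]; simp⟩
  · obtain ⟨a, ha, -⟩ := exists_intIncl_eq_alpha (d := d) (p := p) b
    exact ⟨a, by rw [frame_map, Omega_eq_frame, intIncl_star, ha]⟩

theorem residue_isUnit_of_eq_algebraMap [InertAt d p] {z : LAlg d ℤ_[p]} {u : ZMod p}
    (hu : u ≠ 0) (h : residue d p z = algebraMap _ _ u) :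
    IsUnit z ∧ qabs (intIncl d p z) = 1 ∧ ‖(intIncl d p z).im‖ < 1 := by
  have h1 : IsUnit z := isUnit_of_residue_ne_zero (by
    rw [h]
    intro h0
    exact hu (by simpa using congrArg QuadraticAlgebra.re h0))
  refine ⟨h1, (isUnit_iff_qabs_eq_one z).1 h1, ?_⟩
  rw [← residue_im_eq_zero_iff, h]
  simp

/-- The parabolic multiplies pivot and complementary columns by the same `D`, so their quotient `S`
may be computed from the integral matrix `X κ`, whose reduction is known. The value is thereby
expressed through `t` alone, which gives its uniqueness. -/
theorem pivotForm_of_isUpsilonValue [InertAt d p] {b : ℤ} {Λ : (LAlg d ℚ_[p])ˣ →* Circle}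
    (hΛ : IsAdmissible Λ) {s : ℂ} {t : Matrix (Fin 3 ⊕ Fin 3) (Fin 3 ⊕ Fin 3) (LAlg d ℚ_[p])}
    (ht : IsJUnitary t) {z : ℂ} (hz : IsUpsilonValue b Λ s t z) :
    (∃ S, HasPivotForm t S) ∧ z = pivotValue Λ s t := by
  obtain ⟨B, A, v, X, κ, hB, hX, hκ, rfl, rfl⟩ := hz
  obtain ⟨a, rfl⟩ := exists_frame_of_mem b hX
  set Y := frame a (star a) * (κ : Matrix _ _ (LAlg d ℤ_[p])) with hY
  set D : Matrix (Fin 3) (Fin 3) (LAlg d ℚ_[p]) := algebraMap ℚ_[p] (LAlg d ℚ_[p]) v •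
    ((A⁻¹ : GL (Fin 3) (LAlg d ℚ_[p])) : Matrix (Fin 3) (Fin 3) (LAlg d ℚ_[p]))ᴴ with hD
  set t := fromBlocks 1 B 0 1 * siegelLevi A v * (frame a (star a)).map (intIncl d p) *
      (κ : Matrix _ _ (LAlg d ℤ_[p])).map (intIncl d p) with ht'
  have htY : t = (fromBlocks 1 B 0 1 * siegelLevi A v) * Y.map (intIncl d p) := by
    rw [ht', hY, Matrix.map_mul, Matrix.mul_assoc]
  have hPb : fromBlocks 1 B 0 1 * siegelLevi A v = fromBlocks (A : Matrix _ _ _) (B * D) 0 D := by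
    rw [siegelLevi, fromBlocks_multiply]
    simp [hD]
  have hbot : t.submatrix Sum.inr id = D * (Y.map (intIncl d p)).submatrix Sum.inr id := by
    rw [htY, hPb]
    ext1 i j
    simp [Matrix.mul_apply, Fintype.sum_sum_type]
  obtain ⟨hE, hN⟩ := pivotCols_mul_submatrix _ _ hbot
  rw [pivotCols_map] at hE
  rw [complCols_map] at hN
  obtain ⟨u₀, u₁, u₂, r, hu₀, hu₁, hu₂, E, N, hEe, hNe, ⟨e1, e2, e3, e4, e5, e6⟩,
    ⟨n1, n2, n3, n4, n5⟩⟩ := residue_frame_mul hκ a (star a)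
  rw [← hY] at hEe hNe
  have hdet : residue d p (pivotCols Y).det = algebraMap _ _ (-(u₁ * u₀ * u₂)) := by
    rw [RingHom.map_det, RingHom.mapMatrix_apply, hEe, det_fin_three, e1, e2, e3, e4, e5, e6]
    simp only [map_neg, map_mul]
    ring
  obtain ⟨hEu, hEabs, hEim⟩ := residue_isUnit_of_eq_algebraMap
    (neg_ne_zero.2 (mul_ne_zero (mul_ne_zero hu₁ hu₀) hu₂)) hdet
  have hdetE : (pivotCols t).det = D.det * intIncl d p (pivotCols Y).det := by
    rw [hE, det_mul, RingHom.map_det, RingHom.mapMatrix_apply]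
  set δ : (LAlg d ℚ_[p]) := (A : Matrix (Fin 3) (Fin 3) (LAlg d ℚ_[p])).det with hδ
  have hδ0 : δ ≠ 0 := ((Matrix.isUnit_iff_isUnit_det _).1 A.isUnit).ne_zero
  have hdetD : D.det = algebraMap _ _ ((v : ℚ_[p]) ^ 3) * (star δ)⁻¹ := by
    rw [hD, det_smul, det_conjTranspose, coe_units_inv, det_nonsing_inv, Ring.inverse_eq_inv',
      Fintype.card_fin, map_pow]
    congr 1
    refine eq_inv_of_mul_eq_one_left ?_
    rw [← star_mul, mul_inv_cancel₀ hδ0, star_one]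
  -- All other determinants in the factorization have absolute value one, and the parabolic factor
  -- contributes `|v|³`.
  have hv : ‖(v : ℚ_[p])‖ = 1 := by
    have h1 := ht.qabs_det
    rw [htY, det_mul, hPb, det_fromBlocks_zero₂₁, hdetD, hY, Matrix.map_mul, det_mul] at h1
    have h2 : qabs ((frame a (star a)).map (intIncl d p)).det = 1 := by
      rw [frame_map, intIncl_star]
      exact (isJUnitary_frame _).qabs_det
    have h3 : qabs ((κ : Matrix (Fin 3 ⊕ Fin 3) (Fin 3 ⊕ Fin 3) (LAlg d ℤ_[p])).map
        (intIncl d p)).det = 1 := by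
      rw [← RingHom.mapMatrix_apply, ← RingHom.map_det]
      exact (isUnit_iff_qabs_eq_one _).1 ((Matrix.isUnit_iff_isUnit_det _).1 κ.isUnit)
    simp only [qabs_mul, h2, h3, qabs_algebraMap, qabs_inv, qabs_star, mul_one, norm_pow] at h1
    rw [← hδ, mul_comm (‖(v : ℚ_[p])‖ ^ 3), ← mul_assoc,
      mul_inv_cancel₀ (qabs_pos hδ0).ne', one_mul] at h1
    exact (pow_eq_one_iff_of_nonneg (norm_nonneg _) (by norm_num)).1 h1
  have hDabs : qabs (pivotCols t).det = (qabs δ)⁻¹ := by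
    rw [hdetE, hdetD, qabs_mul, qabs_mul, qabs_inv, qabs_star, qabs_algebraMap, hEabs, norm_pow,
      hv]
    simp
  have hdet0 : (pivotCols t).det ≠ 0 := by
    intro h0
    rw [h0, qabs_zero] at hDabs
    exact (inv_pos.2 (qabs_pos hδ0)).ne hDabs
  refine ⟨?_, ?_⟩
  · set S := (pivotCols Y)⁻¹ * complCols Y with hS
    have hES : pivotCols Y * S = complCols Y := by
      rw [hS, ← Matrix.mul_assoc, Matrix.mul_nonsing_inv _ hEu, Matrix.one_mul]
    clear_value S
    have hres : E * S.map (residue d p) = N := by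
      rw [← hEe, ← hNe, ← hES, Matrix.map_mul]
    have hent := fun i j => congrFun (congrFun hres i) j
    simp only [Matrix.mul_apply, Fin.sum_univ_three, Matrix.map_apply] at hent
    -- The equation `E S = N` modulo `p` is solved row by row: the first row gives the second row of
    -- `S`, the second row of the equation then gives the first, and the third row gives `S 2 1`.
    have hcan : ∀ {u : ZMod p} {x : LAlg d (ZMod p)}, u ≠ 0 → algebraMap _ _ u * x = 0 → x = 0 := by
      intro u x hu hx
      have := congrArg (fun y => algebraMap (ZMod p) (LAlg d (ZMod p)) u⁻¹ * y) hx
      simpa only [← mul_assoc, ← map_mul, inv_mul_cancel₀ hu, map_one, one_mul, mul_zero] using this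
    have z10 : residue d p (S 1 0) = 0 := hcan hu₁ (by
      have := hent 0 0; rw [e1, e2, e3, n1] at this; simpa using this)
    have z11 : residue d p (S 1 1) = 0 := hcan hu₁ (by
      have := hent 0 1; rw [e1, e2, e3, n2] at this; simpa using this)
    have z00 : residue d p (S 0 0) = 0 := hcan hu₀ (by
      have := hent 1 0; rw [e4, e5, n3, z10] at this; simpa using this)
    have z01 : residue d p (S 0 1) = 0 := hcan hu₀ (by
      have := hent 1 1; rw [e4, e5, n4, z11] at this; simpa using this)
    have z21 : algebraMap _ _ u₂ * residue d p (S 2 1) = algebraMap _ _ r := by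
      have := hent 2 1; rw [e6, n5, z01, z11] at this; simpa using this
    refine ⟨S, ?_, hdet0, z00, z01, z10, z11, ?_⟩
    · rw [hN, hE, ← hES, Matrix.map_mul, Matrix.mul_assoc]
    · have := congrArg QuadraticAlgebra.im z21
      simp only [QuadraticAlgebra.im_mul, QuadraticAlgebra.algebraMap_re,
        QuadraticAlgebra.algebraMap_im, zero_mul, add_zero] at this
      exact (mul_eq_zero.1 this).resolve_left hu₂
  · have hv0 : (v : ℚ_[p]) ^ 3 ≠ 0 := pow_ne_zero _ v.ne_zero
    have hy0 : intIncl d p (pivotCols Y).det ≠ 0 := by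
      rw [hdetE] at hdet0
      exact right_ne_zero_of_mul hdet0
    -- The Levi block on the lower half is the conjugate inverse of `A`. As `Λ` inverts under
    -- conjugation, it takes the same value there as at `det A`.
    have hstar : charFun Λ (star δ)⁻¹ = charFun Λ δ := by
      have h1 := hΛ.charFun_mul_star hδ0
      have h2 : charFun Λ (star δ)⁻¹ * charFun Λ (star δ) = 1 := by
        rw [← map_mul, inv_mul_cancel₀ (by simpa using hδ0), map_one]
      exact mul_right_cancel₀ (right_ne_zero_of_mul_eq_one h1) (h2.trans h1.symm)
    have hchar : charFun Λ (pivotCols t).det = (Λ (GeneralLinearGroup.det A) : ℂ) := by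
      rw [hdetE, hdetD, map_mul, map_mul, hΛ.charFun_algebraMap hv0, hΛ.charFun_eq_one hEabs hEim,
        hstar, one_mul, mul_one, ← charFun_coe]
      rfl
    rw [pivotValue, siegelChar, hchar, hDabs, hv, mul_comm]
    congr 1
    rw [Complex.ofReal_one, Complex.one_cpow, one_mul, norm_norm_eq_qabs_sq,
      ← cpow_sq_eq_inv_cpow (qabs_pos hδ0)]
    rfl

end Values

/-! ### Existence of the value of the section -/

section Kappa

variable {R : Type*} [CommRing R]

/-- An explicit family of elements that are unitary for `J₃` when `c₁₀, r', m'` are the conjugates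
of `c₀₁, r, m`, and `q q' = 1`. -/
def iwahoriElt (q q' r r' m m' s c₀₀ c₀₁ c₁₀ c₁₁ : R) : Matrix (Fin 3 ⊕ Fin 3) (Fin 3 ⊕ Fin 3) R :=
  fromBlocks !![q, 0, 0; 0, 1, 0; r, m, 1] !![0, 0, 0; 0, 0, 0; 0, 0, s]
    !![q' * c₀₀, q' * c₀₁, 0; c₁₀, c₁₁, 0; 0, 0, 0] !![q', 0, -(q' * r'); 0, 1, -m'; 0, 0, 1]

theorem conjTranspose_of_three {R : Type*} [Star R] (a b c d e f g h i : R) :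
    (!![a, b, c; d, e, f; g, h, i])ᴴ =
      !![star a, star d, star g; star b, star e, star h; star c, star f, star i] := by
  ext i j
  fin_cases i <;> fin_cases j <;> rfl

theorem isJUnitary_iwahoriElt [StarRing R] {q q' r m s c₀₀ c₀₁ c₁₁ : R} (hq : q * q' = 1)
    (hqs : star q = q) (hqs' : star q' = q') (hs : star s = s) (h₀₀ : star c₀₀ = c₀₀)
    (h₁₁ : star c₁₁ = c₁₁) :
    IsJUnitary (iwahoriElt q q' r (star r) m (star m) s c₀₀ c₀₁ (star c₀₁) c₁₁) := by
  have hq₁ : ∀ x, q * (q' * x) = x := fun x => by linear_combination x * hq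
  have hq₂ : ∀ x, x * q' * q = x := fun x => by linear_combination x * hq
  have hq₃ : ∀ x, q * -(q' * x) + x = 0 := fun x => by linear_combination -x * hq
  rw [iwahoriElt, isJUnitary_fromBlocks_iff]
  simp only [conjTranspose_of_three, Matrix.mul_fin_three, Matrix.one_fin_three, star_zero,
    star_one, star_mul, star_neg, star_star, hqs, hqs', hs, h₀₀, h₁₁, mul_zero, zero_mul, add_zero,
    zero_add, mul_one, one_mul, hq₁, hq₂, hq₃, hq, neg_add_cancel, true_and]
  ext i j
  fin_cases i <;> fin_cases j <;> simp

theorem iwahoriElt_map {S : Type*} [CommRing S] (φ : R →+* S)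
    (q q' r r' m m' s c₀₀ c₀₁ c₁₀ c₁₁ : R) :
    (iwahoriElt q q' r r' m m' s c₀₀ c₀₁ c₁₀ c₁₁).map φ =
      iwahoriElt (φ q) (φ q') (φ r) (φ r') (φ m) (φ m') (φ s) (φ c₀₀) (φ c₀₁) (φ c₁₀) (φ c₁₁) := by
  rw [iwahoriElt, iwahoriElt, fromBlocks_map]
  rw [fromBlocks_inj]
  simp [← Matrix.ext_iff, Fin.forall_fin_succ]

theorem isBorel_iwahoriElt {q q' r m s : R} (hq : q * q' = 1) :
    IsBorel (iwahoriElt q q' r r m m s 0 0 0 0) := by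
  refine ⟨⟨1, ?_⟩, ⟨!![q, 0, 0; 0, 1, 0; r, m, 1], !![q', 0, 0; 0, 1, 0; -(q' * r), -m, 1],
    ?_, ?_⟩, !![0, 0, 0; 0, 0, 0; 0, 0, s], 1, ?_, ?_⟩
  -- With the trivial involution, unitary means symplectic, so the unitary computation is reused.
  · let _ : StarRing R := starRingOfComm
    have h := isJUnitary_iwahoriElt (R := R) (q := q) (q' := q') (r := r) (m := m) (s := s)
      (c₀₀ := 0) (c₀₁ := 0) (c₁₁ := 0) hq rfl rfl rfl rfl rfl
    rw [Units.val_one, one_smul]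
    exact h
  · simp [← Matrix.ext_iff, Fin.forall_fin_succ, hq, Matrix.one_apply]
    ring
  · simp [← Matrix.ext_iff, Fin.forall_fin_succ, Matrix.one_apply]
    exact ⟨by rw [mul_comm, hq], by linear_combination -r * hq⟩
  · simp [Fin.forall_fin_succ]
  · rw [iwahoriElt, fromBlocks_inj]
    simp [← Matrix.ext_iff, Fin.forall_fin_succ]

/-- The lower half of `X κ` for `X` a frame and `κ` in the explicit family. -/
theorem cols_frame_mul_iwahoriElt {a a' q q' r r' s : R} {S : Matrix (Fin 3) (Fin 3) R}
    (hq : q' * q = 1) (h₂₀ : S 2 0 = r + q * a) (h₀₂ : S 0 2 = -(r' + q * a'))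
    (h₂₂ : S 2 2 = s) :
    pivotCols (frame a a' * iwahoriElt q q' r r' (S 2 1 - 1) (-(S 1 2 + 1)) s (S 0 0) (S 0 1)
      (S 1 0) (S 1 1)) = !![0, 1, 0; q', -a', 0; 0, 0, 1] ∧
    complCols (frame a a' * iwahoriElt q q' r r' (S 2 1 - 1) (-(S 1 2 + 1)) s (S 0 0) (S 0 1)
      (S 1 0) (S 1 1)) = !![0, 1, 0; q', -a', 0; 0, 0, 1] * S := by
  constructor
  · simp [← Matrix.ext_iff, Fin.forall_fin_succ, Matrix.mul_apply, Fin.sum_univ_three, pivotCols,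
      frame, iwahoriElt]
  · simp [← Matrix.ext_iff, Fin.forall_fin_succ, Matrix.mul_apply, Fin.sum_univ_three, complCols,
      frame, iwahoriElt]
    simp [Matrix.vecMul, dotProduct, Fin.sum_univ_three, h₂₀, h₀₂, h₂₂]
    exact ⟨by linear_combination a' * hq, by ring⟩

end Kappa

/-! ### Every Hermitian coordinate matrix with the right residues occurs -/

section Existence

variable {d : ℕ} {p : Nat.Primes}

/-- The rows of the lower half span an isotropic space. The form pairs the pivots `f₁, f₂, e₃` with
the complementary columns `e₁, e₂, f₃`, with the opposite sign for the third pair, so isotropy says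
that `S` is Hermitian up to `diag(1, 1, -1)`. -/
theorem HasPivotForm.star_relation {t : Matrix (Fin 3 ⊕ Fin 3) (Fin 3 ⊕ Fin 3) (LAlg d ℚ_[p])}
    {S : Matrix (Fin 3) (Fin 3) (LAlg d ℤ_[p])} [InertAt d p]
    (hS : HasPivotForm t S) (ht : IsJUnitary t) :
    S * Matrix.diagonal ![1, 1, -1] = Matrix.diagonal ![1, 1, -1] * Sᴴ := by
  set E := pivotCols t with hE
  set N := complCols t with hN
  have h1 : N * Matrix.diagonal ![1, 1, -1] * Eᴴ = E * Matrix.diagonal ![1, 1, -1] * Nᴴ := by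
    have h := ht.mul_Jform_mul
    rw [Jform_eq, ← fromBlocks_toBlocks t, fromBlocks_conjTranspose, fromBlocks_multiply,
      fromBlocks_multiply, fromBlocks_inj] at h
    obtain ⟨-, -, -, h⟩ := h
    ext1 i j
    have h' := congrFun (congrFun h i) j
    simp only [Matrix.mul_zero, Matrix.mul_one, Matrix.mul_neg, add_zero, zero_add,
      Matrix.neg_mul, Matrix.add_apply, Matrix.neg_apply, Matrix.mul_apply, Fin.sum_univ_three,
      conjTranspose_apply, toBlocks₂₁, toBlocks₂₂, of_apply, Matrix.zero_apply] at h'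
    simp only [Matrix.mul_diagonal, Matrix.mul_apply (M := N * _), Matrix.mul_apply (M := E * _),
      Fin.sum_univ_three, conjTranspose_apply]
    simp [hE, hN, pivotCols, complCols]
    linear_combination h'
  have hinv : IsUnit E.det := hS.det_ne_zero.isUnit
  have hinv' : IsUnit Eᴴ.det := by rw [det_conjTranspose]; exact hinv.star
  have h2 : S.map (intIncl d p) * Matrix.diagonal ![1, 1, -1] =
      Matrix.diagonal ![1, 1, -1] * (S.map (intIncl d p))ᴴ := by
    rw [hN, hS.compl, conjTranspose_mul, ← hE] at h1
    have h3 : E * (S.map (intIncl d p) * Matrix.diagonal ![1, 1, -1]) * Eᴴ =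
        E * (Matrix.diagonal ![1, 1, -1] * (S.map (intIncl d p))ᴴ) * Eᴴ := by
      simpa only [Matrix.mul_assoc] using h1
    have h4 := congrArg (fun X => E⁻¹ * (X * (Eᴴ)⁻¹)) h3
    simpa only [Matrix.mul_nonsing_inv_cancel_right _ _ hinv',
      Matrix.nonsing_inv_mul_cancel_left _ _ hinv] using h4
  ext1 i j
  apply intIncl_injective
  have h3 := congrFun (congrFun h2 i) j
  rw [Matrix.mul_diagonal, Matrix.diagonal_mul, conjTranspose_apply, Matrix.map_apply,
    Matrix.map_apply] at h3
  rw [Matrix.mul_diagonal, Matrix.diagonal_mul, conjTranspose_apply, map_mul, map_mul, intIncl_star]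
  convert h3 using 2
  · fin_cases j <;> simp
  · fin_cases i <;> simp

/-- The relation for `S` supplies exactly the conjugate pairs that make the explicit element
unitary. Its reduction has entries in `𝔽_p`: self-conjugate entries are rational, and the two
remaining ones are rational by assumption. -/
theorem exists_iwahoriElt_mem {q q' r : LAlg d ℤ_[p]} {S : Matrix (Fin 3) (Fin 3) (LAlg d ℤ_[p])}
    (hS : S * Matrix.diagonal ![1, 1, -1] = Matrix.diagonal ![1, 1, -1] * Sᴴ)
    (h₀₀ : residue d p (S 0 0) = 0) (h₀₁ : residue d p (S 0 1) = 0)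
    (h₁₀ : residue d p (S 1 0) = 0) (h₁₁ : residue d p (S 1 1) = 0)
    (h₂₁ : (residue d p (S 2 1)).im = 0) (hq : q * q' = 1) (hqs : star q = q)
    (hqs' : star q' = q') (hr : (residue d p r).im = 0) :
    ∃ κ ∈ IwahoriH d p, (κ : Matrix (Fin 3 ⊕ Fin 3) (Fin 3 ⊕ Fin 3) (LAlg d ℤ_[p])) =
      iwahoriElt q q' r (star r) (S 2 1 - 1) (-(S 1 2 + 1)) (S 2 2) (S 0 0) (S 0 1) (S 1 0)
        (S 1 1) ∧ IsJUnitary (κ : Matrix (Fin 3 ⊕ Fin 3) (Fin 3 ⊕ Fin 3) (LAlg d ℤ_[p])) := by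
  have hent : ∀ i j, _ := fun i j => congrFun (congrFun hS i) j
  simp only [Matrix.mul_diagonal, Matrix.diagonal_mul, conjTranspose_apply] at hent
  have e00 : star (S 0 0) = S 0 0 := by simpa using (hent 0 0).symm
  have e11 : star (S 1 1) = S 1 1 := by simpa using (hent 1 1).symm
  have e22 : star (S 2 2) = S 2 2 := by simpa using (hent 2 2).symm
  have e10 : S 1 0 = star (S 0 1) := by simpa using hent 1 0
  have e12 : -S 1 2 = star (S 2 1) := by simpa using hent 1 2
  have em : -(S 1 2 + 1) = star (S 2 1 - 1) := by
    rw [star_sub, star_one, ← e12]; ring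
  have hJ : IsJUnitary (iwahoriElt q q' r (star r) (S 2 1 - 1) (-(S 1 2 + 1)) (S 2 2) (S 0 0)
      (S 0 1) (S 1 0) (S 1 1)) := by
    rw [em, e10]
    exact isJUnitary_iwahoriElt hq hqs hqs' e22 e00 e11
  obtain ⟨κ, hκ⟩ := hJ.exists_GL
  refine ⟨κ, ⟨⟨1, ?_⟩, ?_⟩, hκ, hκ ▸ hJ⟩
  · rw [hκ, Units.val_one, map_one, one_smul]
    exact hJ
  · have hreal : ∀ z : LAlg d (ZMod p), z.im = 0 → algebraMap _ _ z.re = z := fun z hz =>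
      QuadraticAlgebra.ext rfl hz.symm
    have hstar : ∀ z : LAlg d ℤ_[p], residue d p (star z) = star (residue d p z) := fun z =>
      LAlg.map_star _ _
    have hs0 : ∀ z : LAlg d (ZMod p), z.im = 0 → star z = z := fun z hz =>
      QuadraticAlgebra.ext (by simp) (by simp [hz])
    have hfix : ∀ z : LAlg d ℤ_[p], star z = z → (residue d p z).im = 0 := by
      intro z hz
      have h2 : (2 : ℤ_[p]) ≠ 0 := two_ne_zero
      have h3 : z.im = 0 := by
        have := congrArg QuadraticAlgebra.im hz
        rw [QuadraticAlgebra.im_star] at this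
        have h4 : 2 * z.im = 0 := by linear_combination -this
        exact (mul_eq_zero.1 h4).resolve_left h2
      rw [residue_im, h3, map_zero]
    have hm : (residue d p (S 2 1 - 1)).im = 0 := by
      rw [map_sub, QuadraticAlgebra.im_sub, h₂₁, map_one, QuadraticAlgebra.im_one, sub_zero]
    refine ⟨iwahoriElt (residue d p q).re (residue d p q').re (residue d p r).re (residue d p r).re
      (residue d p (S 2 1 - 1)).re (residue d p (S 2 1 - 1)).re (residue d p (S 2 2)).re 0 0 0 0,
      isBorel_iwahoriElt ?_, ?_⟩
    · have h := congrArg (fun z => (residue d p z).re) hq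
      simpa [QuadraticAlgebra.re_one, hfix q hqs, hfix q' hqs'] using h
    · rw [hκ, em, iwahoriElt_map (algebraMap (ZMod p) (LAlg d (ZMod p))), hreal _ (hfix q hqs),
        hreal _ (hfix q' hqs'), hreal _ hr, hreal _ hm, hreal _ (hfix _ e22), map_zero]
      change (iwahoriElt _ _ _ _ _ _ _ _ _ _ _).map (residue d p) = _
      rw [iwahoriElt_map, h₀₀, h₀₁, h₁₀, h₁₁, hstar, hstar, hs0 _ hr, hs0 _ hm]

/-- The entry `S 2 0` has to be of the form `r + q a` with `q` a rational unit and `r` rational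
modulo `p`. If its residue is rational, `a = 0` works and the cell is that of `Q`; otherwise `a = α`
works and the cell is that of `Ω`. -/
theorem exists_iwahori_of_star_relation [h : InertAt d p] (b : ℤ)
    {S : Matrix (Fin 3) (Fin 3) (LAlg d ℤ_[p])}
    (hS : S * Matrix.diagonal ![1, 1, -1] = Matrix.diagonal ![1, 1, -1] * Sᴴ)
    (h₀₀ : residue d p (S 0 0) = 0) (h₀₁ : residue d p (S 0 1) = 0)
    (h₁₀ : residue d p (S 1 0) = 0) (h₁₁ : residue d p (S 1 1) = 0)
    (h₂₁ : (residue d p (S 2 1)).im = 0) :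
    ∃ (a q q' : LAlg d ℤ_[p]), ∃ κ ∈ IwahoriH d p,
      ((frame a (star a)).map (intIncl d p) = Qmat _ ∨
        (frame a (star a)).map (intIncl d p) = Omega d b p) ∧ q * q' = 1 ∧
      IsJUnitary (κ : Matrix (Fin 3 ⊕ Fin 3) (Fin 3 ⊕ Fin 3) (LAlg d ℤ_[p])) ∧
      pivotCols (frame a (star a) * (κ : Matrix (Fin 3 ⊕ Fin 3) (Fin 3 ⊕ Fin 3) (LAlg d ℤ_[p]))) =
        !![0, 1, 0; q', -star a, 0; 0, 0, 1] ∧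
      complCols (frame a (star a) * (κ : Matrix (Fin 3 ⊕ Fin 3) (Fin 3 ⊕ Fin 3) (LAlg d ℤ_[p]))) =
        !![0, 1, 0; q', -star a, 0; 0, 0, 1] * S := by
  have e20 : S 0 2 = -star (S 2 0) := by
    have := congrFun (congrFun hS 0) 2
    simp only [Matrix.mul_diagonal, Matrix.diagonal_mul, conjTranspose_apply] at this
    rw [← neg_eq_iff_eq_neg]
    simpa using this
  suffices H : ∃ (a q q' r : LAlg d ℤ_[p]), q * q' = 1 ∧ star q = q ∧ star q' = q' ∧
      (residue d p r).im = 0 ∧ S 2 0 = r + q * a ∧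
      ((frame a (star a)).map (intIncl d p) = Qmat _ ∨
        (frame a (star a)).map (intIncl d p) = Omega d b p) by
    obtain ⟨a, q, q', r, hq, hqs, hqs', hr, h20, hX⟩ := H
    obtain ⟨κ, hκ, hκe, hκJ⟩ := exists_iwahoriElt_mem hS h₀₀ h₀₁ h₁₀ h₁₁ h₂₁ hq hqs hqs' hr
    refine ⟨a, q, q', κ, hκ, hX, hq, hκJ, ?_⟩
    rw [hκe]
    refine cols_frame_mul_iwahoriElt (by rw [mul_comm, hq]) h20 ?_ rfl
    rw [e20, h20, star_add, star_mul, hqs, mul_comm]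
  by_cases him : (residue d p (S 2 0)).im = 0
  · refine ⟨0, 1, 1, S 2 0, by simp, star_one _, star_one _, him, by simp, Or.inl ?_⟩
    rw [frame_map, star_zero, map_zero, Qmat_eq_frame]
  · obtain ⟨a, ha, ha2, hab⟩ := exists_intIncl_eq_alpha (d := d) (p := p) b
    set y := (S 2 0).im with hy
    have hyu : IsUnit (2 * y) := by
      rw [PadicInt.isUnit_iff]
      refine le_antisymm (PadicInt.norm_le_one _) (not_lt.1 fun hlt => ?_)
      rw [← toZMod_eq_zero_iff_norm_lt, map_mul, map_ofNat, mul_eq_zero] at hlt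
      exact hlt.elim h.two_ne_zero him
    obtain ⟨u, hu⟩ := hyu
    -- Since `2 y α = b y + y √-d`, the choice `q = 2 y` absorbs the imaginary part of `S 2 0` and
    -- leaves `r = Re (S 2 0) - b y`. Here `2 y` is a unit because that imaginary part is nonzero
    -- modulo `p`.
    refine ⟨a, algebraMap _ _ (u : ℤ_[p]), algebraMap _ _ ((u⁻¹ : ℤ_[p]ˣ) : ℤ_[p]),
      algebraMap _ _ ((S 2 0).re - b * y), ?_, ?_, ?_, ?_, ?_, Or.inr ?_⟩
    · rw [← map_mul, Units.mul_inv, map_one]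
    · exact QuadraticAlgebra.ext (by simp) (by simp)
    · exact QuadraticAlgebra.ext (by simp) (by simp)
    · rw [residue_im]; simp
    · refine QuadraticAlgebra.ext ?_ ?_
      · simp [hu, hab]
        linear_combination -b * y * ha2
      · simp [hu]
        linear_combination -y * ha2
    · rw [frame_map, intIncl_star, ha, Omega_eq_frame]

/-- The constructed `X κ` has the same coordinate matrix `S` as `t`. The two Lagrangians coincide,
so the matrices differ by the Siegel parabolic, with `v = 1`. -/
theorem isUpsilonValue_of_pivotForm [InertAt d p] (b : ℤ) (Λ : (LAlg d ℚ_[p])ˣ →* Circle) (s : ℂ)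
    {t : Matrix (Fin 3 ⊕ Fin 3) (Fin 3 ⊕ Fin 3) (LAlg d ℚ_[p])} (ht : IsJUnitary t)
    {S : Matrix (Fin 3) (Fin 3) (LAlg d ℤ_[p])} (hS : HasPivotForm t S) :
    ∃ z, IsUpsilonValue b Λ s t z := by
  obtain ⟨a, q, q', κ, hκ, hX, hq, hκJ, hE, hN⟩ := exists_iwahori_of_star_relation b
    (hS.star_relation ht) hS.zero₀₀ hS.zero₀₁ hS.zero₁₀ hS.zero₁₁ hS.rational
  set Y := frame a (star a) * (κ : Matrix (Fin 3 ⊕ Fin 3) (Fin 3 ⊕ Fin 3) (LAlg d ℤ_[p])) with hY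
  have hC : (!![q * star a, q, 0; 1, 0, 0; 0, 0, 1] : Matrix (Fin 3) (Fin 3) (LAlg d ℤ_[p])) *
      !![0, 1, 0; q', -star a, 0; 0, 0, 1] = 1 := by
    rw [Matrix.mul_fin_three, Matrix.one_fin_three]
    simp [hq]
  set C : Matrix (Fin 3) (Fin 3) (LAlg d ℤ_[p]) := !![0, 1, 0; q', -star a, 0; 0, 0, 1]
  set C' : Matrix (Fin 3) (Fin 3) (LAlg d ℤ_[p]) := !![q * star a, q, 0; 1, 0, 0; 0, 0, 1]
  have hCm : C'.map (intIncl d p) * C.map (intIncl d p) = 1 := by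
    rw [← Matrix.map_mul, hC, Matrix.map_one _ (map_zero _) (map_one _)]
  set D := pivotCols t * C'.map (intIncl d p) with hD
  have hbot : t.submatrix Sum.inr id = D * (Y.map (intIncl d p)).submatrix Sum.inr id := by
    refine submatrix_inr_eq_of_cols ?_ ?_
    · rw [pivotCols_map, hE, hD, Matrix.mul_assoc, hCm, Matrix.mul_one]
    · rw [complCols_map, hN, Matrix.map_mul, hS.compl, hD, Matrix.mul_assoc,
        ← Matrix.mul_assoc (C'.map _), hCm, Matrix.one_mul]
  have hYJ : IsJUnitary (Y.map (intIncl d p)) := by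
    have h1 : IsJUnitary Y := (isJUnitary_frame a).mul hκJ
    unfold IsJUnitary at h1 ⊢
    have h2 := congrArg (fun M => M.map (intIncl d p)) h1
    have h3 : (Jform 3 (LAlg d ℤ_[p])).map (intIncl d p) = Jform 3 (LAlg d ℚ_[p]) := by
      ext1 i j; simp
    have h4 : (Yᴴ).map (intIncl d p) = (Y.map (intIncl d p))ᴴ := by
      ext1 i j; simp [intIncl_star]
    simpa only [Matrix.map_mul, h3, h4] using h2
  obtain ⟨A, B, hB, -, ht2⟩ := ht.exists_siegel hYJ hbot
  refine ⟨siegelChar Λ s A 1, B, A, 1, _, κ, hB, hX, hκ, ?_, rfl⟩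
  have hm : siegelLevi A 1 = fromBlocks (A : Matrix (Fin 3) (Fin 3) (LAlg d ℚ_[p])) 0 0
      ((A⁻¹ : GL (Fin 3) (LAlg d ℚ_[p])) : Matrix (Fin 3) (Fin 3) (LAlg d ℚ_[p]))ᴴ := by
    rw [siegelLevi, Units.val_one, map_one, one_smul]
  conv_lhs => rw [ht2]
  rw [hm, hY, Matrix.map_mul]
  simp only [Matrix.mul_assoc]

open Classical in
/-- The value of the section `Υ_p` at a unitary matrix. -/
theorem Upsilon_eq [InertAt d p] (b : ℤ) {Λ : (LAlg d ℚ_[p])ˣ →* Circle}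
    (hΛ : IsAdmissible Λ) (s : ℂ)
    {t : Matrix (Fin 3 ⊕ Fin 3) (Fin 3 ⊕ Fin 3) (LAlg d ℚ_[p])} (ht : IsJUnitary t) :
    Upsilon b Λ s t = if ∃ S, HasPivotForm t S then pivotValue Λ s t else 0 := by
  unfold Upsilon theValue
  split_ifs with h1 h2 h2
  · exact (pivotForm_of_isUpsilonValue hΛ ht h1.choose_spec.1).2
  · exact absurd (pivotForm_of_isUpsilonValue hΛ ht h1.choose_spec.1).1 h2
  · obtain ⟨S, hS⟩ := h2
    obtain ⟨z, hz⟩ := isUpsilonValue_of_pivotForm b Λ s ht hS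
    refine absurd ⟨z, hz, fun y hy => ?_⟩ h1
    rw [(pivotForm_of_isUpsilonValue hΛ ht hz).2, (pivotForm_of_isUpsilonValue hΛ ht hy).2]
  · rfl

end Existence

/-! ### The section along the embedding -/

section Embedding

section Generic

variable {R : Type*} [CommRing R]

theorem addCorner_mul (A B : Matrix (Fin 2) (Fin 2) R) (a b : R) :
    addCorner A a * addCorner B b = addCorner (A * B) (a * b) := by
  rw [addCorner, addCorner, addCorner, Matrix.mul_fin_three]
  simp [Matrix.mul_apply, Fin.sum_univ_two]

theorem addCorner_sub (A B : Matrix (Fin 2) (Fin 2) R) (a b : R) :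
    addCorner A a - addCorner B b = addCorner (A - B) (a - b) := by
  ext i j
  fin_cases i <;> fin_cases j <;> simp [addCorner]

theorem addCorner_one : addCorner (1 : Matrix (Fin 2) (Fin 2) R) 1 = 1 := by
  rw [addCorner, Matrix.one_fin_three]
  simp

variable [StarRing R]

theorem addCorner_conjTranspose (A : Matrix (Fin 2) (Fin 2) R) (a : R) :
    (addCorner A a)ᴴ = addCorner Aᴴ (star a) := by
  rw [addCorner, conjTranspose_of_three, addCorner]
  simp

theorem isJUnitary_iota {k : Matrix (Fin 2 ⊕ Fin 2) (Fin 2 ⊕ Fin 2) R}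
    {H : Matrix (Fin 2) (Fin 2) R} (hk : IsJUnitary k)
    (h₁ : star (H 0 0) * H 1 0 = star (H 1 0) * H 0 0)
    (h₂ : star (H 0 1) * H 1 1 = star (H 1 1) * H 0 1)
    (h₃ : star (H 0 0) * H 1 1 - star (H 1 0) * H 0 1 = 1) : IsJUnitary (iota k H) := by
  rw [← fromBlocks_toBlocks k, isJUnitary_fromBlocks_iff] at hk
  obtain ⟨k1, k2, k3⟩ := hk
  rw [iota, isJUnitary_fromBlocks_iff]
  simp only [addCorner_conjTranspose, addCorner_mul, addCorner_sub, k1, k2, k3, star_neg,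
    mul_neg, neg_mul, h₁, h₂, neg_neg, h₃, addCorner_one, and_true]

theorem isJUnitary_one {n : ℕ} : IsJUnitary (1 : Matrix (Fin n ⊕ Fin n) (Fin n ⊕ Fin n) R) := by
  simp [IsJUnitary]

theorem isJUnitary_Qmat : IsJUnitary (Qmat R) := by
  have h := isJUnitary_frame (0 : R)
  rwa [star_zero, ← Qmat_eq_frame] at h

theorem isJUnitary_s₁ : IsJUnitary (s₁ R) := by
  rw [s₁, isJUnitary_fromBlocks_iff]
  simp [← Matrix.ext_iff, Fin.forall_fin_succ, Matrix.mul_apply]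

theorem isJUnitary_s₂ : IsJUnitary (s₂ R) := by
  rw [s₂, isJUnitary_fromBlocks_iff]
  simp [← Matrix.ext_iff, Fin.forall_fin_succ, Matrix.mul_apply]

theorem isJUnitary_s₃ : IsJUnitary (s₃ R) := by
  rw [s₃, isJUnitary_fromBlocks_iff]
  simp

theorem isJUnitary_s₄ : IsJUnitary (s₄ R) := by
  rw [s₄, isJUnitary_fromBlocks_iff]
  simp [← Matrix.ext_iff, Fin.forall_fin_succ, Matrix.mul_apply]

theorem isJUnitary_s₅ : IsJUnitary (s₅ R) := by
  rw [s₅, isJUnitary_fromBlocks_iff]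
  simp [← Matrix.ext_iff, Fin.forall_fin_succ, Matrix.mul_apply]

end Generic

variable {d : ℕ} {p : Nat.Primes}

theorem isJUnitary_Theta (b : ℤ) : IsJUnitary (Theta d b p) := by
  rw [Theta, isJUnitary_fromBlocks_iff]
  generalize alpha d b p = a
  refine ⟨by simp, by simp, ?_⟩
  refine Matrix.ext fun i j => ?_
  fin_cases i <;> fin_cases j <;> simp [Matrix.mul_apply, Fin.sum_univ_two]

/-- The matrix of an element of `U(1,1)(ℚ_p)`. -/
abbrev umat (h : Ftilde₁ d ℚ_[p]) : Matrix (Fin 2) (Fin 2) (LAlg d ℚ_[p]) := h.1.1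

theorem umat_relations (h : Ftilde₁ d ℚ_[p]) :
    star (umat h 0 0) * umat h 1 0 = star (umat h 1 0) * umat h 0 0 ∧
    star (umat h 0 1) * umat h 1 1 = star (umat h 1 1) * umat h 0 1 ∧
    star (umat h 0 0) * umat h 1 1 - star (umat h 1 0) * umat h 0 1 = 1 := by
  have h0 : (umat h)ᴴ * J₁.map (Int.cast : ℤ → LAlg d ℚ_[p]) * umat h =
    J₁.map (Int.cast : ℤ → LAlg d ℚ_[p]) := h.2
  have hent := fun i j => congrFun (congrFun h0 i) j
  have e00 := hent 0 0
  have e01 := hent 0 1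
  have e11 := hent 1 1
  simp [Matrix.mul_apply, Fin.sum_univ_two, J₁] at e00 e01 e11
  refine ⟨by linear_combination e00, by linear_combination e11, by linear_combination e01⟩

theorem isJUnitary_iota_umat {k : Matrix (Fin 2 ⊕ Fin 2) (Fin 2 ⊕ Fin 2) (LAlg d ℚ_[p])}
    (hk : IsJUnitary k) (h : Ftilde₁ d ℚ_[p]) : IsJUnitary (Qmat _ * iota k (umat h)) := by
  obtain ⟨h1, h2, h3⟩ := umat_relations h
  exact isJUnitary_Qmat.mul (isJUnitary_iota hk h1 h2 h3)

/-- The condition on `h = (x, y; z, w)` for the support of the section. -/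
structure InSupport (h : Ftilde₁ d ℚ_[p]) : Prop where
  ne_zero : umat h 0 0 ≠ 0
  one_le : 1 ≤ qabs (umat h 0 0)
  upper : qabs (umat h 0 1) ≤ qabs (umat h 0 0)
  lower : qabs (umat h 1 0) < qabs (umat h 0 0)

theorem exists_map_intIncl {M : Matrix (Fin 3) (Fin 3) (LAlg d ℚ_[p])}
    (hM : ∀ i j, qabs (M i j) ≤ 1) : ∃ S : Matrix (Fin 3) (Fin 3) (LAlg d ℤ_[p]),
      S.map (intIncl d p) = M := by
  choose f hf using fun i j => (exists_intIncl_eq_iff (M i j)).2 (hM i j)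
  exact ⟨f, by ext1 i j; exact hf i j⟩

/-- The element `(1, 0; a, 1)` of the Levi subgroup, which is `Θ` for `a = α`. -/
def lowerLevi (a : LAlg d ℚ_[p]) : Matrix (Fin 2 ⊕ Fin 2) (Fin 2 ⊕ Fin 2) (LAlg d ℚ_[p]) :=
  fromBlocks !![1, 0; a, 1] 0 0 !![1, -star a; 0, 1]

theorem cols_lowerLevi (a : LAlg d ℚ_[p]) (H : Matrix (Fin 2) (Fin 2) (LAlg d ℚ_[p])) :
    pivotCols (Qmat _ * iota (lowerLevi a) H) = !![0, 1, H 1 0; 1, -star a, 0; 0, 0, H 0 0] ∧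
    complCols (Qmat _ * iota (lowerLevi a) H) = !![0, 0, -H 1 1; 0, 0, 0; a, 1, -H 0 1] := by
  constructor <;> refine Matrix.ext fun i j => ?_ <;> fin_cases i <;> fin_cases j <;>
    simp [pivotCols, complCols, Qmat, iota, lowerLevi, addCorner, Matrix.mul_apply,
      Fin.sum_univ_three, toBlocks₁₁, toBlocks₁₂, toBlocks₂₁, toBlocks₂₂]

theorem cols_s₁ (H : Matrix (Fin 2) (Fin 2) (LAlg d ℚ_[p])) :
    pivotCols (Qmat _ * iota (s₁ _) H) = !![1, 0, H 1 0; 0, 1, 0; 0, 0, H 0 0] ∧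
    complCols (Qmat _ * iota (s₁ _) H) = !![0, 0, -H 1 1; 0, 0, 0; 1, 0, -H 0 1] := by
  constructor <;> refine Matrix.ext fun i j => ?_ <;> fin_cases i <;> fin_cases j <;>
    simp [pivotCols, complCols, Qmat, iota, s₁, addCorner, Matrix.mul_apply,
      Fin.sum_univ_three, toBlocks₁₁, toBlocks₁₂, toBlocks₂₁, toBlocks₂₂]

theorem lowerLevi_zero : lowerLevi (0 : LAlg d ℚ_[p]) = 1 := by
  rw [lowerLevi, ← fromBlocks_one, fromBlocks_inj]
  simp [Matrix.one_fin_two]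

/-- The value of the section on its support. -/
def supportValue (Λ : (LAlg d ℚ_[p])ˣ →* Circle) (s : ℂ) (x : LAlg d ℚ_[p]) : ℂ :=
  charFun Λ x * (qabs x : ℂ) ^ (-6 * (s + 1 / 2))

/-- The Schur complement of `x` in a unitary matrix is `x̄⁻¹`. It is an entry of `S` up to sign, and
`|x| ≥ 1` makes it integral with no condition on `w`. -/
theorem lower_sub_mul_div [InertAt d p] {h : Ftilde₁ d ℚ_[p]} (hx : umat h 0 0 ≠ 0) :
    umat h 1 1 - umat h 1 0 / umat h 0 0 * umat h 0 1 = (star (umat h 0 0))⁻¹ := by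
  obtain ⟨h1, -, h3⟩ := umat_relations h
  have hsx : star (umat h 0 0) ≠ 0 := by simpa using hx
  refine eq_inv_of_mul_eq_one_left ?_
  rw [← h3]
  field_simp
  linear_combination -umat h 0 1 * h1

theorem qabs_inv_le_one [InertAt d p] {x : LAlg d ℚ_[p]} (h : 1 ≤ qabs x) : qabs x⁻¹ ≤ 1 := by
  rw [qabs_inv]
  exact inv_le_one_of_one_le₀ h

/-- In both charts used below, the entries `1/x`, `-y/x` and `-z/x` occur in `S`. Integrality of the
first two and vanishing of the third modulo `p` are the inequalities of `InSupport`. -/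
theorem inSupport_of_cols [InertAt d p] {h : Ftilde₁ d ℚ_[p]} {c y' z' : LAlg d ℤ_[p]}
    (hc : umat h 0 0 * intIncl d p c = 1) (hy : umat h 0 0 * intIncl d p y' = -umat h 0 1)
    (hz : umat h 1 0 * intIncl d p c = -intIncl d p z') (hz' : residue d p z' = 0) :
    InSupport h ∧ (umat h 0 0)⁻¹ = intIncl d p c := by
  have hx : umat h 0 0 ≠ 0 := left_ne_zero_of_mul_eq_one hc
  have hxp := qabs_pos hx
  have hinv : (umat h 0 0)⁻¹ = intIncl d p c := (eq_inv_of_mul_eq_one_right hc).symm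
  refine ⟨⟨hx, ?_, ?_, ?_⟩, hinv⟩
  · have h1 := congrArg qabs hc
    rw [qabs_mul, qabs_one] at h1
    nlinarith [qabs_intIncl_le c]
  · have h1 := congrArg qabs hy
    rw [qabs_mul, qabs_neg] at h1
    nlinarith [qabs_intIncl_le y']
  · rw [residue_eq_zero_iff] at hz'
    have h1 := congrArg qabs hz
    rw [← hinv, qabs_mul, qabs_neg, qabs_inv] at h1
    rw [← h1, ← div_eq_mul_inv, div_lt_one hxp] at hz'
    exact hz'

/-- Solving for `S` gives the last row `(a/x, 1/x, -y/x)`. So `1/x` stands where rationality modulo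
`p` is demanded, while `a/x` stands at the free place. The other entries are `-z/x` and `-x̄⁻¹`
times integral factors. -/
theorem exists_pivotForm_lowerLevi_iff [InertAt d p] {a : LAlg d ℚ_[p]} (ha : qabs a ≤ 1)
    (h : Ftilde₁ d ℚ_[p]) :
    (∃ S, HasPivotForm (Qmat _ * iota (lowerLevi a) (umat h)) S) ↔
      InSupport h ∧ ‖(umat h 0 0)⁻¹.im‖ < 1 := by
  obtain ⟨hE, hN⟩ := cols_lowerLevi a (umat h)
  constructor
  · rintro ⟨S, hS⟩
    have hc := hS.compl
    rw [hE, hN] at hc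
    have hent := fun i j => congrFun (congrFun hc i) j
    have e21 := hent 2 1
    have e22 := hent 2 2
    have e01 := hent 0 1
    simp [Matrix.mul_apply, Fin.sum_univ_three] at e21 e22 e01
    obtain ⟨h1, h2⟩ := inSupport_of_cols (h := h) e21.symm e22.symm
      (z' := S 1 1) (by linear_combination -e01) hS.zero₁₁
    refine ⟨h1, ?_⟩
    rw [h2, ← residue_im_eq_zero_iff]
    exact hS.rational
  · rintro ⟨hs, him⟩
    set x := umat h 0 0 with hx
    set y := umat h 0 1 with hy
    set z := umat h 1 0 with hz
    set w := umat h 1 1 with hw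
    have hx0 : x ≠ 0 := hs.ne_zero
    have hxp := qabs_pos hx0
    have hζ : qabs (z / x) < 1 := by rw [qabs_div, div_lt_one hxp]; exact hs.lower
    have hη : qabs (-y / x) ≤ 1 := by rw [qabs_div, qabs_neg, div_le_one hxp]; exact hs.upper
    have hω : qabs (-(w - z / x * y)) ≤ 1 := by
      rw [lower_sub_mul_div hx0, qabs_neg, qabs_inv, qabs_star, ← qabs_inv]
      exact qabs_inv_le_one hs.one_le
    have hxi : qabs x⁻¹ ≤ 1 := qabs_inv_le_one hs.one_le
    have hsa : qabs (star a) ≤ 1 := by rwa [qabs_star]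
    have hm : ∀ {u v : LAlg d ℚ_[p]}, qabs u ≤ 1 → qabs v ≤ 1 → qabs (u * v) ≤ 1 := by
      intro u v hu hv
      rw [qabs_mul]
      exact mul_le_one₀ hu (qabs_nonneg _) hv
    have hm' : ∀ {u v : LAlg d ℚ_[p]}, qabs u ≤ 1 → qabs v < 1 → qabs (u * v) < 1 := by
      intro u v hu hv
      rw [qabs_mul]
      exact mul_lt_one_of_nonneg_of_lt_one_right hu (qabs_nonneg _) hv
    have hζ' : qabs (-(z / x)) < 1 := by rwa [qabs_neg]
    obtain ⟨S, hS⟩ := exists_map_intIncl (M := !![star a * (a * -(z / x)), star a * -(z / x),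
        star a * -(w - z / x * y); a * -(z / x), -(z / x), -(w - z / x * y);
        a * x⁻¹, x⁻¹, -y / x]) (by
      intro i j
      fin_cases i <;> fin_cases j <;> simp only [of_apply, cons_val', cons_val_zero, cons_val_one,
        cons_val, Fin.zero_eta, Fin.mk_one, Fin.reduceFinMk, cons_val_fin_one]
      · exact hm hsa (hm' ha hζ').le
      · exact hm hsa hζ'.le
      · exact hm hsa hω
      · exact (hm' ha hζ').le
      · exact hζ'.le
      · exact hω
      · exact hm ha hxi
      · exact hxi
      · exact hη)
    have hent : ∀ i j, intIncl d p (S i j) = _ := fun i j => congrFun (congrFun hS i) j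
    refine ⟨S, ?_, ?_, ?_, ?_, ?_, ?_, ?_⟩
    · rw [hE, hN, hS, Matrix.mul_fin_three]
      refine Matrix.ext fun i j => ?_
      fin_cases i <;> fin_cases j <;> simp <;> field_simp <;> ring
    · rw [hE, det_fin_three]
      simpa using hx0
    · rw [residue_eq_zero_iff, hent]
      exact hm' hsa (hm' ha hζ')
    · rw [residue_eq_zero_iff, hent]
      exact hm' hsa hζ'
    · rw [residue_eq_zero_iff, hent]
      exact hm' ha hζ'
    · rw [residue_eq_zero_iff, hent]
      exact hζ'
    · rw [residue_im_eq_zero_iff, hent]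
      exact him

/-- The last row of `S` is now `(1/x, 0, -y/x)`: the swap moves `1/x` to the free place and puts
zero where rationality is demanded. -/
theorem exists_pivotForm_s₁_iff [InertAt d p] (h : Ftilde₁ d ℚ_[p]) :
    (∃ S, HasPivotForm (Qmat _ * iota (s₁ _) (umat h)) S) ↔ InSupport h := by
  obtain ⟨hE, hN⟩ := cols_s₁ (umat h)
  constructor
  · rintro ⟨S, hS⟩
    have hc := hS.compl
    rw [hE, hN] at hc
    have hent := fun i j => congrFun (congrFun hc i) j
    have e20 := hent 2 0
    have e22 := hent 2 2
    have e00 := hent 0 0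
    simp [Matrix.mul_apply, Fin.sum_univ_three] at e20 e22 e00
    exact (inSupport_of_cols (h := h) e20.symm e22.symm
      (z' := S 0 0) (by linear_combination -e00) hS.zero₀₀).1
  · intro hs
    set x := umat h 0 0 with hx
    set y := umat h 0 1 with hy
    set z := umat h 1 0 with hz
    set w := umat h 1 1 with hw
    have hx0 : x ≠ 0 := hs.ne_zero
    have hxp := qabs_pos hx0
    have hζ : qabs (-(z / x)) < 1 := by rw [qabs_neg, qabs_div, div_lt_one hxp]; exact hs.lower
    have hη : qabs (-y / x) ≤ 1 := by rw [qabs_div, qabs_neg, div_le_one hxp]; exact hs.upper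
    have hω : qabs (-(w - z / x * y)) ≤ 1 := by
      rw [lower_sub_mul_div hx0, qabs_neg, qabs_inv, qabs_star, ← qabs_inv]
      exact qabs_inv_le_one hs.one_le
    have hxi : qabs x⁻¹ ≤ 1 := qabs_inv_le_one hs.one_le
    have h0 : qabs (0 : LAlg d ℚ_[p]) ≤ 1 := by rw [qabs_zero]; exact zero_le_one
    obtain ⟨S, hS⟩ := exists_map_intIncl (M := !![-(z / x), 0, -(w - z / x * y); 0, 0, 0;
        x⁻¹, 0, -y / x]) (by
      intro i j
      fin_cases i <;> fin_cases j <;> simp only [of_apply, cons_val', cons_val_zero, cons_val_one,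
        cons_val, Fin.zero_eta, Fin.mk_one, Fin.reduceFinMk, cons_val_fin_one]
      exacts [hζ.le, h0, hω, h0, h0, h0, hxi, h0, hη])
    have hent : ∀ i j, intIncl d p (S i j) = _ := fun i j => congrFun (congrFun hS i) j
    have hz0 : ∀ i j, intIncl d p (S i j) = 0 → residue d p (S i j) = 0 := by
      intro i j hij
      rw [residue_eq_zero_iff, hij, qabs_zero]
      exact zero_lt_one
    refine ⟨S, ?_, ?_, ?_, hz0 _ _ (hent 0 1), hz0 _ _ (hent 1 0), hz0 _ _ (hent 1 1), ?_⟩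
    · rw [hE, hN, hS, Matrix.mul_fin_three]
      refine Matrix.ext fun i j => ?_
      fin_cases i <;> fin_cases j <;> simp <;> field_simp <;> ring
    · rw [hE, det_fin_three]
      simpa using hx0
    · rw [residue_eq_zero_iff, hent]
      exact hζ
    · rw [hz0 _ _ (hent 2 1), QuadraticAlgebra.im_zero]

theorem charFun_neg [InertAt d p] {Λ : (LAlg d ℚ_[p])ˣ →* Circle} (hΛ : IsAdmissible Λ)
    (x : LAlg d ℚ_[p]) : charFun Λ (-x) = charFun Λ x := by
  have h := hΛ.charFun_algebraMap (r := -1) (by norm_num)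
  rw [map_neg, map_one] at h
  have hx : -x = -1 * x := by ring
  rw [hx, map_mul, h, one_mul]

open Classical in
theorem Upsilon_lowerLevi [InertAt d p] (b : ℤ) {Λ : (LAlg d ℚ_[p])ˣ →* Circle}
    (hΛ : IsAdmissible Λ) (s : ℂ) {a : LAlg d ℚ_[p]} (ha : qabs a ≤ 1)
    (haJ : IsJUnitary (lowerLevi a)) (h : Ftilde₁ d ℚ_[p]) :
    Upsilon b Λ s (Qmat _ * iota (lowerLevi a) (umat h)) =
      if InSupport h ∧ ‖(umat h 0 0)⁻¹.im‖ < 1 then supportValue Λ s (umat h 0 0) else 0 := by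
  rw [Upsilon_eq b hΛ s (isJUnitary_iota_umat haJ h)]
  have hdet : (pivotCols (Qmat _ * iota (lowerLevi a) (umat h))).det = -umat h 0 0 := by
    rw [(cols_lowerLevi a (umat h)).1, det_fin_three]
    simp
  simp only [exists_pivotForm_lowerLevi_iff ha, pivotValue, hdet, charFun_neg hΛ, qabs_neg,
    supportValue]

open Classical in
theorem Upsilon_s₁ [InertAt d p] (b : ℤ) {Λ : (LAlg d ℚ_[p])ˣ →* Circle}
    (hΛ : IsAdmissible Λ) (s : ℂ) (h : Ftilde₁ d ℚ_[p]) :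
    Upsilon b Λ s (Qmat _ * iota (s₁ _) (umat h)) =
      if InSupport h then supportValue Λ s (umat h 0 0) else 0 := by
  rw [Upsilon_eq b hΛ s (isJUnitary_iota_umat isJUnitary_s₁ h)]
  have hdet : (pivotCols (Qmat _ * iota (s₁ _) (umat h))).det = umat h 0 0 := by
    rw [(cols_s₁ (umat h)).1, det_fin_three]
    simp
  simp only [exists_pivotForm_s₁_iff, pivotValue, hdet, supportValue]

end Embedding

/-! ### Matrices of `Y_p` along which the section vanishes -/

section Vanishing

variable {d : ℕ} {p : Nat.Primes}

theorem qabs_alpha [h : InertAt d p] (b : ℤ) : qabs (alpha d b p) = 1 := by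
  refine le_antisymm ?_ ?_
  · obtain ⟨a, ha, -⟩ := exists_intIncl_eq_alpha (d := d) (p := p) b
    rw [← ha]
    exact qabs_intIncl_le a
  · refine le_trans (le_of_eq ?_) (norm_im_le_qabs _)
    change 1 = ‖(1 / 2 : ℚ_[p])‖
    rw [norm_div, h.norm_two, norm_one, div_one]

theorem Upsilon_eq_zero [InertAt d p] (b : ℤ) {Λ : (LAlg d ℚ_[p])ˣ →* Circle}
    (hΛ : IsAdmissible Λ) (s : ℂ)
    {k : Matrix (Fin 2 ⊕ Fin 2) (Fin 2 ⊕ Fin 2) (LAlg d ℚ_[p])} (hk : IsJUnitary k)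
    (h : Ftilde₁ d ℚ_[p]) (hS : ∀ S, ¬ HasPivotForm (Qmat _ * iota k (umat h)) S) :
    Upsilon b Λ s (Qmat _ * iota k (umat h)) = 0 := by
  rw [Upsilon_eq b hΛ s (isJUnitary_iota_umat hk h), if_neg]
  rintro ⟨S, hS'⟩
  exact hS S hS'

/-- Covers `s₂`, `s₃` and `Θ s₂`, whose Lagrangians lie outside the chart for every `h`. -/
theorem not_hasPivotForm_of_row {t : Matrix (Fin 3 ⊕ Fin 3) (Fin 3 ⊕ Fin 3) (LAlg d ℚ_[p])}
    (h : ∀ j, pivotCols t 1 j = 0) (S : Matrix (Fin 3) (Fin 3) (LAlg d ℤ_[p])) :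
    ¬ HasPivotForm t S := fun hS => hS.det_ne_zero (det_eq_zero_of_row_eq_zero 1 h)

theorem cols_lowerLevi_mul_s₄ (a : LAlg d ℚ_[p]) (H : Matrix (Fin 2) (Fin 2) (LAlg d ℚ_[p])) :
    pivotCols (Qmat _ * iota (lowerLevi a * s₄ _) H) =
      !![-1, 0, H 1 0; star a, -1, 0; 0, 0, H 0 0] ∧
    complCols (Qmat _ * iota (lowerLevi a * s₄ _) H) =
      !![1, 0, -H 1 1; -star a, 0, 0; -1, -a, -H 0 1] := by
  constructor <;> refine Matrix.ext fun i j => ?_ <;> fin_cases i <;> fin_cases j <;>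
    simp [pivotCols, complCols, Qmat, iota, lowerLevi, s₄, addCorner, Matrix.mul_apply,
      Fin.sum_univ_three, toBlocks₁₁, toBlocks₁₂, toBlocks₂₁, toBlocks₂₂]

theorem cols_lowerLevi_mul_s₅ (a : LAlg d ℚ_[p]) (H : Matrix (Fin 2) (Fin 2) (LAlg d ℚ_[p])) :
    pivotCols (Qmat _ * iota (lowerLevi a * s₅ _) H) =
      !![-1, 0, H 1 0; star a, -1, 0; 0, 0, H 0 0] ∧
    complCols (Qmat _ * iota (lowerLevi a * s₅ _) H) =
      !![0, 0, -H 1 1; 0, 1, 0; -1, -a, -H 0 1] := by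
  constructor <;> refine Matrix.ext fun i j => ?_ <;> fin_cases i <;> fin_cases j <;>
    simp [pivotCols, complCols, Qmat, iota, lowerLevi, s₅, addCorner, Matrix.mul_apply,
      Fin.sum_univ_three, toBlocks₁₁, toBlocks₁₂, toBlocks₂₁, toBlocks₂₂]

theorem not_hasPivotForm_s₂ (H : Matrix (Fin 2) (Fin 2) (LAlg d ℚ_[p])) (S) :
    ¬ HasPivotForm (Qmat _ * iota (s₂ _) H) S := by
  refine not_hasPivotForm_of_row (fun j => ?_) S
  fin_cases j <;> simp [pivotCols, Qmat, iota, s₂, addCorner, Matrix.mul_apply,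
      Fin.sum_univ_three, toBlocks₁₁, toBlocks₁₂, toBlocks₂₁, toBlocks₂₂]

theorem not_hasPivotForm_s₃ (H : Matrix (Fin 2) (Fin 2) (LAlg d ℚ_[p])) (S) :
    ¬ HasPivotForm (Qmat _ * iota (s₃ _) H) S := by
  refine not_hasPivotForm_of_row (fun j => ?_) S
  fin_cases j <;> simp [pivotCols, Qmat, iota, s₃, addCorner, Matrix.mul_apply,
      Fin.sum_univ_three, toBlocks₁₁, toBlocks₁₂, toBlocks₂₁, toBlocks₂₂]

theorem not_hasPivotForm_lowerLevi_mul_s₂ (a : LAlg d ℚ_[p])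
    (H : Matrix (Fin 2) (Fin 2) (LAlg d ℚ_[p])) (S) :
    ¬ HasPivotForm (Qmat _ * iota (lowerLevi a * s₂ _) H) S := by
  refine not_hasPivotForm_of_row (fun j => ?_) S
  fin_cases j <;> simp [pivotCols, Qmat, iota, lowerLevi, s₂, addCorner, Matrix.mul_apply,
      Fin.sum_univ_three, toBlocks₁₁, toBlocks₁₂, toBlocks₂₁, toBlocks₂₂]

/-- Eliminating the entries of `H` gives `S 0 1 - a · S 0 0 = a`. The left side vanishes modulo `p`,
but `a` is a unit. -/
theorem not_hasPivotForm_lowerLevi_mul_s₄ [InertAt d p] {a : LAlg d ℚ_[p]} (ha : qabs a = 1)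
    (H : Matrix (Fin 2) (Fin 2) (LAlg d ℚ_[p])) (S) :
    ¬ HasPivotForm (Qmat _ * iota (lowerLevi a * s₄ _) H) S := by
  intro hS
  obtain ⟨hE, hN⟩ := cols_lowerLevi_mul_s₄ a H
  have hc := hS.compl
  rw [hE, hN] at hc
  have hent := fun i j => congrFun (congrFun hc i) j
  have e00 := hent 0 0
  have e01 := hent 0 1
  have e20 := hent 2 0
  have e21 := hent 2 1
  simp [Matrix.mul_apply, Fin.sum_univ_three] at e00 e01 e20 e21
  have hx : H 0 0 ≠ 0 := by
    intro h0
    rw [h0, zero_mul] at e20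
    simp at e20
  have h1 : intIncl d p (S 2 1) = a * intIncl d p (S 2 0) := by
    apply mul_left_cancel₀ hx
    linear_combination -e21 + a * e20
  have h2 : a = intIncl d p (S 0 1) - a * intIncl d p (S 0 0) := by
    linear_combination a * e00 - e01 - H 1 0 * h1
  have h3 := (residue_eq_zero_iff _).1 hS.zero₀₁
  have h4 := (residue_eq_zero_iff _).1 hS.zero₀₀
  have h5 := qabs_sub_le (intIncl d p (S 0 1)) (a * intIncl d p (S 0 0))
  rw [← h2, qabs_mul, ha, one_mul] at h5
  exact absurd h5 (not_le.2 (max_lt h3 h4))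

/-- The second row reads `ā · S 0 1 - S 1 1 = 1`, which is impossible modulo `p`. -/
theorem not_hasPivotForm_lowerLevi_mul_s₅ [InertAt d p] {a : LAlg d ℚ_[p]} (ha : qabs a = 1)
    (H : Matrix (Fin 2) (Fin 2) (LAlg d ℚ_[p])) (S) :
    ¬ HasPivotForm (Qmat _ * iota (lowerLevi a * s₅ _) H) S := by
  intro hS
  obtain ⟨hE, hN⟩ := cols_lowerLevi_mul_s₅ a H
  have hc := hS.compl
  rw [hE, hN] at hc
  have e11 := congrFun (congrFun hc 1) 1
  simp [Matrix.mul_apply, Fin.sum_univ_three] at e11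
  have h3 := (residue_eq_zero_iff _).1 hS.zero₀₁
  have h4 := (residue_eq_zero_iff _).1 hS.zero₁₁
  have h5 := qabs_sub_le (star a * intIncl d p (S 0 1)) (intIncl d p (S 1 1))
  have h6 : star a * intIncl d p (S 0 1) - intIncl d p (S 1 1) = 1 := by
    linear_combination -e11
  rw [h6, qabs_mul, qabs_star, ha, one_mul, qabs_one] at h5
  exact absurd h5 (not_le.2 (max_lt h3 h4))

/-- The matrices of `Y_p` fall into three groups according to the section along them. -/
theorem Upsilon_Y [InertAt d p] (b : ℤ) {Λ : (LAlg d ℚ_[p])ˣ →* Circle}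
    (hΛ : IsAdmissible Λ) (s : ℂ)
    {k : Matrix (Fin 2 ⊕ Fin 2) (Fin 2 ⊕ Fin 2) (LAlg d ℚ_[p])} (hk : k ∈ Y d b p) :
    ((k = 1 ∨ k = Theta d b p) ∧ ∀ h : Ftilde₁ d ℚ_[p],
      Upsilon b Λ s (Qmat _ * iota k (umat h)) = open Classical in
        if InSupport h ∧ ‖(umat h 0 0)⁻¹.im‖ < 1 then supportValue Λ s (umat h 0 0) else 0) ∨
    (¬ (k = 1 ∨ k = Theta d b p) ∧ ∀ h : Ftilde₁ d ℚ_[p],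
      Upsilon b Λ s (Qmat _ * iota k (umat h)) = open Classical in
        if InSupport h then supportValue Λ s (umat h 0 0) else 0) ∨
    (¬ (k = 1 ∨ k = Theta d b p) ∧ ∀ h : Ftilde₁ d ℚ_[p],
      Upsilon b Λ s (Qmat _ * iota k (umat h)) = 0) := by
  have hα := qabs_alpha (d := d) (p := p) b
  have hΘ := isJUnitary_Theta (d := d) (p := p) b
  -- The first diagonal entry, one for `1` and `Θ` and zero for the other six matrices, tells the
  -- groups apart.
  have hne : ∀ {k' : Matrix (Fin 2 ⊕ Fin 2) (Fin 2 ⊕ Fin 2) (LAlg d ℚ_[p])},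
      k' (Sum.inl 0) (Sum.inl 0) = 0 → ¬ (k' = 1 ∨ k' = Theta d b p) := by
    rintro k' h0 (rfl | rfl)
    · simp at h0
    · simp [Theta] at h0
  simp only [Y, Set.mem_insert_iff, Set.mem_singleton_iff] at hk
  rcases hk with rfl | rfl | rfl | rfl | rfl | rfl | rfl | rfl
  · refine Or.inl ⟨Or.inl rfl, fun h => ?_⟩
    have h0 : qabs (0 : LAlg d ℚ_[p]) ≤ 1 := by rw [qabs_zero]; exact zero_le_one
    have := Upsilon_lowerLevi b hΛ s h0 (by rw [lowerLevi_zero]; exact isJUnitary_one) h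
    rwa [lowerLevi_zero] at this
  · exact Or.inr (Or.inl ⟨hne (by simp [s₁]), fun h => Upsilon_s₁ b hΛ s h⟩)
  · exact Or.inr (Or.inr ⟨hne (by simp [s₂]), fun h =>
      Upsilon_eq_zero b hΛ s isJUnitary_s₂ h (not_hasPivotForm_s₂ _)⟩)
  · exact Or.inr (Or.inr ⟨hne (by simp [s₃]), fun h =>
      Upsilon_eq_zero b hΛ s isJUnitary_s₃ h (not_hasPivotForm_s₃ _)⟩)
  · exact Or.inl ⟨Or.inr rfl, fun h => Upsilon_lowerLevi b hΛ s hα.le hΘ h⟩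
  · exact Or.inr (Or.inr ⟨hne (by simp [s₂, Theta, fromBlocks_multiply]), fun h =>
      Upsilon_eq_zero b hΛ s (hΘ.mul isJUnitary_s₂) h (not_hasPivotForm_lowerLevi_mul_s₂ _ _)⟩)
  · exact Or.inr (Or.inr ⟨hne (by simp [s₄, Theta, fromBlocks_multiply]), fun h =>
      Upsilon_eq_zero b hΛ s (hΘ.mul isJUnitary_s₄) h (not_hasPivotForm_lowerLevi_mul_s₄ hα _)⟩)
  · exact Or.inr (Or.inr ⟨hne (by simp [s₅, Theta, fromBlocks_multiply]), fun h =>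
      Upsilon_eq_zero b hΛ s (hΘ.mul isJUnitary_s₅) h (not_hasPivotForm_lowerLevi_mul_s₅ hα _)⟩)

end Vanishing

/-! ### Integration of functions that are right invariant under an open subgroup -/

section OpenSubgroup

theorem apply_out_eq {G : Type*} [Group G] {K : Subgroup G} {F : G → ℂ}
    (hF : ∀ g, ∀ k ∈ K, F (g * k) = F g) (g : G) :
    F (QuotientGroup.mk (s := K) g).out = F g := by
  have h := QuotientGroup.eq.1 (QuotientGroup.out_eq' (QuotientGroup.mk (s := K) g))
  have := hF (QuotientGroup.mk (s := K) g).out _ h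
  rw [← this, mul_inv_cancel_left]

theorem isOpen_leftCoset {G : Type*} [Group G] [TopologicalSpace G] [ContinuousMul G]
    {K : Subgroup G} (hK : IsOpen (K : Set G)) (g : G) : IsOpen {h | g⁻¹ * h ∈ K} :=
  hK.preimage (continuous_const_mul g⁻¹)

variable {G : Type*} [Group G] [TopologicalSpace G] [ContinuousMul G] [MeasurableSpace G]
  [BorelSpace G] {μ : Measure G} [μ.IsMulLeftInvariant] {K : Subgroup G}

theorem measure_leftCoset (g : G) (K : Subgroup G) : μ {h | g⁻¹ * h ∈ K} = μ (K : Set G) :=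
  measure_preimage_mul μ g⁻¹ (K : Set G)

theorem measure_eq_card_mul_of_cosets (hK : IsOpen (K : Set G)) {ι : Type*} [Fintype ι]
    (r : ι → G) {S : Set G} (hS : ∀ h, h ∈ S ↔ ∃ i, (r i)⁻¹ * h ∈ K)
    (hr : ∀ i j, (r i)⁻¹ * r j ∈ K → i = j) : μ S = Fintype.card ι * μ (K : Set G) := by
  have hS' : S = ⋃ i, {h | (r i)⁻¹ * h ∈ K} := by
    ext h
    simp [hS]
  rw [hS', measure_iUnion]
  · simp only [measure_leftCoset]
    rw [tsum_fintype, Finset.sum_const, Finset.card_univ, nsmul_eq_mul]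
  · intro i j hij
    refine Set.disjoint_left.2 fun h hi hj => hij (hr i j ?_)
    have := K.mul_mem hi (K.inv_mem hj)
    simpa [mul_assoc] using this
  · exact fun i => (isOpen_leftCoset hK (r i)).measurableSet

theorem measurable_of_fibers {X : Type*} [MeasurableSpace X] {π : G → X}
    (hK : IsOpen (K : Set G)) (hπ : ∀ g h, π g = π h ↔ g⁻¹ * h ∈ K) :
    Measurable π := by
  intro s _
  refine IsOpen.measurableSet (isOpen_iff_mem_nhds.2 fun g hg => ?_)
  refine Filter.mem_of_superset ((isOpen_leftCoset hK g).mem_nhds ?_) fun h hh => ?_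
  · change g⁻¹ * g ∈ K
    rw [inv_mul_cancel]
    exact K.one_mem
  · rw [Set.mem_preimage, ← (hπ g h).2 hh]
    exact hg

variable {X : Type*} [MeasurableSpace X] [DiscreteMeasurableSpace X] {π : G → X}

/-- The fibres of `π` are the left cosets of `K`, all of measure `μ K`. An infinite set has infinite
measure on both sides since `μ K ≠ 0`, so no countability of the coset space is needed. -/
theorem map_eq_smul_count (hK : IsOpen (K : Set G)) (hK0 : μ (K : Set G) ≠ 0)
    (hπ : ∀ g h, π g = π h ↔ g⁻¹ * h ∈ K) (hsurj : Function.Surjective π) :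
    μ.map π = μ (K : Set G) • Measure.count := by
  have hm := measurable_of_fibers hK hπ
  have hfib : ∀ x, μ (π ⁻¹' {x}) = μ (K : Set G) := by
    intro x
    obtain ⟨g, rfl⟩ := hsurj x
    rw [← measure_leftCoset g K]
    congr 1
    ext h
    rw [Set.mem_preimage, Set.mem_singleton_iff, eq_comm]
    exact hπ g h
  have hdisj : ∀ S : Set X, Pairwise (Function.onFun Disjoint fun x : S => π ⁻¹' {(x : X)}) := by
    intro S x y hxy
    refine Set.disjoint_left.2 fun h hx hy => hxy (Subtype.ext ?_)
    exact hx.symm.trans hy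
  have hU : ∀ S : Set X, π ⁻¹' S = ⋃ x : S, π ⁻¹' {(x : X)} := by
    intro S
    ext h
    simp
  ext S hS
  rw [Measure.map_apply hm hS, Measure.smul_apply, Measure.count_apply hS, smul_eq_mul]
  by_cases hfin : S.Finite
  · have : Fintype S := hfin.fintype
    rw [hU, measure_iUnion (hdisj S) fun x => hm (MeasurableSet.of_discrete), tsum_fintype]
    simp only [hfib, Finset.sum_const, Finset.card_univ, nsmul_eq_mul]
    rw [Set.encard_eq_coe_toFinset_card, Set.toFinset_card, mul_comm]
    rfl
  · have hinf : Infinite S := Set.infinite_coe_iff.2 hfin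
    have h1 := tsum_meas_le_meas_iUnion_of_disjoint μ (As := fun x : S => π ⁻¹' {(x : X)})
      (fun x => hm MeasurableSet.of_discrete) (hdisj S)
    simp only [hfib, ENNReal.tsum_const_eq_top_of_ne_zero hK0, top_le_iff] at h1
    rw [hU, h1, Set.encard_eq_top_iff.2 hfin]
    simp [hK0]

theorem integrable_of_summable_cosets (hK : IsOpen (K : Set G)) (hK0 : μ (K : Set G) ≠ 0)
    (hKfin : μ (K : Set G) ≠ ⊤) (hπ : ∀ g h, π g = π h ↔ g⁻¹ * h ∈ K)
    (hsurj : Function.Surjective π) {f : X → ℂ} (hf : Summable fun x => ‖f x‖) :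
    Integrable (fun g => f (π g)) μ := by
  have h1 : Integrable f (μ.map π) := by
    rw [map_eq_smul_count hK hK0 hπ hsurj]
    exact (integrable_count_iff.2 hf).smul_measure hKfin
  exact h1.comp_measurable (measurable_of_fibers hK hπ)

/-- No integrability is required, as both the change of variables and the scaling of the measure
hold for the Bochner integral of any measurable function. -/
theorem integral_cosets (hK : IsOpen (K : Set G)) (hK0 : μ (K : Set G) ≠ 0)
    (hπ : ∀ g h, π g = π h ↔ g⁻¹ * h ∈ K) (hsurj : Function.Surjective π) (f : X → ℂ) :
    ∫ g, f (π g) ∂μ = (μ (K : Set G)).toReal • ∫ x, f x ∂Measure.count := by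
  have hm := measurable_of_fibers hK hπ
  rw [← integral_map hm.aemeasurable (Measurable.of_discrete (f := f)).aestronglyMeasurable,
    map_eq_smul_count hK hK0 hπ hsurj, integral_smul_measure]

/-- An element that normalizes `K` permutes the left cosets of `K` from the right, and these all
have the same measure. Unimodularity of `G` is not needed. -/
theorem integral_mul_right_of_normalizes (hK : IsOpen (K : Set G)) (hK0 : μ (K : Set G) ≠ 0)
    {c : G} (hc : ∀ k ∈ K, c⁻¹ * k * c ∈ K) (hc' : ∀ k ∈ K, c * k * c⁻¹ ∈ K) {F : G → ℂ}
    (hF : ∀ g, ∀ k ∈ K, F (g * k) = F g) : ∫ g, F (g * c) ∂μ = ∫ g, F g ∂μ := by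
  let _ : MeasurableSpace (G ⧸ K) := ⊤
  have _ : DiscreteMeasurableSpace (G ⧸ K) := ⟨fun _ => trivial⟩
  have hπ : ∀ g h : G, (QuotientGroup.mk g : G ⧸ K) = QuotientGroup.mk h ↔ g⁻¹ * h ∈ K :=
    fun g h => QuotientGroup.eq
  have hFc : ∀ g, ∀ k ∈ K, F (g * k * c) = F (g * c) := by
    intro g k hk
    have := hF (g * c) _ (hc k hk)
    rw [← this]
    congr 1
    group
  let f : G ⧸ K → ℂ := fun x => F x.out
  have hf : ∀ g : G, f (QuotientGroup.mk g) = F g := apply_out_eq hF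
  let ρ : G ⧸ K ≃ G ⧸ K :=
    { toFun := Quotient.map' (fun g => g * c) (by
        intro g h hgh
        rw [QuotientGroup.leftRel_apply] at hgh ⊢
        have := hc _ hgh
        simpa [mul_assoc] using this)
      invFun := Quotient.map' (fun g => g * c⁻¹) (by
        intro g h hgh
        rw [QuotientGroup.leftRel_apply] at hgh ⊢
        have := hc' _ hgh
        simpa [mul_assoc] using this)
      left_inv := by
        intro x
        induction x using QuotientGroup.induction_on with
        | H g => exact congrArg QuotientGroup.mk (mul_inv_cancel_right g c)
      right_inv := by
        intro x
        induction x using QuotientGroup.induction_on with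
        | H g => exact congrArg QuotientGroup.mk (inv_mul_cancel_right g c) }
  have hρ : ∀ g : G, f (ρ (QuotientGroup.mk g)) = F (g * c) := fun g => hf (g * c)
  have h1 := integral_cosets hK hK0 hπ QuotientGroup.mk_surjective f
  have h2 := integral_cosets hK hK0 hπ QuotientGroup.mk_surjective (fun x => f (ρ x))
  simp only [hf, hρ] at h1 h2
  rw [h1, h2]
  congr 1
  have hmp : MeasurePreserving ρ (Measure.count : Measure (G ⧸ K)) Measure.count := by
    refine ⟨Measurable.of_discrete, ?_⟩
    ext S hS
    rw [Measure.map_apply Measurable.of_discrete hS, Measure.count_apply MeasurableSet.of_discrete,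
      Measure.count_apply hS, ← Equiv.image_symm_eq_preimage,
      Function.Injective.encard_image ρ.symm.injective]
  exact hmp.integral_comp
    ⟨ρ.injective, Measurable.of_discrete, fun _ _ => MeasurableSet.of_discrete⟩ _

/-- Translation preserves the integral and also multiplies it by `z ≠ 1`. For a function that is not
integrable, the convention that its integral is zero is consistent with this. -/
theorem integral_eq_zero_of_mul_right (hK : IsOpen (K : Set G)) (hK0 : μ (K : Set G) ≠ 0)
    {c : G} (hc : ∀ k ∈ K, c⁻¹ * k * c ∈ K) (hc' : ∀ k ∈ K, c * k * c⁻¹ ∈ K) {F : G → ℂ}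
    (hF : ∀ g, ∀ k ∈ K, F (g * k) = F g) {z : ℂ} (hz : z ≠ 1) (hFc : ∀ g, F (g * c) = z * F g) :
    ∫ g, F g ∂μ = 0 := by
  have h := integral_mul_right_of_normalizes (μ := μ) hK hK0 hc hc' hF
  simp only [hFc, integral_const_mul] at h
  have h2 : (z - 1) * ∫ g, F g ∂μ = 0 := by linear_combination h
  exact (mul_eq_zero.1 h2).resolve_left (sub_ne_zero.2 hz)

/-- A function that is right invariant under an open subgroup is integrable if its values on the
cosets in its support are dominated by a summable family. -/
theorem integrable_of_coset_bound (hK : IsOpen (K : Set G)) (hK0 : μ (K : Set G) ≠ 0)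
    (hKfin : μ (K : Set G) ≠ ⊤) {F : G → ℂ} (hF : ∀ g, ∀ k ∈ K, F (g * k) = F g)
    {ι : Type*} (label : G → ι) {B : ι → ℝ} (hB : Summable B)
    (hlabel : ∀ g h, F g ≠ 0 → F h ≠ 0 → label g = label h → g⁻¹ * h ∈ K)
    (hbound : ∀ g, F g ≠ 0 → ‖F g‖ ≤ B (label g)) : Integrable F μ := by
  let _ : MeasurableSpace (G ⧸ K) := ⊤
  have _ : DiscreteMeasurableSpace (G ⧸ K) := ⟨fun _ => trivial⟩
  have hπ : ∀ g h : G, (QuotientGroup.mk g : G ⧸ K) = QuotientGroup.mk h ↔ g⁻¹ * h ∈ K :=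
    fun g h => QuotientGroup.eq
  let f : G ⧸ K → ℂ := fun x => F x.out
  have hf : ∀ g : G, f (QuotientGroup.mk g) = F g := apply_out_eq hF
  have hsum : Summable fun x => ‖f x‖ := by
    have hsupp : Function.support (fun x => ‖f x‖) ⊆ {x | f x ≠ 0} := by
      intro x hx
      simpa using hx
    rw [← summable_subtype_iff_indicator.trans (iff_of_eq (congrArg (Summable ·)
      (Set.indicator_eq_self.2 hsupp)))]
    refine Summable.of_nonneg_of_le (fun x => norm_nonneg _) (fun x => hbound _ x.2)
      (hB.comp_injective (i := fun x : {x | f x ≠ 0} => label (x : G ⧸ K).out) ?_)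
    intro x y hxy
    have := (hπ _ _).2 (hlabel _ _ x.2 y.2 hxy)
    rw [QuotientGroup.out_eq', QuotientGroup.out_eq'] at this
    exact Subtype.ext this
  have := integrable_of_summable_cosets hK hK0 hKfin hπ QuotientGroup.mk_surjective hsum
  simpa only [hf] using this

end OpenSubgroup

/-! ### Topology of `U(1,1)(ℚ_p)` -/

section Topology

variable {R : Type*} [TopologicalSpace R] {a b : R}

theorem continuous_quadratic_re :
    Continuous (QuadraticAlgebra.re : QuadraticAlgebra R a b → R) := by
  have h : Continuous (QuadraticAlgebra.equivProd a b) := continuous_induced_dom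
  exact continuous_fst.comp h

theorem continuous_quadratic_im :
    Continuous (QuadraticAlgebra.im : QuadraticAlgebra R a b → R) := by
  have h : Continuous (QuadraticAlgebra.equivProd a b) := continuous_induced_dom
  exact continuous_snd.comp h

theorem continuous_quadratic_of {X : Type*} [TopologicalSpace X] {f : X → QuadraticAlgebra R a b}
    (h₁ : Continuous fun x => (f x).re) (h₂ : Continuous fun x => (f x).im) : Continuous f :=
  continuous_induced_rng.2 (h₁.prodMk h₂)

instance [CommRing R] [IsTopologicalRing R] : ContinuousAdd (QuadraticAlgebra R a b) := ⟨by
  have h₁ := continuous_quadratic_re (a := a) (b := b)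
  have h₂ := continuous_quadratic_im (a := a) (b := b)
  refine continuous_quadratic_of ?_ ?_
  · exact (h₁.comp continuous_fst).add (h₁.comp continuous_snd)
  · exact (h₂.comp continuous_fst).add (h₂.comp continuous_snd)⟩

instance [CommRing R] [IsTopologicalRing R] : ContinuousMul (QuadraticAlgebra R a b) := ⟨by
  have h₁ := continuous_quadratic_re (a := a) (b := b)
  have h₂ := continuous_quadratic_im (a := a) (b := b)
  have a₁ := h₁.comp (continuous_fst (X := QuadraticAlgebra R a b) (Y := QuadraticAlgebra R a b))
  have a₂ := h₂.comp (continuous_fst (X := QuadraticAlgebra R a b) (Y := QuadraticAlgebra R a b))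
  have b₁ := h₁.comp (continuous_snd (X := QuadraticAlgebra R a b) (Y := QuadraticAlgebra R a b))
  have b₂ := h₂.comp (continuous_snd (X := QuadraticAlgebra R a b) (Y := QuadraticAlgebra R a b))
  refine continuous_quadratic_of ?_ ?_
  · simp only [QuadraticAlgebra.re_mul]
    exact (a₁.mul b₁).add ((continuous_const.mul a₂).mul b₂)
  · simp only [QuadraticAlgebra.im_mul]
    exact ((a₁.mul b₂).add (a₂.mul b₁)).add ((continuous_const.mul a₂).mul b₂)⟩

end Topology

/-! ### Matrix coordinates on `U(1,1)(ℚ_p)` -/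

section UnitaryGroup

variable {d : ℕ} {p : Nat.Primes}

theorem continuous_umat (i j : Fin 2) :
    Continuous fun h : Ftilde₁ d ℚ_[p] => umat h i j := by
  have h1 : Continuous fun h : Ftilde₁ d ℚ_[p] => umat h :=
    Units.continuous_val.comp (continuous_subtype_val.comp continuous_subtype_val)
  exact (continuous_apply j).comp ((continuous_apply i).comp h1)

theorem umat_mul (g h : Ftilde₁ d ℚ_[p]) : umat (g * h) = umat g * umat h := rfl

theorem umat_one : umat (1 : Ftilde₁ d ℚ_[p]) = 1 := rfl

theorem umat_mul_apply (g h : Ftilde₁ d ℚ_[p]) (i j : Fin 2) :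
    umat (g * h) i j = umat g i 0 * umat h 0 j + umat g i 1 * umat h 1 j := by
  rw [umat_mul, Matrix.mul_apply, Fin.sum_univ_two]

theorem umat_inv (h : Ftilde₁ d ℚ_[p]) : umat h⁻¹ =
    !![star (umat h 1 1), -star (umat h 0 1); -star (umat h 1 0), star (umat h 0 0)] := by
  have h1 : umat h⁻¹ * umat h = 1 := by
    rw [← umat_mul, inv_mul_cancel, umat_one]
  have h2 : !![star (umat h 1 1), -star (umat h 0 1); -star (umat h 1 0), star (umat h 0 0)] *
      umat h = 1 := by
    obtain ⟨r1, r2, r3⟩ := umat_relations h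
    have r3' := congrArg star r3
    simp only [star_sub, star_mul, star_star, star_one] at r3'
    refine Matrix.ext fun i j => ?_
    fin_cases i <;> fin_cases j <;> simp [Matrix.mul_apply, Fin.sum_univ_two]
    · linear_combination r3'
    · linear_combination -r2
    · linear_combination r1
    · linear_combination r3
  rw [← Matrix.inv_eq_left_inv h1, Matrix.inv_eq_left_inv h2]

/-- The element of `U(1,1)(ℚ_p)` with given entries. -/
theorem exists_umat_eq {x y z w : LAlg d ℚ_[p]} (h₁ : star x * z = star z * x)
    (h₂ : star y * w = star w * y) (h₃ : star x * w - star z * y = 1) :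
    ∃ h : Ftilde₁ d ℚ_[p], umat h = !![x, y; z, w] := by
  have h3' := congrArg star h₃
  simp only [star_sub, star_mul, star_star, star_one] at h3'
  have hinv : !![star w, -star y; -star z, star x] * !![x, y; z, w] = 1 := by
    refine Matrix.ext fun i j => ?_
    fin_cases i <;> fin_cases j <;> simp [Matrix.mul_apply, Fin.sum_univ_two]
    · linear_combination h3'
    · linear_combination -h₂
    · linear_combination h₁
    · linear_combination h₃
  let g : GL (Fin 2) (LAlg d ℚ_[p]) := ⟨!![x, y; z, w], _, mul_eq_one_comm.1 hinv, hinv⟩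
  have hg : (g : Matrix (Fin 2) (Fin 2) (LAlg d ℚ_[p]))ᴴ *
      J₁.map (Int.cast : ℤ → LAlg d ℚ_[p]) * g = J₁.map (Int.cast : ℤ → LAlg d ℚ_[p]) := by
    refine Matrix.ext fun i j => ?_
    fin_cases i <;> fin_cases j <;> simp [g, Matrix.mul_apply, Fin.sum_univ_two, J₁]
    · linear_combination h₁
    · linear_combination h₃
    · linear_combination -h3'
    · linear_combination h₂
  exact ⟨⟨⟨g, 1, by rw [Units.val_one, map_one, one_smul]; exact hg⟩, hg⟩, rfl⟩

theorem eq_algebraMap_of_star_eq {u : LAlg d ℚ_[p]} (h : star u = u) :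
    ∃ r : ℚ_[p], u = algebraMap _ _ r := by
  refine ⟨u.re, QuadraticAlgebra.ext (by simp) ?_⟩
  have := congrArg QuadraticAlgebra.im h
  rw [QuadraticAlgebra.im_star] at this
  rw [QuadraticAlgebra.algebraMap_im]
  have h2 : (2 : ℚ_[p]) * u.im = 0 := by linear_combination -this
  exact (mul_eq_zero.1 h2).resolve_left two_ne_zero

/-- The parametrization of the elements `(x, y; z, w)` with `x ≠ 0`. -/
theorem exists_ratios [InertAt d p] {h : Ftilde₁ d ℚ_[p]} (hx : umat h 0 0 ≠ 0) :
    ∃ ζ η : ℚ_[p], umat h 1 0 = algebraMap _ _ ζ * umat h 0 0 ∧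
      umat h 0 1 = algebraMap _ _ η * umat h 0 0 ∧
      umat h 1 1 = algebraMap _ _ ζ * (algebraMap _ _ η * umat h 0 0) + (star (umat h 0 0))⁻¹ := by
  have hsx : star (umat h 0 0) ≠ 0 := by simpa using hx
  obtain ⟨r1, -, -⟩ := umat_relations h
  -- The relations of `h` concern its columns and show that `z/x` is self-conjugate. For `y/x` a
  -- relation on the first row is needed, and `h⁻¹` provides it.
  obtain ⟨-, r2, -⟩ := umat_relations h⁻¹
  rw [umat_inv] at r2
  simp at r2
  obtain ⟨ζ, hζ⟩ := eq_algebraMap_of_star_eq (u := umat h 1 0 / umat h 0 0) (by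
    rw [div_eq_mul_inv, star_mul, star_inv₀]
    field_simp
    linear_combination -r1)
  obtain ⟨η, hη⟩ := eq_algebraMap_of_star_eq (u := umat h 0 1 / umat h 0 0) (by
    rw [div_eq_mul_inv, star_mul, star_inv₀]
    field_simp
    linear_combination -r2)
  have hz : umat h 1 0 = algebraMap _ _ ζ * umat h 0 0 := by rw [← hζ]; field_simp
  have hy : umat h 0 1 = algebraMap _ _ η * umat h 0 0 := by rw [← hη]; field_simp
  refine ⟨ζ, η, hz, hy, ?_⟩
  have := lower_sub_mul_div hx
  rw [hζ] at this
  rw [← this, ← hy]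
  ring

end UnitaryGroup

/-! ### Compact open subgroups of `U(1,1)(ℚ_p)` -/

section Subgroups

variable {d : ℕ} {p : Nat.Primes}

theorem qabs_mul_le_one [InertAt d p] {u v : LAlg d ℚ_[p]} (hu : qabs u ≤ 1) (hv : qabs v ≤ 1) :
    qabs (u * v) ≤ 1 := by
  rw [qabs_mul]
  exact mul_le_one₀ hu (qabs_nonneg _) hv

theorem qabs_mul_lt_one_right [InertAt d p] {u v : LAlg d ℚ_[p]} (hu : qabs u ≤ 1)
    (hv : qabs v < 1) : qabs (u * v) < 1 := by
  rw [qabs_mul]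
  exact mul_lt_one_of_nonneg_of_lt_one_right hu (qabs_nonneg _) hv

theorem qabs_mul_lt_one_left [InertAt d p] {u v : LAlg d ℚ_[p]} (hu : qabs u < 1)
    (hv : qabs v ≤ 1) : qabs (u * v) < 1 := by
  rw [mul_comm]
  exact qabs_mul_lt_one_right hv hu

/-- Elements of `L_p` that are integral, and rational modulo `p`. -/
def nearRational (d : ℕ) (p : Nat.Primes) [h : InertAt d p] : Subring (LAlg d ℚ_[p]) where
  carrier := {u | qabs u ≤ 1 ∧ ‖u.im‖ < 1}
  zero_mem' := ⟨by rw [qabs_zero]; exact zero_le_one, by simp⟩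
  one_mem' := ⟨qabs_one.le, by rw [QuadraticAlgebra.im_one, norm_zero]; exact zero_lt_one⟩
  add_mem' hu hv := ⟨(qabs_add_le _ _).trans (max_le hu.1 hv.1),
    (Padic.nonarchimedean _ _).trans_lt (max_lt hu.2 hv.2)⟩
  neg_mem' hu := ⟨by rw [qabs_neg]; exact hu.1, by
    rw [QuadraticAlgebra.im_neg, norm_neg]; exact hu.2⟩
  mul_mem' {u v} hu hv := ⟨qabs_mul_le_one hu.1 hv.1, by
    rw [QuadraticAlgebra.im_mul, zero_mul, zero_mul, add_zero]
    refine (Padic.nonarchimedean _ _).trans_lt (max_lt ?_ ?_)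
    · rw [norm_mul]
      exact mul_lt_one_of_nonneg_of_lt_one_right ((norm_re_le_qabs u).trans hu.1)
        (norm_nonneg _) hv.2
    · rw [norm_mul]
      exact mul_lt_one_of_nonneg_of_lt_one_left (norm_nonneg _) hu.2
        ((norm_re_le_qabs v).trans hv.1)⟩

theorem isOpen_qabs_le_one : IsOpen {u : LAlg d ℚ_[p] | qabs u ≤ 1} := by
  have h : {u : LAlg d ℚ_[p] | qabs u ≤ 1} =
      QuadraticAlgebra.re ⁻¹' Metric.closedBall 0 1 ∩
        QuadraticAlgebra.im ⁻¹' Metric.closedBall 0 1 := by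
    ext u
    simp [qabs]
  rw [h]
  exact ((IsUltrametricDist.isOpen_closedBall _ one_ne_zero).preimage continuous_quadratic_re).inter
    ((IsUltrametricDist.isOpen_closedBall _ one_ne_zero).preimage continuous_quadratic_im)

theorem continuous_qabs : Continuous (qabs : LAlg d ℚ_[p] → ℝ) :=
  continuous_quadratic_re.norm.max continuous_quadratic_im.norm

/-- The entries of the inverse of a unitary matrix are conjugates of the original ones up to sign,
so integrality of `h` alone suffices. -/
theorem mem_KF₁_iff (h : Ftilde₁ d ℚ_[p]) : h ∈ KF₁ d p ↔ ∀ i j, qabs (umat h i j) ≤ 1 := by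
  constructor
  · rintro ⟨k, hk⟩ i j
    have : umat h i j = intIncl d p ((k : Matrix (Fin 2) (Fin 2) (LAlg d ℤ_[p])) i j) := by
      rw [umat, ← hk]
      rfl
    rw [this]
    exact qabs_intIncl_le _
  · intro hh
    have hh' : ∀ i j, qabs (umat h⁻¹ i j) ≤ 1 := by
      intro i j
      rw [umat_inv]
      fin_cases i <;> fin_cases j <;> simp [qabs_star, qabs_neg, hh]
    choose f hf using fun i j => (exists_intIncl_eq_iff (umat h i j)).2 (hh i j)
    choose f' hf' using fun i j => (exists_intIncl_eq_iff (umat h⁻¹ i j)).2 (hh' i j)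
    have e : (Matrix.of f).map (intIncl d p) = umat h := by ext1 i j; exact hf i j
    have e' : (Matrix.of f').map (intIncl d p) = umat h⁻¹ := by ext1 i j; exact hf' i j
    have hinj : Function.Injective fun M : Matrix (Fin 2) (Fin 2) (LAlg d ℤ_[p]) =>
        M.map (intIncl d p) := Matrix.map_injective intIncl_injective
    have h1 : Matrix.of f * Matrix.of f' = 1 := by
      apply hinj
      change (Matrix.of f * Matrix.of f').map (intIncl d p) = (1 : Matrix _ _ _).map _
      rw [Matrix.map_mul, e, e', ← umat_mul, mul_inv_cancel, umat_one,
        Matrix.map_one _ (map_zero _) (map_one _)]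
    refine ⟨⟨Matrix.of f, Matrix.of f', h1, mul_eq_one_comm.1 h1⟩, Units.ext ?_⟩
    exact e

variable [InertAt d p]

theorem mem_nearRational {u : LAlg d ℚ_[p]} :
    u ∈ nearRational d p ↔ qabs u ≤ 1 ∧ ‖u.im‖ < 1 := Iff.rfl

theorem star_mem_nearRational {u : LAlg d ℚ_[p]} (hu : u ∈ nearRational d p) :
    star u ∈ nearRational d p := by
  refine ⟨by rw [qabs_star]; exact hu.1, ?_⟩
  rw [QuadraticAlgebra.im_star, norm_neg]
  exact hu.2

theorem nearRational_of_qabs_lt {u : LAlg d ℚ_[p]} (hu : qabs u < 1) : u ∈ nearRational d p :=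
  ⟨hu.le, (norm_im_le_qabs u).trans_lt hu⟩

theorem algebraMap_mem_nearRational {r : ℚ_[p]} (hr : ‖r‖ ≤ 1) :
    algebraMap ℚ_[p] (LAlg d ℚ_[p]) r ∈ nearRational d p :=
  ⟨by rwa [qabs_algebraMap], by simp⟩

/-- The inverse is `ū` divided by the norm, which is a unit of `ℤ_p`. -/
theorem inv_mem_nearRational {u : LAlg d ℚ_[p]} (hu : u ∈ nearRational d p) (h1 : qabs u = 1) :
    u⁻¹ ∈ nearRational d p := by
  have hu0 : u ≠ 0 := fun h => by rw [h, qabs_zero] at h1; exact zero_ne_one h1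
  have hN0 : QuadraticAlgebra.norm u ≠ 0 := by
    rwa [Ne, QuadraticAlgebra.norm_eq_zero_iff_eq_zero]
  have h2 : u⁻¹ = algebraMap _ _ (QuadraticAlgebra.norm u)⁻¹ * star u := by
    refine inv_eq_of_mul_eq_one_right ?_
    rw [mul_left_comm, ← QuadraticAlgebra.algebraMap_norm_eq_mul_star, ← map_mul,
      inv_mul_cancel₀ hN0, map_one]
  rw [h2]
  refine (nearRational d p).mul_mem (algebraMap_mem_nearRational ?_) (star_mem_nearRational hu)
  rw [norm_inv, norm_norm_eq_qabs_sq, h1]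
  simp

/-- The integral elements of `U(1,1)(ℚ_p)` with lower left entry divisible by `p`. -/
def lowerSubgroup (d : ℕ) (p : Nat.Primes) [InertAt d p] : Subgroup (Ftilde₁ d ℚ_[p]) where
  carrier := {h | (∀ i j, qabs (umat h i j) ≤ 1) ∧ qabs (umat h 1 0) < 1}
  one_mem' := by
    refine ⟨fun i j => ?_, ?_⟩
    · rw [umat_one, Matrix.one_apply]
      split_ifs
      · exact qabs_one.le
      · rw [qabs_zero]; exact zero_le_one
    · rw [umat_one, Matrix.one_apply_ne (by decide), qabs_zero]; exact zero_lt_one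
  mul_mem' {g h} hg hh := by
    refine ⟨fun i j => ?_, ?_⟩
    · rw [umat_mul_apply]
      exact (qabs_add_le _ _).trans (max_le (qabs_mul_le_one (hg.1 _ _) (hh.1 _ _))
        (qabs_mul_le_one (hg.1 _ _) (hh.1 _ _)))
    · rw [umat_mul_apply]
      exact (qabs_add_le _ _).trans_lt (max_lt (qabs_mul_lt_one_left hg.2 (hh.1 _ _))
        (qabs_mul_lt_one_right (hg.1 _ _) hh.2))
  inv_mem' {h} hh := by
    refine ⟨fun i j => ?_, ?_⟩
    · rw [umat_inv]
      fin_cases i <;> fin_cases j <;> simp [qabs_star, qabs_neg, hh.1]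
    · rw [umat_inv]
      simpa [qabs_star, qabs_neg] using hh.2

/-- The integral elements of `U(1,1)(ℚ_p)` whose reduction modulo `p` is an upper triangular
matrix with entries in `𝔽_p`. -/
def rationalSubgroup (d : ℕ) (p : Nat.Primes) [InertAt d p] : Subgroup (Ftilde₁ d ℚ_[p]) where
  carrier := {h | (∀ i j, umat h i j ∈ nearRational d p) ∧ qabs (umat h 1 0) < 1}
  one_mem' := by
    refine ⟨fun i j => ?_, ?_⟩
    · rw [umat_one, Matrix.one_apply]
      split_ifs
      · exact (nearRational d p).one_mem
      · exact (nearRational d p).zero_mem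
    · rw [umat_one, Matrix.one_apply_ne (by decide), qabs_zero]; exact zero_lt_one
  mul_mem' {g h} hg hh := by
    refine ⟨fun i j => ?_, ?_⟩
    · rw [umat_mul_apply]
      exact (nearRational d p).add_mem ((nearRational d p).mul_mem (hg.1 _ _) (hh.1 _ _))
        ((nearRational d p).mul_mem (hg.1 _ _) (hh.1 _ _))
    · rw [umat_mul_apply]
      exact (qabs_add_le _ _).trans_lt (max_lt (qabs_mul_lt_one_left hg.2 (hh.1 _ _).1)
        (qabs_mul_lt_one_right (hg.1 _ _).1 hh.2))
  inv_mem' {h} hh := by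
    refine ⟨fun i j => ?_, ?_⟩
    · rw [umat_inv]
      fin_cases i <;> fin_cases j
      · exact star_mem_nearRational (hh.1 1 1)
      · exact (nearRational d p).neg_mem (star_mem_nearRational (hh.1 0 1))
      · exact (nearRational d p).neg_mem (star_mem_nearRational (hh.1 1 0))
      · exact star_mem_nearRational (hh.1 0 0)
    · rw [umat_inv]
      simpa [qabs_star, qabs_neg] using hh.2

theorem mem_lowerSubgroup {h : Ftilde₁ d ℚ_[p]} : h ∈ lowerSubgroup d p ↔
    (∀ i j, qabs (umat h i j) ≤ 1) ∧ qabs (umat h 1 0) < 1 := Iff.rfl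

theorem mem_rationalSubgroup {h : Ftilde₁ d ℚ_[p]} : h ∈ rationalSubgroup d p ↔
    (∀ i j, umat h i j ∈ nearRational d p) ∧ qabs (umat h 1 0) < 1 := Iff.rfl

theorem isOpen_lowerSubgroup : IsOpen (lowerSubgroup d p : Set (Ftilde₁ d ℚ_[p])) := by
  have h : (lowerSubgroup d p : Set (Ftilde₁ d ℚ_[p])) =
      (⋂ i, ⋂ j, {h | qabs (umat h i j) ≤ 1}) ∩ {h | qabs (umat h 1 0) < 1} := by
    ext h
    simp [mem_lowerSubgroup]
  rw [h]
  refine (isOpen_iInter_of_finite fun i => isOpen_iInter_of_finite fun j =>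
    isOpen_qabs_le_one.preimage (continuous_umat i j)).inter ?_
  exact isOpen_lt (continuous_qabs.comp (continuous_umat 1 0)) continuous_const

theorem isOpen_rationalSubgroup : IsOpen (rationalSubgroup d p : Set (Ftilde₁ d ℚ_[p])) := by
  have h : (rationalSubgroup d p : Set (Ftilde₁ d ℚ_[p])) =
      (⋂ i, ⋂ j, ({h | qabs (umat h i j) ≤ 1} ∩ {h | ‖(umat h i j).im‖ < 1})) ∩
        {h | qabs (umat h 1 0) < 1} := by
    ext h
    simp [mem_rationalSubgroup, mem_nearRational]
  rw [h]
  refine (isOpen_iInter_of_finite fun i => isOpen_iInter_of_finite fun j =>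
    (isOpen_qabs_le_one.preimage (continuous_umat i j)).inter ?_).inter ?_
  · exact isOpen_lt (continuous_quadratic_im.comp (continuous_umat i j)).norm continuous_const
  · exact isOpen_lt (continuous_qabs.comp (continuous_umat 1 0)) continuous_const

/-- For `h` in the lower subgroup, the upper left entry is a unit. -/
theorem qabs_eq_one_of_mem_lowerSubgroup {h : Ftilde₁ d ℚ_[p]} (hh : h ∈ lowerSubgroup d p) :
    qabs (umat h 0 0) = 1 := by
  obtain ⟨-, -, h3⟩ := umat_relations h
  refine le_antisymm (hh.1 0 0) ?_
  have h4 := qabs_sub_le (star (umat h 0 0) * umat h 1 1) (star (umat h 1 0) * umat h 0 1)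
  rw [h3, qabs_one, qabs_mul, qabs_mul, qabs_star, qabs_star] at h4
  rcases le_max_iff.1 h4 with h5 | h5
  · exact h5.trans (mul_le_of_le_one_right (qabs_nonneg _) (hh.1 1 1))
  · exact absurd h5 (not_le.2 (mul_lt_one_of_nonneg_of_lt_one_left (qabs_nonneg _) hh.2 (hh.1 0 1)))

theorem rationalSubgroup_le : rationalSubgroup d p ≤ lowerSubgroup d p :=
  fun _ hh => ⟨fun i j => (hh.1 i j).1, hh.2⟩

/-- A criterion for membership in terms of the first column and the upper right entry. -/
theorem mem_rationalSubgroup_of {h : Ftilde₁ d ℚ_[p]} (hx : umat h 0 0 ∈ nearRational d p)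
    (hx1 : qabs (umat h 0 0) = 1) (hy : qabs (umat h 0 1) ≤ 1) (hz : qabs (umat h 1 0) < 1) :
    h ∈ rationalSubgroup d p := by
  have hx0 : umat h 0 0 ≠ 0 := fun h0 => by rw [h0, qabs_zero] at hx1; exact zero_ne_one hx1
  obtain ⟨ζ, η, hζ, hη, hw⟩ := exists_ratios hx0
  have hζ1 : ‖ζ‖ < 1 := by
    rwa [hζ, qabs_mul, hx1, mul_one, qabs_algebraMap] at hz
  have hη1 : ‖η‖ ≤ 1 := by
    rwa [hη, qabs_mul, hx1, mul_one, qabs_algebraMap] at hy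
  have hyr : umat h 0 1 ∈ nearRational d p := by
    rw [hη]
    exact (nearRational d p).mul_mem (algebraMap_mem_nearRational hη1) hx
  refine ⟨fun i j => ?_, hz⟩
  fin_cases i <;> fin_cases j
  · exact hx
  · exact hyr
  · exact nearRational_of_qabs_lt hz
  · change umat h 1 1 ∈ nearRational d p
    rw [hw, ← hη]
    exact (nearRational d p).add_mem ((nearRational d p).mul_mem
      (algebraMap_mem_nearRational hζ1.le) hyr)
      (inv_mem_nearRational (star_mem_nearRational hx) (by rw [qabs_star, hx1]))

/-- The element `diag(u, ū⁻¹)`. -/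
theorem exists_torus {u : LAlg d ℚ_[p]} (hu : u ≠ 0) :
    ∃ c : Ftilde₁ d ℚ_[p], umat c = !![u, 0; 0, (star u)⁻¹] :=
  exists_umat_eq (by simp) (by simp) (by
    rw [mul_inv_cancel₀ (by simpa using hu)]
    simp)

/-- The element `(1, 0; ζ, 1)`. -/
theorem exists_lowerUnipotent (ζ : ℚ_[p]) :
    ∃ c : Ftilde₁ d ℚ_[p], umat c = !![1, 0; algebraMap _ _ ζ, 1] :=
  exists_umat_eq (by
    rw [star_one, one_mul, mul_one]
    exact QuadraticAlgebra.ext (by simp) (by simp)) (by simp) (by simp)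

/-- The element `(0, 1; -1, 0)`. -/
theorem exists_weyl : ∃ c : Ftilde₁ d ℚ_[p], umat c = !![0, 1; -1, 0] :=
  exists_umat_eq (by simp) (by simp) (by simp)

end Subgroups

/-! ### The volume of the rational subgroup -/

section Volume

variable {d : ℕ} {p : Nat.Primes}

/-- Lifts of residue classes. -/
def lift (p : Nat.Primes) (t : ZMod p) : ℤ_[p] := (t.val : ℤ_[p])

theorem norm_lift_sub_lt_iff (t : ZMod p) (r : ℤ_[p]) :
    ‖(lift p t : ℚ_[p]) - r‖ < 1 ↔ t = PadicInt.toZMod r := by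
  have h : ‖(lift p t : ℚ_[p]) - r‖ = ‖lift p t - r‖ := by
    rw [PadicInt.norm_def]; push_cast; rfl
  rw [h, ← toZMod_eq_zero_iff_norm_lt, map_sub, lift, map_natCast, ZMod.natCast_zmod_val,
    sub_eq_zero]

theorem toZMod_lift (t : ZMod p) : PadicInt.toZMod (lift p t) = t := by
  rw [lift, map_natCast, ZMod.natCast_zmod_val]

/-- Representatives of the units modulo `p` up to rational units modulo `p`. -/
def unitRep (d : ℕ) (p : Nat.Primes) : Option (ZMod p) → LAlg d ℚ_[p]
  | none => 1
  | some t => ⟨lift p t, 1⟩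

theorem qabs_unitRep (i : Option (ZMod p)) : qabs (unitRep d p i) = 1 := by
  rcases i with _ | t
  · exact qabs_one
  · change max ‖(lift p t : ℚ_[p])‖ ‖(1 : ℚ_[p])‖ = 1
    rw [norm_one]
    exact max_eq_right (PadicInt.norm_le_one _)

theorem unitRep_ne_zero (i : Option (ZMod p)) : unitRep d p i ≠ 0 := fun h => by
  have := qabs_unitRep (d := d) i
  rw [h, qabs_zero] at this
  exact zero_ne_one this

variable [InertAt d p]

theorem unitRep_some_not_mem (t : ZMod p) : unitRep d p (some t) ∉ nearRational d p := by
  intro h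
  have h2 := h.2
  change ‖(1 : ℚ_[p])‖ < 1 at h2
  rw [norm_one] at h2
  exact lt_irrefl _ h2

/-- If the imaginary coordinate is a unit, then `x` is that coordinate times `ρ + √-d` with `ρ`
integral. Replacing `ρ` by the lift of its residue changes the second factor only by a multiple of
`p`. -/
theorem exists_unitRep_mul_mem {x : LAlg d ℚ_[p]} (hx : qabs x = 1) :
    ∃ i, (unitRep d p i)⁻¹ * x ∈ nearRational d p := by
  by_cases him : ‖x.im‖ < 1
  · refine ⟨none, ?_⟩
    change (1 : LAlg d ℚ_[p])⁻¹ * x ∈ _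
    rw [inv_one, one_mul]
    exact ⟨hx.le, him⟩
  · have him1 : ‖x.im‖ = 1 := le_antisymm ((norm_im_le_qabs x).trans hx.le) (not_lt.1 him)
    have him0 : x.im ≠ 0 := fun h => by rw [h, norm_zero] at him1; exact zero_ne_one him1
    have hρ : ‖x.re / x.im‖ ≤ 1 := by
      rw [norm_div, him1, div_one]
      exact (norm_re_le_qabs x).trans hx.le
    set t := PadicInt.toZMod (⟨x.re / x.im, hρ⟩ : ℤ_[p]) with ht
    have hlt := (norm_lift_sub_lt_iff t ⟨x.re / x.im, hρ⟩).2 ht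
    change ‖(lift p t : ℚ_[p]) - x.re / x.im‖ < 1 at hlt
    refine ⟨some t, ?_⟩
    have hu := unitRep_ne_zero (d := d) (some t)
    have hxe : x = algebraMap _ _ x.im *
        (unitRep d p (some t) - algebraMap _ _ ((lift p t : ℚ_[p]) - x.re / x.im)) := by
      refine QuadraticAlgebra.ext ?_ ?_
      · simp [unitRep]
        field_simp
      · simp [unitRep]
    have he : (unitRep d p (some t))⁻¹ * x = algebraMap _ _ x.im *
        (1 - (unitRep d p (some t))⁻¹ * algebraMap _ _ ((lift p t : ℚ_[p]) - x.re / x.im)) := by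
      conv_lhs => rw [hxe]
      field_simp
    rw [he]
    refine (nearRational d p).mul_mem (algebraMap_mem_nearRational him1.le)
      ((nearRational d p).sub_mem (nearRational d p).one_mem (nearRational_of_qabs_lt
        (qabs_mul_lt_one_right ?_ ?_)))
    · rw [qabs_inv, qabs_unitRep, inv_one]
    · rwa [qabs_algebraMap]

/-- The quotient of `t' + √-d` by `t + √-d` is `1 + δ (t + √-d)⁻¹` with `δ` the difference of the
lifts. If `δ` were a unit, `t + √-d` would be rational modulo `p`, but its imaginary coordinate is
one. -/
theorem unitRep_injective_mod {i j : Option (ZMod p)}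
    (h : (unitRep d p i)⁻¹ * unitRep d p j ∈ nearRational d p) : i = j := by
  have hinv : ∀ t : ZMod p, (unitRep d p (some t))⁻¹ ∉ nearRational d p := by
    intro t ht
    have := inv_mem_nearRational ht (by rw [qabs_inv, qabs_unitRep, inv_one])
    rw [inv_inv] at this
    exact unitRep_some_not_mem t this
  rcases i with _ | t <;> rcases j with _ | t'
  · rfl
  · refine absurd ?_ (unitRep_some_not_mem (d := d) t')
    change (1 : LAlg d ℚ_[p])⁻¹ * _ ∈ _ at h
    rwa [inv_one, one_mul] at h
  · refine absurd ?_ (hinv t)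
    change _ * (1 : LAlg d ℚ_[p]) ∈ _ at h
    rwa [mul_one] at h
  · set δ : ℚ_[p] := (lift p t' : ℚ_[p]) - lift p t with hδ
    have he : unitRep d p (some t') = unitRep d p (some t) + algebraMap _ _ δ := by
      refine QuadraticAlgebra.ext ?_ ?_ <;> simp [unitRep, hδ]
    rw [he, mul_add, inv_mul_cancel₀ (unitRep_ne_zero _)] at h
    have h1 := (nearRational d p).sub_mem h (nearRational d p).one_mem
    rw [add_sub_cancel_left] at h1
    by_cases hlt : ‖δ‖ < 1
    · rw [hδ, norm_lift_sub_lt_iff, toZMod_lift] at hlt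
      rw [hlt]
    · have hδ1 : ‖δ‖ = 1 := by
        refine le_antisymm ?_ (not_lt.1 hlt)
        rw [hδ, sub_eq_add_neg]
        refine (Padic.nonarchimedean _ _).trans (max_le (PadicInt.norm_le_one _) ?_)
        rw [norm_neg]
        exact PadicInt.norm_le_one _
      have hδ0 : δ ≠ 0 := fun h0 => by rw [h0, norm_zero] at hδ1; exact zero_ne_one hδ1
      refine absurd ?_ (hinv t)
      have h2 := (nearRational d p).mul_mem h1 (algebraMap_mem_nearRational (d := d) (r := δ⁻¹)
        (by rw [norm_inv, hδ1, inv_one]))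
      rwa [mul_assoc, ← map_mul, mul_inv_cancel₀ hδ0, map_one, mul_one] at h2

/-- By `mem_rationalSubgroup_of`, a coset is determined by the class of `x` in `𝔽_{p²}ˣ / 𝔽_pˣ`, a
group of order `p + 1`. Torus elements represent the classes. -/
theorem measure_lowerSubgroup (μ : Measure (Ftilde₁ d ℚ_[p])) [μ.IsMulLeftInvariant] :
    μ (lowerSubgroup d p : Set (Ftilde₁ d ℚ_[p])) =
      ((p : ℕ) + 1) * μ (rationalSubgroup d p : Set (Ftilde₁ d ℚ_[p])) := by
  choose r hr using fun i => exists_torus (unitRep_ne_zero (d := d) (p := p) i)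
  have hent : ∀ i h, umat ((r i)⁻¹ * h) 0 0 = (unitRep d p i)⁻¹ * umat h 0 0 ∧
      umat ((r i)⁻¹ * h) 0 1 = (unitRep d p i)⁻¹ * umat h 0 1 ∧
      umat ((r i)⁻¹ * h) 1 0 = star (unitRep d p i) * umat h 1 0 := by
    intro i h
    simp only [umat_mul_apply, umat_inv, hr]
    simp [star_inv₀]
  have hrl : ∀ i, r i ∈ lowerSubgroup d p := by
    intro i
    rw [mem_lowerSubgroup, hr]
    refine ⟨fun a b => ?_, ?_⟩
    · fin_cases a <;> fin_cases b <;> simp [qabs_unitRep, qabs_zero, qabs_inv, qabs_star]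
    · simp [qabs_zero]
  have key := measure_eq_card_mul_of_cosets (μ := μ) isOpen_rationalSubgroup r
    (S := (lowerSubgroup d p : Set (Ftilde₁ d ℚ_[p]))) (fun h => ?_) (fun i j hij => ?_)
  · rw [key, Fintype.card_option, ZMod.card]
    push_cast
    rfl
  · constructor
    · intro hh
      have hx1 := qabs_eq_one_of_mem_lowerSubgroup hh
      obtain ⟨i, hi⟩ := exists_unitRep_mul_mem hx1
      obtain ⟨e1, e2, e3⟩ := hent i h
      refine ⟨i, mem_rationalSubgroup_of (by rwa [e1]) ?_ ?_ ?_⟩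
      · rw [e1, qabs_mul, qabs_inv, qabs_unitRep, hx1, inv_one, mul_one]
      · rw [e2, qabs_mul, qabs_inv, qabs_unitRep, inv_one, one_mul]
        exact hh.1 0 1
      · rw [e3, qabs_mul, qabs_star, qabs_unitRep, one_mul]
        exact hh.2
    · rintro ⟨i, hi⟩
      have := (lowerSubgroup d p).mul_mem (hrl i) (rationalSubgroup_le hi)
      rwa [mul_inv_cancel_left] at this
  · have := hij.1 0 0
    rw [(hent i (r j)).1, hr] at this
    exact unitRep_injective_mod this

/-- A coset is determined by the first column modulo `p` as a point of the projective line. That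
point is defined over `𝔽_p`, since `z/x` lies in `ℚ_p` when `x ≠ 0`; this is why the index is `p +
1` and not `p² + 1`. -/
theorem measure_KF₁ (μ : Measure (Ftilde₁ d ℚ_[p])) [μ.IsMulLeftInvariant] :
    μ (KF₁ d p) = ((p : ℕ) + 1) * μ (lowerSubgroup d p : Set (Ftilde₁ d ℚ_[p])) := by
  choose n hn using fun t : ZMod p => exists_lowerUnipotent (d := d) (lift p t : ℚ_[p])
  obtain ⟨w₀, hw₀⟩ := exists_weyl (d := d) (p := p)
  let r : Option (ZMod p) → Ftilde₁ d ℚ_[p] := fun i => i.elim w₀ n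
  have hlift : ∀ t : ZMod p, qabs (algebraMap ℚ_[p] (LAlg d ℚ_[p]) (lift p t)) ≤ 1 := by
    intro t
    rw [qabs_algebraMap]
    exact PadicInt.norm_le_one _
  have hrint : ∀ i a b, qabs (umat (r i) a b) ≤ 1 := by
    intro i a b
    rcases i with _ | t
    · change qabs (umat w₀ a b) ≤ 1
      rw [hw₀]
      fin_cases a <;> fin_cases b <;> simp [qabs_neg, qabs_one, qabs_zero]
    · change qabs (umat (n t) a b) ≤ 1
      rw [hn]
      fin_cases a <;> fin_cases b <;> simp [qabs_one, qabs_zero, hlift]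
  have hmulint : ∀ g h : Ftilde₁ d ℚ_[p], (∀ a b, qabs (umat g a b) ≤ 1) →
      (∀ a b, qabs (umat h a b) ≤ 1) → ∀ a b, qabs (umat (g * h) a b) ≤ 1 := by
    intro g h hg hh a b
    rw [umat_mul_apply]
    exact (qabs_add_le _ _).trans (max_le (qabs_mul_le_one (hg _ _) (hh _ _))
      (qabs_mul_le_one (hg _ _) (hh _ _)))
  have hinvint : ∀ g : Ftilde₁ d ℚ_[p], (∀ a b, qabs (umat g a b) ≤ 1) →
      ∀ a b, qabs (umat g⁻¹ a b) ≤ 1 := by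
    intro g hg a b
    rw [umat_inv]
    fin_cases a <;> fin_cases b <;> simp [qabs_star, qabs_neg, hg]
  have hent₁ : ∀ h, umat (w₀⁻¹ * h) 1 0 = umat h 0 0 := by
    intro h
    simp only [umat_mul_apply, umat_inv, hw₀]
    simp
  have hent₂ : ∀ t h, umat ((n t)⁻¹ * h) 1 0 =
      umat h 1 0 - algebraMap _ _ (lift p t : ℚ_[p]) * umat h 0 0 := by
    intro t h
    have hs : star (algebraMap ℚ_[p] (LAlg d ℚ_[p]) (lift p t)) =
      algebraMap ℚ_[p] (LAlg d ℚ_[p]) (lift p t) := QuadraticAlgebra.ext (by simp) (by simp)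
    simp only [umat_mul_apply, umat_inv, hn]
    simp [hs]
    ring
  have key := measure_eq_card_mul_of_cosets (μ := μ) isOpen_lowerSubgroup r
    (S := KF₁ d p) (fun h => ?_) (fun i j hij => ?_)
  · rw [key, Fintype.card_option, ZMod.card]
    push_cast
    rfl
  · rw [mem_KF₁_iff]
    constructor
    · intro hh
      have hint := fun i => hmulint _ _ (hinvint _ (hrint i)) hh
      rcases lt_or_eq_of_le (hh 0 0) with hlt | heq
      · refine ⟨none, hint _, ?_⟩
        change qabs (umat (w₀⁻¹ * h) 1 0) < 1
        rwa [hent₁]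
      · have hx0 : umat h 0 0 ≠ 0 := fun h0 => by
          rw [h0, qabs_zero] at heq; exact zero_ne_one heq
        obtain ⟨ζ, -, hζ, -, -⟩ := exists_ratios hx0
        have hζ1 : ‖ζ‖ ≤ 1 := by
          have := hh 1 0
          rwa [hζ, qabs_mul, heq, mul_one, qabs_algebraMap] at this
        refine ⟨some (PadicInt.toZMod (⟨ζ, hζ1⟩ : ℤ_[p])), hint _, ?_⟩
        change qabs (umat ((n _)⁻¹ * h) 1 0) < 1
        rw [hent₂, hζ, ← sub_mul, ← map_sub, qabs_mul, heq, mul_one, qabs_algebraMap,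
          norm_sub_rev]
        exact (norm_lift_sub_lt_iff _ ⟨ζ, hζ1⟩).2 rfl
    · rintro ⟨i, hi⟩
      have := hmulint _ _ (hrint i) hi.1
      rwa [mul_inv_cancel_left] at this
  · have h10 := hij.2
    rcases i with _ | t <;> rcases j with _ | t'
    · rfl
    · change qabs (umat (w₀⁻¹ * n t') 1 0) < 1 at h10
      rw [hent₁, hn] at h10
      simp [qabs_one] at h10
    · change qabs (umat ((n t)⁻¹ * w₀) 1 0) < 1 at h10
      rw [hent₂, hw₀] at h10
      simp [qabs_one, qabs_neg] at h10
    · change qabs (umat ((n t)⁻¹ * n t') 1 0) < 1 at h10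
      rw [hent₂, hn] at h10
      simp only [of_apply, cons_val', cons_val_zero, cons_val_one, cons_val_fin_one, mul_one] at h10
      rw [← map_sub, qabs_algebraMap, norm_lift_sub_lt_iff, toZMod_lift] at h10
      rw [h10]

theorem measure_rationalSubgroup {μ : Measure (Ftilde₁ d ℚ_[p])} [μ.IsMulLeftInvariant]
    (hμ : μ (KF₁ d p) = 1) : μ (rationalSubgroup d p : Set (Ftilde₁ d ℚ_[p])) ≠ 0 ∧
      μ (rationalSubgroup d p : Set (Ftilde₁ d ℚ_[p])) ≠ ⊤ ∧
      (μ (rationalSubgroup d p : Set (Ftilde₁ d ℚ_[p]))).toReal = 1 / ((p : ℕ) + 1 : ℝ) ^ 2 := by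
  rw [measure_KF₁, measure_lowerSubgroup] at hμ
  set v := μ (rationalSubgroup d p : Set (Ftilde₁ d ℚ_[p])) with hv
  have h1 : v ≠ 0 := fun h0 => by rw [h0] at hμ; simp at hμ
  refine ⟨h1, fun h0 => ?_, ?_⟩
  · rw [h0, ENNReal.mul_top (by simp), ENNReal.mul_top (by simp)] at hμ
    exact ENNReal.top_ne_one hμ
  · have := congrArg ENNReal.toReal hμ
    rw [ENNReal.toReal_mul, ENNReal.toReal_mul, ENNReal.toReal_one, ENNReal.toReal_add (by simp)
      (by simp), ENNReal.toReal_natCast, ENNReal.toReal_one] at this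
    rw [eq_div_iff (by positivity)]
    linear_combination this

end Volume

/-! ### Points over a product of two rings -/

section Product

variable {d : ℕ} {R S : Type*} [CommRing R] [CommRing S]

/-- The element of `L ⊗ (R × S)` with given components. -/
def LAlg.pair : LAlg d R × LAlg d S →+* LAlg d (R × S) where
  toFun z := ⟨(z.1.re, z.2.re), (z.1.im, z.2.im)⟩
  map_one' := by ext <;> simp [QuadraticAlgebra.re_one, QuadraticAlgebra.im_one]
  map_mul' z w := by ext <;> simp
  map_zero' := by ext <;> simp
  map_add' z w := by ext <;> simp

theorem LAlg.ext_prod {z w : LAlg d (R × S)}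
    (h₁ : LAlg.map (RingHom.fst R S) z = LAlg.map (RingHom.fst R S) w)
    (h₂ : LAlg.map (RingHom.snd R S) z = LAlg.map (RingHom.snd R S) w) : z = w :=
  QuadraticAlgebra.ext
    (Prod.ext (congrArg QuadraticAlgebra.re h₁) (congrArg QuadraticAlgebra.re h₂))
    (Prod.ext (congrArg QuadraticAlgebra.im h₁) (congrArg QuadraticAlgebra.im h₂))

theorem matrix_ext_prod {n : Type*} {M M' : Matrix n n (LAlg d (R × S))}
    (h₁ : M.map (LAlg.map (RingHom.fst R S)) = M'.map (LAlg.map (RingHom.fst R S)))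
    (h₂ : M.map (LAlg.map (RingHom.snd R S)) = M'.map (LAlg.map (RingHom.snd R S))) : M = M' :=
  Matrix.ext fun i j => LAlg.ext_prod (congrFun (congrFun h₁ i) j) (congrFun (congrFun h₂ i) j)

/-- The invertible matrix over a product ring with given components. -/
def glPair {n : Type*} [Fintype n] [DecidableEq n] {A B : Type*} [CommRing A] [CommRing B]
    (g : GL n A) (h : GL n B) : GL n (A × B) where
  val := .of fun i j => ((g : Matrix n n A) i j, (h : Matrix n n B) i j)
  inv := .of fun i j => (((g⁻¹ : GL n A) : Matrix n n A) i j, ((h⁻¹ : GL n B) : Matrix n n B) i j)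
  val_inv := by
    have h₁ : (g : Matrix n n A) * ((g⁻¹ : GL n A) : Matrix n n A) = 1 := by
      rw [← Units.val_mul, mul_inv_cancel, Units.val_one]
    have h₂ : (h : Matrix n n B) * ((h⁻¹ : GL n B) : Matrix n n B) = 1 := by
      rw [← Units.val_mul, mul_inv_cancel, Units.val_one]
    refine Matrix.ext fun i j => Prod.ext ?_ ?_
    · rw [Matrix.mul_apply, Prod.fst_sum]
      refine (congrFun (congrFun h₁ i) j).trans ?_
      rw [Matrix.one_apply, Matrix.one_apply]
      split_ifs <;> rfl
    · rw [Matrix.mul_apply, Prod.snd_sum]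
      refine (congrFun (congrFun h₂ i) j).trans ?_
      rw [Matrix.one_apply, Matrix.one_apply]
      split_ifs <;> rfl
  inv_val := by
    have h₁ : ((g⁻¹ : GL n A) : Matrix n n A) * (g : Matrix n n A) = 1 := by
      rw [← Units.val_mul, inv_mul_cancel, Units.val_one]
    have h₂ : ((h⁻¹ : GL n B) : Matrix n n B) * (h : Matrix n n B) = 1 := by
      rw [← Units.val_mul, inv_mul_cancel, Units.val_one]
    refine Matrix.ext fun i j => Prod.ext ?_ ?_
    · rw [Matrix.mul_apply, Prod.fst_sum]
      refine (congrFun (congrFun h₁ i) j).trans ?_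
      rw [Matrix.one_apply, Matrix.one_apply]
      split_ifs <;> rfl
    · rw [Matrix.mul_apply, Prod.snd_sum]
      refine (congrFun (congrFun h₂ i) j).trans ?_
      rw [Matrix.one_apply, Matrix.one_apply]
      split_ifs <;> rfl

theorem map_unitary_form {T T' : Type*} [CommRing T] [CommRing T'] (φ : T →+* T')
    (M : Matrix (Fin 2) (Fin 2) (LAlg d T)) :
    (Mᴴ * J₁.map (Int.cast : ℤ → LAlg d T) * M).map (LAlg.map φ) =
      (M.map (LAlg.map φ))ᴴ * J₁.map (Int.cast : ℤ → LAlg d T') * M.map (LAlg.map φ) := by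
  have hJ : (J₁.map (Int.cast : ℤ → LAlg d T)).map (LAlg.map φ) =
      J₁.map (Int.cast : ℤ → LAlg d T') := by ext1; simp
  have hs : (M.map (LAlg.map φ))ᴴ = (Mᴴ).map (LAlg.map φ) := by
    ext1 i j; simp [LAlg.map_star]
  rw [hs, ← hJ, Matrix.map_mul, Matrix.map_mul]

theorem map_smul_form {T T' : Type*} [CommRing T] [CommRing T'] (φ : T →+* T') (r : T) :
    (algebraMap T (LAlg d T) r • J₁.map (Int.cast : ℤ → LAlg d T)).map (LAlg.map φ) =
      algebraMap T' (LAlg d T') (φ r) • J₁.map (Int.cast : ℤ → LAlg d T') := by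
  ext1 i j
  simp only [Matrix.map_apply, Matrix.smul_apply, smul_eq_mul, map_mul, LAlg.map_algebraMap,
    map_intCast]

theorem map_smul_mul {T T' : Type*} [CommRing T] [CommRing T'] (φ : T →+* T') (c : LAlg d T)
    (M : Matrix (Fin 2) (Fin 2) (LAlg d T)) (K : Matrix (Fin 2) (Fin 2) T) :
    (c • (M * K.map (algebraMap T (LAlg d T)))).map (LAlg.map φ) =
      LAlg.map φ c • (M.map (LAlg.map φ) * (K.map φ).map (algebraMap T' (LAlg d T'))) := by
  refine Matrix.ext fun i j => ?_
  simp only [Matrix.map_apply, Matrix.smul_apply, smul_eq_mul, map_mul, Matrix.mul_apply, map_sum,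
    LAlg.map_algebraMap]

theorem map_fst_glPair {n : Type*} [Fintype n] [DecidableEq n] {A B : Type*} [CommRing A]
    [CommRing B] (g : GL n A) (h : GL n B) :
    GeneralLinearGroup.map (RingHom.fst A B) (glPair g h) = g :=
  Units.ext (Matrix.ext fun _ _ => rfl)

theorem exists_glPair {n : Type*} [Fintype n] [DecidableEq n] (g : GL n (LAlg d R))
    (h : GL n (LAlg d S)) : ∃ k : GL n (LAlg d (R × S)),
      GeneralLinearGroup.map (LAlg.map (RingHom.fst R S)) k = g ∧
        GeneralLinearGroup.map (LAlg.map (RingHom.snd R S)) k = h := by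
  let e : Matrix n n (LAlg d R) → Matrix n n (LAlg d S) → Matrix n n (LAlg d (R × S)) :=
    fun M M' => .of fun i j => LAlg.pair (M i j, M' i j)
  have e₁ : ∀ M M', (e M M').map (LAlg.map (RingHom.fst R S)) = M := fun M M' => rfl
  have e₂ : ∀ M M', (e M M').map (LAlg.map (RingHom.snd R S)) = M' := fun M M' => rfl
  have he : ∀ A A' B B', e A B * e A' B' = e (A * A') (B * B') := by
    intro A A' B B'
    refine matrix_ext_prod ?_ ?_
    · rw [Matrix.map_mul, e₁, e₁, e₁]
    · rw [Matrix.map_mul, e₂, e₂, e₂]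
  have he1 : e 1 1 = 1 := by
    refine matrix_ext_prod ?_ ?_
    · rw [e₁, Matrix.map_one _ (map_zero _) (map_one _)]
    · rw [e₂, Matrix.map_one _ (map_zero _) (map_one _)]
  refine ⟨⟨e g h, e (g⁻¹ : GL n _) (h⁻¹ : GL n _), ?_, ?_⟩, Units.ext (e₁ _ _),
    Units.ext (e₂ _ _)⟩
  · rw [he, ← Units.val_mul, ← Units.val_mul, mul_inv_cancel, mul_inv_cancel, Units.val_one,
      Units.val_one, he1]
  · rw [he, ← Units.val_mul, ← Units.val_mul, inv_mul_cancel, inv_mul_cancel, Units.val_one,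
      Units.val_one, he1]

theorem Ftilde.coe_map {T T' : Type*} [CommRing T] [CommRing T'] (φ : T →+* T') (k : Ftilde d T) :
    (Ftilde.map φ k).1 = GeneralLinearGroup.map (LAlg.map φ) k.1 := rfl

/-- Applied to the ring `Adele × ℚ_[p]` and followed by `replaceAt`, this substitutes an arbitrary
component at `p` into an adelic point. -/
theorem exists_Ftilde_pair (g : Ftilde d R) (h : Ftilde d S) : ∃ k : Ftilde d (R × S),
    Ftilde.map (RingHom.fst R S) k = g ∧ Ftilde.map (RingHom.snd R S) k = h := by
  obtain ⟨k, h₁, h₂⟩ := exists_glPair g.1 h.1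
  obtain ⟨r, hr⟩ := g.2
  obtain ⟨s, hs⟩ := h.2
  have h₁' : (k : Matrix (Fin 2) (Fin 2) (LAlg d (R × S))).map (LAlg.map (RingHom.fst R S)) =
      g.1 := congrArg Units.val h₁
  have h₂' : (k : Matrix (Fin 2) (Fin 2) (LAlg d (R × S))).map (LAlg.map (RingHom.snd R S)) =
      h.1 := congrArg Units.val h₂
  have hk : (k : Matrix (Fin 2) (Fin 2) (LAlg d (R × S)))ᴴ *
      J₁.map (Int.cast : ℤ → LAlg d (R × S)) * k =
      algebraMap (R × S) (LAlg d (R × S)) ((MulEquiv.prodUnits.symm (r, s) : (R × S)ˣ) : R × S) •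
        J₁.map (Int.cast : ℤ → LAlg d (R × S)) := by
    refine matrix_ext_prod ?_ ?_
    · rw [map_unitary_form, map_smul_form, h₁']
      exact hr
    · rw [map_unitary_form, map_smul_form, h₂']
      exact hs
  refine ⟨⟨k, _, hk⟩, Subtype.ext ?_, Subtype.ext ?_⟩
  · rw [Ftilde.coe_map]
    exact h₁
  · rw [Ftilde.coe_map]
    exact h₂

end Product

/-! ### Changing an adele at one prime -/

section Replace

variable {d : ℕ} (p : Nat.Primes)

/-- The adele obtained by replacing the component at `p`. -/
def replaceAt : Adele × ℚ_[p] →+* Adele where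
  toFun z := (z.1.1, ⟨Function.update (fun q => z.1.2 q) p z.2, by
    refine (z.1.2.2.and (Set.finite_singleton p).compl_mem_cofinite).mono fun q hq => ?_
    have hne : q ≠ p := fun h => hq.2 h
    rw [Function.update_of_ne hne]
    exact hq.1⟩)
  map_one' := by
    refine Prod.ext rfl (RestrictedProduct.ext _ _ fun q => ?_)
    rcases eq_or_ne q p with rfl | h
    · exact Function.update_self ..
    · exact Function.update_of_ne h ..
  map_mul' x y := by
    refine Prod.ext rfl (RestrictedProduct.ext _ _ fun q => ?_)
    change Function.update (fun q => (x.1.2 * y.1.2) q) p (x.2 * y.2) q =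
      Function.update (fun q => x.1.2 q) p x.2 q * Function.update (fun q => y.1.2 q) p y.2 q
    rcases eq_or_ne q p with rfl | h
    · simp only [Function.update_self]
    · simp only [Function.update_of_ne h]
      rfl
  map_zero' := by
    refine Prod.ext rfl (RestrictedProduct.ext _ _ fun q => ?_)
    rcases eq_or_ne q p with rfl | h
    · exact Function.update_self ..
    · exact Function.update_of_ne h ..
  map_add' x y := by
    refine Prod.ext rfl (RestrictedProduct.ext _ _ fun q => ?_)
    change Function.update (fun q => (x.1.2 + y.1.2) q) p (x.2 + y.2) q =
      Function.update (fun q => x.1.2 q) p x.2 q + Function.update (fun q => y.1.2 q) p y.2 q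
    rcases eq_or_ne q p with rfl | h
    · simp only [Function.update_self]
    · simp only [Function.update_of_ne h]
      rfl

theorem toPadic_comp_replaceAt : (toPadic p).comp (replaceAt p) = RingHom.snd Adele ℚ_[p] :=
  RingHom.ext fun _ => Function.update_self ..

theorem toPadic_comp_replaceAt_of_ne {q : Nat.Primes} (h : q ≠ p) :
    (toPadic q).comp (replaceAt p) = (toPadic q).comp (RingHom.fst Adele ℚ_[p]) :=
  RingHom.ext fun _ => Function.update_of_ne h ..

theorem Ftilde.map_map {R S T : Type*} [CommRing R] [CommRing S] [CommRing T] (φ : R →+* S)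
    (χ : S →+* T) (k : Ftilde d R) : Ftilde.map χ (Ftilde.map φ k) = Ftilde.map (χ.comp φ) k :=
  rfl

variable {p}

theorem map_replaceAt_fst (k : Ftilde d (Adele × ℚ_[p])) :
    Ftilde.map (RingHom.fst ℝ FinAdele) (Ftilde.map (replaceAt p) k) =
      Ftilde.map (RingHom.fst ℝ FinAdele) (Ftilde.map (RingHom.fst Adele ℚ_[p]) k) := rfl

theorem map_replaceAt_self (k : Ftilde d (Adele × ℚ_[p])) :
    Ftilde.map (toPadic p) (Ftilde.map (replaceAt p) k) =
      Ftilde.map (RingHom.snd Adele ℚ_[p]) k := by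
  rw [Ftilde.map_map, toPadic_comp_replaceAt]

theorem map_replaceAt_of_ne {q : Nat.Primes} (h : q ≠ p) (k : Ftilde d (Adele × ℚ_[p])) :
    Ftilde.map (toPadic q) (Ftilde.map (replaceAt p) k) =
      Ftilde.map (toPadic q) (Ftilde.map (RingHom.fst Adele ℚ_[p]) k) := by
  rw [Ftilde.map_map, toPadic_comp_replaceAt_of_ne p h, Ftilde.map_map]

/-- The adelic matrix with component `γ` at `p` and trivial components elsewhere. -/
def insertAt (γ : GL (Fin 2) ℚ_[p]) : GL (Fin 2) Adele :=
  GeneralLinearGroup.map (replaceAt p) (glPair 1 γ)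

theorem map_fst_insertAt (γ : GL (Fin 2) ℚ_[p]) :
    GeneralLinearGroup.map (RingHom.fst ℝ FinAdele) (insertAt γ) = 1 :=
  (congrArg (GeneralLinearGroup.map (RingHom.fst ℝ FinAdele)) (map_fst_glPair 1 γ)).trans
    (map_one _)

theorem insertAt_mul (γ γ' : GL (Fin 2) ℚ_[p]) : insertAt (γ * γ') = insertAt γ * insertAt γ' := by
  rw [insertAt, insertAt, insertAt, ← map_mul]
  congr 1
  refine Units.ext (Matrix.ext fun i j => Prod.ext ?_ ?_)
  · rw [Units.val_mul, Matrix.mul_apply, Prod.fst_sum]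
    exact (congrFun (congrFun (Matrix.mul_one (1 : Matrix (Fin 2) (Fin 2) Adele)) i) j).symm
  · rw [Units.val_mul, Matrix.mul_apply, Prod.snd_sum]
    rfl

theorem insertAt_one : insertAt (1 : GL (Fin 2) ℚ_[p]) = 1 := by
  have h := insertAt_mul (1 : GL (Fin 2) ℚ_[p]) 1
  rw [mul_one] at h
  exact left_eq_mul.1 h

theorem map_toPadic_insertAt (γ : GL (Fin 2) ℚ_[p]) :
    GeneralLinearGroup.map (toPadic p) (insertAt γ) = γ :=
  Units.ext (Matrix.ext fun i j => DFunLike.congr_fun (toPadic_comp_replaceAt p)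
    ((1 : Matrix (Fin 2) (Fin 2) Adele) i j, (γ : Matrix (Fin 2) (Fin 2) ℚ_[p]) i j))

theorem map_toPadic_insertAt_of_ne {q : Nat.Primes} (h : q ≠ p) (γ : GL (Fin 2) ℚ_[p]) :
    GeneralLinearGroup.map (toPadic q) (insertAt γ) = 1 := by
  have h1 : GeneralLinearGroup.map (toPadic q) (insertAt γ) =
      GeneralLinearGroup.map (toPadic q) (1 : GL (Fin 2) Adele) :=
    Units.ext (Matrix.ext fun i j => DFunLike.congr_fun (toPadic_comp_replaceAt_of_ne p h)
      ((1 : Matrix (Fin 2) (Fin 2) Adele) i j, (γ : Matrix (Fin 2) (Fin 2) ℚ_[p]) i j))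
  rw [h1, map_one]

end Replace

/-! ### Invariance and boundedness of the Whittaker function -/

section Invariance

variable {N ℓ d : ℕ} {p : Nat.Primes}

theorem isLevel_mul_insertAt (hpN : ¬ (p : ℕ) ∣ N) {y : GL (Fin 2) Adele} (hy : IsLevel N y)
    (γ : GL (Fin 2) ℤ_[p]) :
    IsLevel N (y * insertAt (GeneralLinearGroup.map PadicInt.Coe.ringHom γ)) := by
  refine ⟨?_, fun q => ?_⟩
  · rw [map_mul, map_fst_insertAt, mul_one]
    exact hy.1
  · obtain ⟨k, hk, hkN⟩ := hy.2 q
    rcases eq_or_ne q p with rfl | hq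
    · refine ⟨k * γ, ?_, fun h => absurd h hpN⟩
      rw [map_mul, map_mul, hk, map_toPadic_insertAt]
    · refine ⟨k, ?_, hkN⟩
      rw [hk, map_mul, map_toPadic_insertAt_of_ne hq, mul_one]

theorem IsLiftValue.mul_insertAt (hpN : ¬ (p : ℕ) ∣ N) {f : CuspForms N ℓ}
    {x : Matrix (Fin 2) (Fin 2) (LAlg d Adele)} {z : ℂ} (h : IsLiftValue f x z)
    (c : (LAlg d Adele)ˣ) (γ : GL (Fin 2) ℤ_[p]) :
    IsLiftValue f ((c : LAlg d Adele) •
      (x * ((insertAt (GeneralLinearGroup.map PadicInt.Coe.ringHom γ) : GL (Fin 2) Adele) :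
        Matrix (Fin 2) (Fin 2) Adele).map (algebraMap Adele (LAlg d Adele)))) z := by
  obtain ⟨a, β, y, hy, rfl, rfl⟩ := h
  refine ⟨c * a, β, _, isLevel_mul_insertAt hpN hy γ, ?_, ?_⟩
  · rw [← mul_assoc, Matrix.smul_mul, smul_smul, ← Matrix.map_mul, ← Units.val_mul c a,
      ← Units.val_mul]
  · rw [map_mul, map_fst_insertAt, mul_one]

theorem adelicLift_smul_mul_insertAt (hpN : ¬ (p : ℕ) ∣ N) (f : CuspForms N ℓ)
    (x : Matrix (Fin 2) (Fin 2) (LAlg d Adele)) (c : (LAlg d Adele)ˣ) (γ : GL (Fin 2) ℤ_[p]) :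
    adelicLift f ((c : LAlg d Adele) •
      (x * ((insertAt (GeneralLinearGroup.map PadicInt.Coe.ringHom γ) : GL (Fin 2) Adele) :
        Matrix (Fin 2) (Fin 2) Adele).map (algebraMap Adele (LAlg d Adele)))) =
      adelicLift f x := by
  refine congrArg theValue (funext fun z => propext ⟨fun h => ?_, fun h => h.mul_insertAt hpN c γ⟩)
  convert h.mul_insertAt hpN c⁻¹ γ⁻¹ using 1
  rw [Matrix.smul_mul, smul_smul, Units.inv_mul, one_smul, Matrix.mul_assoc, ← Matrix.map_mul,
    ← Units.val_mul, ← insertAt_mul, ← map_mul, mul_inv_cancel, map_one, insertAt_one,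
    Units.val_one, Matrix.map_one _ (map_zero _) (map_one _), Matrix.mul_one]

theorem norm_theValue_le {P : ℂ → Prop} {C : ℝ} (hC : 0 ≤ C) (h : ∀ z, P z → ‖z‖ ≤ C) :
    ‖theValue P‖ ≤ C := by
  unfold theValue
  split_ifs with hP
  · exact h _ hP.choose_spec.1
  · rwa [norm_zero]

/-- The absolute value of a lift value is `Im(τ)^(ℓ/2) |f(τ)|` at `τ = g_∞ i`, which is bounded for
a cusp form. Evenness of the weight makes the natural number quotient `ℓ / 2` exact. -/
theorem exists_norm_adelicLift_le (hN : N ≠ 0) (hℓ : Even ℓ) (f : CuspForms N ℓ) :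
    ∃ C : ℝ, ∀ {d : ℕ} (x : Matrix (Fin 2) (Fin 2) (LAlg d Adele)), ‖adelicLift f x‖ ≤ C := by
  have : NeZero N := ⟨hN⟩
  obtain ⟨C, hC⟩ := CuspFormClass.exists_bound f
  refine ⟨max C 0, fun {d} x => norm_theValue_le (le_max_right _ _) ?_⟩
  rintro z ⟨a, γ, y, hy, -, rfl⟩
  refine le_trans ?_ (le_max_left _ _)
  obtain ⟨m, rfl⟩ := hℓ
  set G := GeneralLinearGroup.map (RingHom.fst ℝ FinAdele) y
  have hdet : 0 < (GeneralLinearGroup.det G : ℝ) := hy.1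
  have him := UpperHalfPlane.im_smul_eq_div_normSq G UpperHalfPlane.I
  rw [UpperHalfPlane.I_im, mul_one, abs_of_pos hdet, Complex.normSq_eq_norm_sq] at him
  have hden : 0 < ‖UpperHalfPlane.denom G (UpperHalfPlane.I : ℂ)‖ :=
    norm_pos_iff.2 (UpperHalfPlane.denom_ne_zero G _)
  have hb := hC (G • UpperHalfPlane.I)
  have he : (((m + m : ℕ) : ℤ) / 2 : ℝ) = m := by push_cast; ring
  rw [he, Real.rpow_natCast, le_div_iff₀ (pow_pos (UpperHalfPlane.im_pos _) _)] at hb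
  refine le_trans (le_of_eq ?_) hb
  rw [him, norm_mul, norm_mul, norm_pow, norm_zpow, Complex.norm_real, Real.norm_of_nonneg hdet.le,
    _root_.zpow_neg, zpow_natCast, show (m + m) / 2 = m by omega, div_pow, ← pow_mul,
    div_eq_mul_inv]
  rw [pow_mul', sq, ← pow_add, UpperHalfPlane.coe_I]
  ring

variable {f : CuspForms N ℓ} {ψ : AddChar Adele Circle} {ν : Measure AdeleQuot}
  {Wp : Ftilde d ℚ_[p] → ℂ}

/-- Around a fixed point where `W'` does not vanish, `Wp` is up to a nonzero constant the
restriction of `W` to changes at `p`. Bounds and invariance pass from `W` to `Wp` this way. -/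
theorem IsLocalComponent.exists_witness {W : Ftilde d Adele → ℂ} (hW : IsLocalComponent p W Wp) :
    ∃ (x₀ : Ftilde d Adele) (c : ℂ), c ≠ 0 ∧ ∀ k : Ftilde d (Adele × ℚ_[p]),
      Ftilde.map (RingHom.fst Adele ℚ_[p]) k = x₀ →
      W (Ftilde.map (replaceAt p) k) = Wp (Ftilde.map (RingHom.snd Adele ℚ_[p]) k) * c := by
  obtain ⟨W', h1, ⟨x₀, hx₀⟩, h2⟩ := hW
  refine ⟨x₀, W' x₀, hx₀, fun k hk => ?_⟩
  rw [h2, map_replaceAt_self]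
  congr 1
  refine h1 _ _ ?_ fun q hq => ?_
  · rw [map_replaceAt_fst, hk]
  · rw [map_replaceAt_of_ne hq, hk]

theorem IsLocalComponent.exists_norm_le (hN : N ≠ 0) (hℓ : Even ℓ) [IsProbabilityMeasure ν]
    (hW : IsLocalComponent p (whittaker f ψ ν) Wp) : ∃ C : ℝ, ∀ g, ‖Wp g‖ ≤ C := by
  obtain ⟨C, hC⟩ := exists_norm_adelicLift_le hN hℓ f
  obtain ⟨x₀, c, hc, h⟩ := hW.exists_witness
  refine ⟨C / ‖c‖, fun g => ?_⟩
  obtain ⟨k, hk₁, rfl⟩ := exists_Ftilde_pair x₀ g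
  rw [le_div_iff₀ (norm_pos_iff.2 hc), ← norm_mul, ← h k hk₁, whittaker]
  refine (norm_integral_le_of_norm_le_const (C := C) (.of_forall fun t => ?_)).trans_eq ?_
  · rw [norm_mul, Circle.norm_coe, mul_one]
    exact hC _
  · rw [probReal_univ, mul_one]

/-- The local Whittaker function is invariant under scalars and under `GL₂(ℤ_p)`. -/
theorem IsLocalComponent.apply_eq_of_smul_mul (hpN : ¬ (p : ℕ) ∣ N)
    (hW : IsLocalComponent p (whittaker f ψ ν) Wp) {g g' : Ftilde d ℚ_[p]}
    (u : (LAlg d ℚ_[p])ˣ) (γ : GL (Fin 2) ℤ_[p])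
    (hg : (g'.1 : Matrix (Fin 2) (Fin 2) (LAlg d ℚ_[p])) = (u : LAlg d ℚ_[p]) •
      ((g.1 : Matrix (Fin 2) (Fin 2) (LAlg d ℚ_[p])) *
        ((GeneralLinearGroup.map PadicInt.Coe.ringHom γ : GL (Fin 2) ℚ_[p]) :
          Matrix (Fin 2) (Fin 2) ℚ_[p]).map (algebraMap ℚ_[p] (LAlg d ℚ_[p])))) :
    Wp g' = Wp g := by
  obtain ⟨x₀, c, hc, h⟩ := hW.exists_witness
  obtain ⟨k, hk₁, rfl⟩ := exists_Ftilde_pair x₀ g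
  obtain ⟨k', hk₁', rfl⟩ := exists_Ftilde_pair x₀ g'
  refine mul_right_cancel₀ hc ?_
  -- The scalar `u` and the matrix `γ` are inserted at `p` with trivial components elsewhere, so
  -- that the identity `hg` becomes one between adelic points.
  obtain ⟨c', hc₁, hc₂⟩ : ∃ c' : (LAlg d (Adele × ℚ_[p]))ˣ,
      LAlg.map (RingHom.fst Adele ℚ_[p]) (c' : LAlg d (Adele × ℚ_[p])) = 1 ∧
        LAlg.map (RingHom.snd Adele ℚ_[p]) (c' : LAlg d (Adele × ℚ_[p])) = (u : LAlg d ℚ_[p]) :=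
    ⟨Units.map LAlg.pair.toMonoidHom (MulEquiv.prodUnits.symm (1, u)), rfl, rfl⟩
  set K : GL (Fin 2) (Adele × ℚ_[p]) := glPair 1 (GeneralLinearGroup.map PadicInt.Coe.ringHom γ)
    with hK
  have hK₁ : (K : Matrix (Fin 2) (Fin 2) (Adele × ℚ_[p])).map (RingHom.fst Adele ℚ_[p]) = 1 := rfl
  have key : (k'.1 : Matrix (Fin 2) (Fin 2) (LAlg d (Adele × ℚ_[p]))) =
      (c' : LAlg d (Adele × ℚ_[p])) • ((k.1 : Matrix (Fin 2) (Fin 2) (LAlg d (Adele × ℚ_[p]))) *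
        (K : Matrix (Fin 2) (Fin 2) (Adele × ℚ_[p])).map
          (algebraMap _ (LAlg d (Adele × ℚ_[p])))) := by
    refine matrix_ext_prod ?_ ?_
    · rw [map_smul_mul, hc₁, one_smul, hK₁, Matrix.map_one _ (map_zero _) (map_one _),
        Matrix.mul_one]
      exact congrArg (fun x : Ftilde d Adele => (x.1 : Matrix (Fin 2) (Fin 2) (LAlg d Adele)))
        (hk₁'.trans hk₁.symm)
    · rw [map_smul_mul, hc₂]
      exact hg
  have hx : ((Ftilde.map (replaceAt p) k').1 : Matrix (Fin 2) (Fin 2) (LAlg d Adele)) =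
      ((Units.map (LAlg.map (replaceAt p)).toMonoidHom c' : (LAlg d Adele)ˣ) : LAlg d Adele) •
        (((Ftilde.map (replaceAt p) k).1 : Matrix (Fin 2) (Fin 2) (LAlg d Adele)) *
          ((insertAt (GeneralLinearGroup.map PadicInt.Coe.ringHom γ) : GL (Fin 2) Adele) :
            Matrix (Fin 2) (Fin 2) Adele).map (algebraMap Adele (LAlg d Adele))) :=
    (congrArg (fun M : Matrix (Fin 2) (Fin 2) (LAlg d (Adele × ℚ_[p])) =>
      M.map (LAlg.map (replaceAt p))) key).trans (map_smul_mul _ _ _ _)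
  rw [← h k hk₁, ← h k' hk₁', whittaker, whittaker]
  refine integral_congr_ae (.of_forall fun t => ?_)
  change adelicLift f _ * _ = adelicLift f _ * _
  rw [hx, Matrix.mul_smul, ← Matrix.mul_assoc, adelicLift_smul_mul_insertAt hpN]

end Invariance

/-! ### The integrand -/

section Integrand

variable {N ℓ d : ℕ} {p : Nat.Primes} [InertAt d p]

/-- Since `x̄⁻¹ = x / N(x)`, the parametrization by `ζ` and `η` reads `h = x · (1, η; ζ, ζη +
N(x)⁻¹)`. The second factor is integral over `ℤ_p` with unit determinant `N(x)⁻¹`. -/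
theorem umat_eq_smul_of_qabs_eq_one {h : Ftilde₁ d ℚ_[p]} (hx : qabs (umat h 0 0) = 1)
    (hy : qabs (umat h 0 1) ≤ 1) (hz : qabs (umat h 1 0) ≤ 1) :
    ∃ γ : GL (Fin 2) ℤ_[p], umat h = umat h 0 0 •
      ((GeneralLinearGroup.map PadicInt.Coe.ringHom γ : GL (Fin 2) ℚ_[p]) :
        Matrix (Fin 2) (Fin 2) ℚ_[p]).map (algebraMap ℚ_[p] (LAlg d ℚ_[p])) := by
  have hx0 : umat h 0 0 ≠ 0 := fun h0 => by rw [h0, qabs_zero] at hx; exact zero_ne_one hx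
  obtain ⟨ζ, η, hζ, hη, hw⟩ := exists_ratios hx0
  have hζ1 : ‖ζ‖ ≤ 1 := by rwa [hζ, qabs_mul, hx, mul_one, qabs_algebraMap] at hz
  have hη1 : ‖η‖ ≤ 1 := by rwa [hη, qabs_mul, hx, mul_one, qabs_algebraMap] at hy
  set n := QuadraticAlgebra.norm (umat h 0 0) with hn
  have hn1 : ‖n⁻¹‖ = 1 := by rw [norm_inv, norm_norm_eq_qabs_sq, hx]; simp
  have hn0 : n ≠ 0 := fun h0 => by rw [h0, _root_.inv_zero, norm_zero] at hn1; exact zero_ne_one hn1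
  let ζ' : ℤ_[p] := ⟨ζ, hζ1⟩
  let η' : ℤ_[p] := ⟨η, hη1⟩
  let n' : ℤ_[p] := ⟨n⁻¹, hn1.le⟩
  have hdet : IsUnit (!![1, η'; ζ', ζ' * η' + n'] : Matrix (Fin 2) (Fin 2) ℤ_[p]).det := by
    have : (!![1, η'; ζ', ζ' * η' + n'] : Matrix (Fin 2) (Fin 2) ℤ_[p]).det = n' := by
      rw [Matrix.det_fin_two_of]
      ring
    rw [this, PadicInt.isUnit_iff]
    exact hn1
  refine ⟨GeneralLinearGroup.mk'' _ hdet, ?_⟩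
  have hinv : (star (umat h 0 0))⁻¹ = umat h 0 0 * algebraMap _ _ n⁻¹ := by
    refine inv_eq_of_mul_eq_one_right ?_
    rw [← mul_assoc, mul_comm (star _), ← QuadraticAlgebra.algebraMap_norm_eq_mul_star, ← map_mul,
      mul_inv_cancel₀ hn0, map_one]
  rw [hinv] at hw
  refine Matrix.ext fun i j => ?_
  fin_cases i <;> fin_cases j
  · change umat h 0 0 = umat h 0 0 * algebraMap _ _ ((1 : ℤ_[p]) : ℚ_[p])
    rw [PadicInt.coe_one, map_one, mul_one]
  · exact hη.trans (mul_comm _ _)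
  · exact hζ.trans (mul_comm _ _)
  · change umat h 1 1 = umat h 0 0 * algebraMap _ _ (ζ * η + n⁻¹)
    rw [hw, map_add, map_mul]
    ring

theorem IsLocalComponent.apply_mul {f : CuspForms N ℓ} {ψ : AddChar Adele Circle}
    {ν : Measure AdeleQuot} {Wp : Ftilde d ℚ_[p] → ℂ} (hpN : ¬ (p : ℕ) ∣ N)
    (hW : IsLocalComponent p (whittaker f ψ ν) Wp) (g : Ftilde d ℚ_[p]) {h : Ftilde₁ d ℚ_[p]}
    (hx : qabs (umat h 0 0) = 1) (hy : qabs (umat h 0 1) ≤ 1) (hz : qabs (umat h 1 0) ≤ 1) :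
    Wp (g * h.1) = Wp g := by
  obtain ⟨γ, hγ⟩ := umat_eq_smul_of_qabs_eq_one hx hy hz
  have hx0 : umat h 0 0 ≠ 0 := fun h0 => by rw [h0, qabs_zero] at hx; exact zero_ne_one hx
  refine hW.apply_eq_of_smul_mul hpN (Units.mk0 _ hx0) γ ?_
  rw [Units.val_mk0, ← Matrix.mul_smul, ← hγ]
  rfl

theorem det_umat {h : Ftilde₁ d ℚ_[p]} (hx : umat h 0 0 ≠ 0) :
    (umat h).det = umat h 0 0 * (star (umat h 0 0))⁻¹ := by
  rw [← lower_sub_mul_div hx, Matrix.det_fin_two]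
  field_simp

/-- Here `det h = x / x̄`, and `Λ` inverts under conjugation, so `Λ(det h) = Λ(x)²`. Together with
the factor `Λ(x)` of the section this leaves `Λ(x)⁻¹`. -/
theorem charFun_det {Λ : (LAlg d ℚ_[p])ˣ →* Circle} (hΛ : IsAdmissible Λ) {h : Ftilde₁ d ℚ_[p]}
    (hx : umat h 0 0 ≠ 0) : (((Λ (GeneralLinearGroup.det h.1.1))⁻¹ : Circle) : ℂ) =
      (charFun Λ (umat h 0 0))⁻¹ * (charFun Λ (umat h 0 0))⁻¹ := by
  have hsx : star (umat h 0 0) ≠ 0 := by simpa using hx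
  have h1 := hΛ.charFun_mul_star hx
  have h2 : charFun Λ (umat h 0 0) = charFun Λ (umat h).det * charFun Λ (star (umat h 0 0)) := by
    rw [det_umat hx, ← map_mul, inv_mul_cancel_right₀ hsx]
  rw [Circle.coe_inv, ← charFun_coe]
  change (charFun Λ (umat h).det)⁻¹ = _
  have h3 := charFun_ne_zero (Λ := Λ) hx
  rw [← mul_inv, _root_.inv_inj]
  nth_rewrite 2 [h2]
  linear_combination -(charFun Λ (umat h).det) * h1

theorem InSupport.qabs_lower_right_le {h : Ftilde₁ d ℚ_[p]} (hh : InSupport h) :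
    qabs (umat h 1 1) ≤ qabs (umat h 0 0) := by
  obtain ⟨ζ, η, hζ, hη, hw⟩ := exists_ratios hh.ne_zero
  have hxp := qabs_pos hh.ne_zero
  have hζ1 : ‖ζ‖ ≤ 1 := by
    have := hh.lower.le
    rw [hζ, qabs_mul, qabs_algebraMap] at this
    exact le_of_mul_le_mul_right (by rwa [one_mul]) hxp
  rw [hw, ← hη]
  refine (qabs_add_le _ _).trans (max_le ?_ ?_)
  · rw [qabs_mul, qabs_algebraMap]
    exact (mul_le_of_le_one_left (qabs_nonneg _) hζ1).trans hh.upper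
  · rw [qabs_inv, qabs_star]
    exact (inv_le_one_of_one_le₀ hh.one_le).trans hh.one_le

/-- In the new entry `x k₀₀ + y k₁₀` the first term dominates, because `|k₀₀| = 1`, `|k₁₀| < 1` and
`|y| ≤ |x|`. -/
theorem InSupport.qabs_mul_upper_left {h k : Ftilde₁ d ℚ_[p]} (hh : InSupport h)
    (hk : k ∈ lowerSubgroup d p) : qabs (umat (h * k) 0 0) = qabs (umat h 0 0) := by
  have hk0 := qabs_eq_one_of_mem_lowerSubgroup hk
  rw [umat_mul_apply, qabs_add_eq_left, qabs_mul, hk0, mul_one]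
  rw [qabs_mul, qabs_mul, hk0, mul_one]
  calc qabs (umat h 0 1) * qabs (umat k 1 0) ≤ qabs (umat h 0 0) * qabs (umat k 1 0) :=
        mul_le_mul_of_nonneg_right hh.upper (qabs_nonneg _)
    _ < qabs (umat h 0 0) := mul_lt_of_lt_one_right (qabs_pos hh.ne_zero) hk.2

theorem InSupport.mul {h k : Ftilde₁ d ℚ_[p]} (hh : InSupport h) (hk : k ∈ lowerSubgroup d p) :
    InSupport (h * k) := by
  have he := hh.qabs_mul_upper_left hk
  have hle : ∀ {u v : LAlg d ℚ_[p]}, qabs u ≤ qabs (umat h 0 0) → qabs v ≤ 1 →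
      qabs (u * v) ≤ qabs (umat h 0 0) := by
    intro u v hu hv
    rw [qabs_mul]
    exact (mul_le_of_le_one_right (qabs_nonneg _) hv).trans hu
  refine ⟨fun h0 => ?_, he ▸ hh.one_le, ?_, ?_⟩
  · rw [h0, qabs_zero] at he
    exact (qabs_pos hh.ne_zero).ne he
  · rw [he, umat_mul_apply]
    exact (qabs_add_le _ _).trans (max_le (hle le_rfl (hk.1 _ _)) (hle hh.upper (hk.1 _ _)))
  · rw [he, umat_mul_apply]
    refine (qabs_add_le _ _).trans_lt (max_lt ?_ ?_)
    · rw [qabs_mul]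
      exact (mul_le_of_le_one_right (qabs_nonneg _) (hk.1 _ _)).trans_lt hh.lower
    · rw [qabs_mul]
      exact (mul_le_mul_of_nonneg_right hh.qabs_lower_right_le (qabs_nonneg _)).trans_lt
        (mul_lt_of_lt_one_right (qabs_pos hh.ne_zero) hk.2)

theorem inSupport_mul_iff {h k : Ftilde₁ d ℚ_[p]} (hk : k ∈ lowerSubgroup d p) :
    InSupport (h * k) ↔ InSupport h := by
  refine ⟨fun hh => ?_, fun hh => hh.mul hk⟩
  have := hh.mul ((lowerSubgroup d p).inv_mem hk)
  rwa [mul_inv_cancel_right] at this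

/-- Right translation by the rational subgroup changes the upper left entry by a unit that is
rational modulo `p`. -/
theorem InSupport.exists_upper_left_mul {h k : Ftilde₁ d ℚ_[p]} (hh : InSupport h)
    (hk : k ∈ rationalSubgroup d p) : ∃ c ∈ nearRational d p, qabs c = 1 ∧
      umat (h * k) 0 0 = umat h 0 0 * c := by
  obtain ⟨-, η, -, hη, -⟩ := exists_ratios hh.ne_zero
  have hxp := qabs_pos hh.ne_zero
  have hη1 : ‖η‖ ≤ 1 := by
    have := hh.upper
    rw [hη, qabs_mul, qabs_algebraMap] at this
    exact le_of_mul_le_mul_right (by rwa [one_mul]) hxp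
  have hx : umat (h * k) 0 0 = umat h 0 0 * (umat k 0 0 + algebraMap _ _ η * umat k 1 0) := by
    rw [umat_mul_apply, hη]
    ring
  refine ⟨_, ?_, ?_, hx⟩
  · exact (nearRational d p).add_mem (hk.1 0 0)
      ((nearRational d p).mul_mem (algebraMap_mem_nearRational hη1) (hk.1 1 0))
  · have := hh.qabs_mul_upper_left (rationalSubgroup_le hk)
    rw [hx, qabs_mul] at this
    exact mul_left_cancel₀ hxp.ne' (by rw [this, mul_one])

theorem InSupport.inv_mem_nearRational_mul_iff {h k : Ftilde₁ d ℚ_[p]} (hh : InSupport h)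
    (hk : k ∈ rationalSubgroup d p) :
    (umat (h * k) 0 0)⁻¹ ∈ nearRational d p ↔ (umat h 0 0)⁻¹ ∈ nearRational d p := by
  obtain ⟨c, hc, hc1, he⟩ := hh.exists_upper_left_mul hk
  have hc0 : c ≠ 0 := fun h0 => by rw [h0, qabs_zero] at hc1; exact zero_ne_one hc1
  rw [he, mul_inv]
  refine ⟨fun h1 => ?_, fun h1 => (nearRational d p).mul_mem h1 (inv_mem_nearRational hc hc1)⟩
  have := (nearRational d p).mul_mem h1 hc
  rwa [inv_mul_cancel_right₀ hc0] at this

theorem InSupport.norm_im_lt_iff {h : Ftilde₁ d ℚ_[p]} (hh : InSupport h) :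
    ‖(umat h 0 0)⁻¹.im‖ < 1 ↔ (umat h 0 0)⁻¹ ∈ nearRational d p :=
  ⟨fun h1 => ⟨qabs_inv_le_one hh.one_le, h1⟩, fun h1 => h1.2⟩

/-- Identifies the part `|x| = 1` of the support along `1` and `Θ`. -/
theorem mem_rationalSubgroup_iff {h : Ftilde₁ d ℚ_[p]} : h ∈ rationalSubgroup d p ↔
    InSupport h ∧ qabs (umat h 0 0) = 1 ∧ (umat h 0 0)⁻¹ ∈ nearRational d p := by
  constructor
  · intro hh
    have h1 := qabs_eq_one_of_mem_lowerSubgroup (rationalSubgroup_le hh)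
    refine ⟨⟨fun h0 => ?_, h1.ge, ?_, ?_⟩, h1, inv_mem_nearRational (hh.1 0 0) h1⟩
    · rw [h0, qabs_zero] at h1
      exact zero_ne_one h1
    · rw [h1]
      exact (hh.1 0 1).1
    · rw [h1]
      exact hh.2
  · rintro ⟨hh, h1, h2⟩
    have h3 := inv_mem_nearRational h2 (by rw [qabs_inv, h1, inv_one])
    rw [inv_inv] at h3
    exact mem_rationalSubgroup_of h3 h1 (h1 ▸ hh.upper) (h1 ▸ hh.lower)

/-- The integrand on its support, for a function `V` in place of the Whittaker function. -/
def supportIntegrand (Λ : (LAlg d ℚ_[p])ˣ →* Circle) (s : ℂ) (V : Ftilde₁ d ℚ_[p] → ℂ)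
    (h : Ftilde₁ d ℚ_[p]) : ℂ :=
  (charFun Λ (umat h 0 0))⁻¹ * (qabs (umat h 0 0) : ℂ) ^ (-6 * (s + 1 / 2)) * V h

variable {Λ : (LAlg d ℚ_[p])ˣ →* Circle} {s : ℂ} {V : Ftilde₁ d ℚ_[p] → ℂ}

theorem supportIntegrand_mul (hΛ : IsAdmissible Λ)
    (hV : ∀ h, ∀ k ∈ lowerSubgroup d p, V (h * k) = V h) {h k : Ftilde₁ d ℚ_[p]}
    (hh : InSupport h) (hk : k ∈ rationalSubgroup d p) :
    supportIntegrand Λ s V (h * k) = supportIntegrand Λ s V h := by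
  have hk' := rationalSubgroup_le hk
  obtain ⟨c, hc, hc1, he⟩ := hh.exists_upper_left_mul hk
  rw [supportIntegrand, supportIntegrand, hV h k hk', hh.qabs_mul_upper_left hk', he, map_mul,
    hΛ.charFun_eq_one hc1 hc.2, mul_one]

theorem torus_mem_lowerSubgroup {u : LAlg d ℚ_[p]} (hu : qabs u = 1) {c : Ftilde₁ d ℚ_[p]}
    (hc : umat c = !![u, 0; 0, (star u)⁻¹]) : c ∈ lowerSubgroup d p := by
  rw [mem_lowerSubgroup, hc]
  refine ⟨fun i j => ?_, by simp [qabs_zero]⟩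
  fin_cases i <;> fin_cases j <;> simp [qabs_zero, qabs_inv, qabs_star, hu]

/-- Only `Λ` sees the translation: `|x|` is unchanged, and `c` lies in the group under which `V` is
invariant. -/
theorem supportIntegrand_mul_torus (hV : ∀ h, ∀ k ∈ lowerSubgroup d p, V (h * k) = V h)
    {u : LAlg d ℚ_[p]} (hu : qabs u = 1) {c : Ftilde₁ d ℚ_[p]}
    (hc : umat c = !![u, 0; 0, (star u)⁻¹]) (h : Ftilde₁ d ℚ_[p]) :
    supportIntegrand Λ s V (h * c) = (charFun Λ u)⁻¹ * supportIntegrand Λ s V h := by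
  have he : umat (h * c) 0 0 = umat h 0 0 * u := by
    rw [umat_mul_apply, hc]
    simp
  rw [supportIntegrand, supportIntegrand, hV h c (torus_mem_lowerSubgroup hu hc), he, map_mul,
    qabs_mul, hu, mul_one, mul_inv]
  ring

/-- Conjugation by a diagonal matrix fixes the upper left entry, and with `c` in `lowerSubgroup` it
preserves the remaining conditions of `mem_rationalSubgroup_of`. -/
theorem torus_conj_mem {u : LAlg d ℚ_[p]} (hu : qabs u = 1) {c k : Ftilde₁ d ℚ_[p]}
    (hc : umat c = !![u, 0; 0, (star u)⁻¹]) (hk : k ∈ rationalSubgroup d p) :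
    c⁻¹ * k * c ∈ rationalSubgroup d p ∧ c * k * c⁻¹ ∈ rationalSubgroup d p := by
  have hu0 : u ≠ 0 := fun h0 => by rw [h0, qabs_zero] at hu; exact zero_ne_one hu
  have hcl := torus_mem_lowerSubgroup hu hc
  have hkl := rationalSubgroup_le hk
  have hk1 := qabs_eq_one_of_mem_lowerSubgroup hkl
  have hm₁ := (lowerSubgroup d p).mul_mem ((lowerSubgroup d p).mul_mem
    ((lowerSubgroup d p).inv_mem hcl) hkl) hcl
  have hm₂ := (lowerSubgroup d p).mul_mem ((lowerSubgroup d p).mul_mem hcl hkl)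
    ((lowerSubgroup d p).inv_mem hcl)
  have h₁ : umat (c⁻¹ * k * c) 0 0 = umat k 0 0 := by
    simp only [umat_mul_apply, umat_inv, hc]
    simp [star_inv₀]
    field_simp
  have h₂ : umat (c * k * c⁻¹) 0 0 = umat k 0 0 := by
    simp only [umat_mul_apply, umat_inv, hc]
    simp [star_inv₀]
    field_simp
  exact ⟨mem_rationalSubgroup_of (h₁ ▸ hk.1 0 0) (h₁ ▸ hk1) (hm₁.1 0 1) hm₁.2,
    mem_rationalSubgroup_of (h₂ ▸ hk.1 0 0) (h₂ ▸ hk1) (hm₂.1 0 1) hm₂.2⟩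

open Classical in
/-- The part of the support on which the upper left entry has prescribed absolute value does not
contribute to the integral if it is stable under the torus. -/
theorem integral_supportIntegrand_eq_zero (hΛ : IsAdmissible Λ)
    (hV : ∀ h, ∀ k ∈ lowerSubgroup d p, V (h * k) = V h) {μ : Measure (Ftilde₁ d ℚ_[p])}
    [μ.IsMulLeftInvariant] (hμ : μ (rationalSubgroup d p : Set (Ftilde₁ d ℚ_[p])) ≠ 0)
    (T : ℝ → Prop) :
    ∫ h, (if InSupport h ∧ T (qabs (umat h 0 0)) then supportIntegrand Λ s V h else 0) ∂μ = 0 := by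
  obtain ⟨u, hu, hu1⟩ := hΛ.exists_charFun_ne_one
  have hu0 : u ≠ 0 := fun h0 => by rw [h0, qabs_zero] at hu; exact zero_ne_one hu
  obtain ⟨c, hc⟩ := exists_torus hu0
  have hcond : ∀ h, ∀ k ∈ lowerSubgroup d p, (InSupport (h * k) ∧ T (qabs (umat (h * k) 0 0))) ↔
      (InSupport h ∧ T (qabs (umat h 0 0))) := by
    intro h k hk
    rw [inSupport_mul_iff hk]
    exact and_congr_right fun hh => by rw [hh.qabs_mul_upper_left hk]
  refine integral_eq_zero_of_mul_right (c := c) (z := (charFun Λ u)⁻¹) isOpen_rationalSubgroup hμ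
    (fun k hk => (torus_conj_mem hu hc hk).1) (fun k hk => (torus_conj_mem hu hc hk).2)
    (fun h k hk => ?_) (fun h1 => hu1 (inv_eq_one.1 h1)) fun h => ?_
  · simp only [hcond h k (rationalSubgroup_le hk)]
    refine if_ctx_congr Iff.rfl (fun hh => ?_) fun _ => rfl
    exact supportIntegrand_mul hΛ hV hh.1 hk
  · simp only [hcond h c (torus_mem_lowerSubgroup hu hc), supportIntegrand_mul_torus hV hu hc,
      mul_ite, mul_zero]

end Integrand

/-! ### Convergence -/

section Convergence

/-- The residue class modulo `p ^ k` of a `p`-adic integer. -/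
def residueClass (p : Nat.Primes) (k : ℕ) (r : ℚ_[p]) : ZMod ((p : ℕ) ^ k) :=
  open Classical in if h : ‖r‖ ≤ 1 then PadicInt.toZModPow k (⟨r, h⟩ : ℤ_[p]) else 0

theorem norm_sub_le_of_residueClass_eq {p : Nat.Primes} {k : ℕ} {r r' : ℚ_[p]} (hr : ‖r‖ ≤ 1)
    (hr' : ‖r'‖ ≤ 1) (h : residueClass p k r = residueClass p k r') :
    ‖r - r'‖ ≤ ((p : ℕ) : ℝ) ^ (-(k : ℤ)) := by
  rw [residueClass, residueClass, dif_pos hr, dif_pos hr'] at h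
  have h' : (show ℤ_[p] from ⟨r, hr⟩) - (show ℤ_[p] from ⟨r', hr'⟩) ∈
      RingHom.ker (PadicInt.toZModPow (p := p) k) :=
    (map_sub (PadicInt.toZModPow (p := p) k) _ _).trans (sub_eq_zero.2 h)
  rw [PadicInt.ker_toZModPow, ← PadicInt.norm_le_pow_iff_mem_span_pow] at h'
  exact h'

variable {d : ℕ} {p : Nat.Primes}

theorem exists_qabs_eq_zpow {x : LAlg d ℚ_[p]} (hx : x ≠ 0) :
    ∃ n : ℤ, qabs x = ((p : ℕ) : ℝ) ^ n := by
  have key : ∀ r : ℚ_[p], ‖r‖ = qabs x → ∃ n : ℤ, qabs x = ((p : ℕ) : ℝ) ^ n := by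
    intro r hr
    have hr0 : r ≠ 0 := fun h0 => by
      rw [h0, norm_zero] at hr
      exact (qabs_pos hx).ne hr
    exact ⟨-r.valuation, by rw [← hr, Padic.norm_eq_zpow_neg_valuation hr0]⟩
  rcases max_choice ‖x.re‖ ‖x.im‖ with h | h
  · exact key _ h.symm
  · exact key _ h.symm

theorem exists_qabs_eq_pow {x : LAlg d ℚ_[p]} (hx : 1 ≤ qabs x) :
    ∃ n : ℕ, qabs x = ((p : ℕ) : ℝ) ^ n := by
  obtain ⟨n, hn⟩ := exists_qabs_eq_zpow (x := x) (fun h0 => by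
    rw [h0, qabs_zero] at hx
    exact absurd hx (not_le.2 zero_lt_one))
  have hp : (1 : ℝ) < (p : ℕ) := by exact_mod_cast p.2.one_lt
  rw [hn] at hx
  lift n to ℕ using (one_le_zpow_iff_right₀ hp).1 hx
  exact ⟨n, by rw [hn, zpow_natCast]⟩

variable [InertAt d p]

/-- The invariants that separate the cosets of the rational subgroup in the support. -/
abbrev CosetLabel (p : Nat.Primes) (n : ℕ) : Type :=
  ZMod ((p : ℕ) ^ (2 * n + 1)) × ZMod ((p : ℕ) ^ 1) × ZMod ((p : ℕ) ^ 1)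

/-- The label of `h = (x, y; z, w)` for `|x| = p ^ n`. -/
def cosetLabel (n : ℕ) (h : Ftilde₁ d ℚ_[p]) : CosetLabel p n :=
  (residueClass p _ (umat h 1 0 / umat h 0 0).re,
    residueClass p _ ((p : LAlg d ℚ_[p]) ^ n * umat h 0 0).re,
    residueClass p _ ((p : LAlg d ℚ_[p]) ^ n * umat h 0 0).im)

theorem qabs_primePow (n : ℕ) : qabs ((p : LAlg d ℚ_[p]) ^ n) = (((p : ℕ) : ℝ) ^ n)⁻¹ := by
  have h : ((p : LAlg d ℚ_[p]) ^ n) = algebraMap ℚ_[p] (LAlg d ℚ_[p]) ((p : ℚ_[p]) ^ n) := by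
    rw [map_pow, map_natCast]
  rw [h, qabs_algebraMap, norm_pow, Padic.norm_p, inv_pow]

/-- The entries of `g⁻¹ h` involve `ζ - ζ'` multiplied by two factors of size at most `pⁿ`, and
agreement modulo `p^(2n+1)` makes these terms divisible by `p`. Agreement of `pⁿ x` modulo `p` makes
the ratio of the two upper left entries congruent to one. No label for `y` is needed, as only
integrality of the upper right entry is at stake. -/
theorem inv_mul_mem_rationalSubgroup_of_cosetLabel_eq {n : ℕ} {g h : Ftilde₁ d ℚ_[p]}
    (hg : InSupport g) (hh : InSupport h) (hgn : qabs (umat g 0 0) = ((p : ℕ) : ℝ) ^ n)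
    (hhn : qabs (umat h 0 0) = ((p : ℕ) : ℝ) ^ n) (he : cosetLabel n g = cosetLabel n h) :
    g⁻¹ * h ∈ rationalSubgroup d p := by
  have hp1 : (1 : ℝ) < (p : ℕ) := by exact_mod_cast p.2.one_lt
  have hpn : (0 : ℝ) < ((p : ℕ) : ℝ) ^ n := pow_pos (zero_lt_one.trans hp1) n
  obtain ⟨ζ, η, hζ, hη, hw⟩ := exists_ratios hg.ne_zero
  obtain ⟨ζ', η', hζ', hη', hw'⟩ := exists_ratios hh.ne_zero
  have hgx := hg.ne_zero
  have hhx := hh.ne_zero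
  have hgx' : star (umat g 0 0) ≠ 0 := by simpa using hgx
  have hhx' : star (umat h 0 0) ≠ 0 := by simpa using hhx
  have hle : ∀ {ξ : ℚ_[p]} {x : LAlg d ℚ_[p]}, x ≠ 0 →
      qabs (algebraMap _ _ ξ * x) ≤ qabs x → ‖ξ‖ ≤ 1 := by
    intro ξ x hx hle
    rw [qabs_mul, qabs_algebraMap] at hle
    exact le_of_mul_le_mul_right (by rwa [one_mul]) (qabs_pos hx)
  have hζ1 : ‖ζ‖ ≤ 1 := hle hgx (hζ ▸ hg.lower.le)
  have hζ1' : ‖ζ'‖ ≤ 1 := hle hhx (hζ' ▸ hh.lower.le)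
  have e1 := congrArg Prod.fst he
  have e2 := congrArg (fun t => t.2.1) he
  have e3 := congrArg (fun t => t.2.2) he
  simp only [cosetLabel] at e1 e2 e3
  rw [hζ, hζ', mul_div_cancel_right₀ _ hgx, mul_div_cancel_right₀ _ hhx,
    QuadraticAlgebra.algebraMap_re, QuadraticAlgebra.algebraMap_re] at e1
  have hd := norm_sub_le_of_residueClass_eq hζ1 hζ1' e1
  set u := (p : LAlg d ℚ_[p]) ^ n * umat g 0 0 with hu
  set u' := (p : LAlg d ℚ_[p]) ^ n * umat h 0 0 with hu'
  have hu1 : qabs u = 1 := by rw [hu, qabs_mul, qabs_primePow, hgn, inv_mul_cancel₀ hpn.ne']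
  have hu1' : qabs u' = 1 := by rw [hu', qabs_mul, qabs_primePow, hhn, inv_mul_cancel₀ hpn.ne']
  have hlt : ((p : ℕ) : ℝ) ^ (-((1 : ℕ) : ℤ)) < 1 := by
    rw [Nat.cast_one, _root_.zpow_neg_one]
    exact inv_lt_one_of_one_lt₀ hp1
  have hdu : qabs (u' - u) < 1 := by
    rw [← qabs_neg, neg_sub]
    refine max_lt ?_ ?_
    · rw [QuadraticAlgebra.re_sub]
      exact (norm_sub_le_of_residueClass_eq ((norm_re_le_qabs u).trans_eq hu1)
        ((norm_re_le_qabs u').trans_eq hu1') e2).trans_lt hlt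
    · rw [QuadraticAlgebra.im_sub]
      exact (norm_sub_le_of_residueClass_eq ((norm_im_le_qabs u).trans_eq hu1)
        ((norm_im_le_qabs u').trans_eq hu1') e3).trans_lt hlt
  have hu0 : u ≠ 0 := fun h0 => by rw [h0, qabs_zero] at hu1; exact zero_ne_one hu1
  have hp0 : (p : LAlg d ℚ_[p]) ^ n ≠ 0 := left_ne_zero_of_mul hu0
  have hq : umat h 0 0 / umat g 0 0 = 1 + (u' - u) * u⁻¹ := by
    have : umat h 0 0 / umat g 0 0 = u' / u := by
      rw [hu, hu', mul_div_mul_left _ _ hp0]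
    rw [this]
    field_simp
    ring
  have hq1 : qabs (umat h 0 0 / umat g 0 0) = 1 := by
    rw [qabs_div, hgn, hhn, div_self hpn.ne']
  have hqn : umat h 0 0 / umat g 0 0 ∈ nearRational d p := by
    rw [hq]
    refine (nearRational d p).add_mem (nearRational d p).one_mem (nearRational_of_qabs_lt ?_)
    rw [qabs_mul, qabs_inv, hu1, inv_one, mul_one]
    exact hdu
  have hsmall : ∀ a b : LAlg d ℚ_[p], qabs a ≤ ((p : ℕ) : ℝ) ^ n → qabs b ≤ ((p : ℕ) : ℝ) ^ n →
      qabs (a * b * algebraMap _ _ (ζ - ζ')) < 1 := by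
    intro a b ha hb
    rw [qabs_mul, qabs_mul, qabs_algebraMap]
    calc qabs a * qabs b * ‖ζ - ζ'‖
        ≤ ((p : ℕ) : ℝ) ^ n * ((p : ℕ) : ℝ) ^ n * ((p : ℕ) : ℝ) ^ (-((2 * n + 1 : ℕ) : ℤ)) :=
          mul_le_mul (mul_le_mul ha hb (qabs_nonneg _) hpn.le) hd (norm_nonneg _)
            (mul_nonneg hpn.le hpn.le)
      _ = ((p : ℕ) : ℝ) ^ (-((1 : ℕ) : ℤ)) := by
          rw [← zpow_natCast, ← zpow_add₀ (zero_lt_one.trans hp1).ne',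
            ← zpow_add₀ (zero_lt_one.trans hp1).ne']
          congr 1
          push_cast
          ring
      _ < 1 := hlt
  have hstar : ∀ r : ℚ_[p], star (algebraMap ℚ_[p] (LAlg d ℚ_[p]) r) = algebraMap _ _ r :=
    fun r => QuadraticAlgebra.ext (by simp) (by simp)
  have hwg : star (umat g 1 1) = algebraMap _ _ ζ * star (umat g 0 1) + (umat g 0 0)⁻¹ := by
    rw [hw, ← hη, star_add, star_mul, star_inv₀, star_star, hstar, mul_comm]
  have k00 : umat (g⁻¹ * h) 0 0 = umat h 0 0 / umat g 0 0 +
      star (umat g 0 1) * umat h 0 0 * algebraMap _ _ (ζ - ζ') := by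
    rw [umat_mul_apply, umat_inv]
    simp only [of_apply, cons_val', cons_val_zero, cons_val_one, cons_val_fin_one]
    rw [hwg, hζ', map_sub]
    ring
  have k10 : umat (g⁻¹ * h) 1 0 =
      -(star (umat g 0 0) * umat h 0 0 * algebraMap _ _ (ζ - ζ')) := by
    rw [umat_mul_apply, umat_inv]
    simp only [of_apply, cons_val', cons_val_zero, cons_val_one, cons_val_fin_one]
    rw [hζ, hζ', map_sub, star_mul, hstar]
    ring
  have k01 : umat (g⁻¹ * h) 0 1 = umat h 0 1 / umat g 0 0 - star (umat g 0 1 / umat h 0 0) +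
      star (umat g 0 1) * umat h 0 1 * algebraMap _ _ (ζ - ζ') := by
    rw [umat_mul_apply, umat_inv]
    simp only [of_apply, cons_val', cons_val_zero, cons_val_one, cons_val_fin_one]
    rw [hwg, hw', ← hη', map_sub, div_eq_mul_inv (umat g 0 1), star_mul, star_inv₀]
    ring
  have hsm := hsmall (star (umat g 0 1)) (umat h 0 0)
    (by rw [qabs_star]; exact hg.upper.trans_eq hgn) hhn.le
  refine mem_rationalSubgroup_of ?_ ?_ ?_ ?_
  · rw [k00]
    exact (nearRational d p).add_mem hqn (nearRational_of_qabs_lt hsm)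
  · rw [k00, qabs_add_eq_left (by rwa [hq1]), hq1]
  · rw [k01]
    refine (qabs_add_le _ _).trans (max_le ((qabs_sub_le _ _).trans (max_le ?_ ?_))
      (hsmall _ _ ?_ ?_).le)
    · rw [qabs_div, hgn, ← hhn]
      exact div_le_one_of_le₀ hh.upper (qabs_nonneg _)
    · rw [qabs_star, qabs_div, hhn, ← hgn]
      exact div_le_one_of_le₀ hg.upper (qabs_nonneg _)
    · rw [qabs_star]
      exact hg.upper.trans_eq hgn
    · exact hh.upper.trans_eq hhn
  · rw [k10, qabs_neg]
    exact hsmall _ _ (by rw [qabs_star, hgn]) hhn.le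

/-- There are `p^(2n+3)` labels at level `n`, each with bound `C p^(-6n(σ+1/2))`. The level sums are
`C p³ p^(-n(1+6σ))`, a geometric series of ratio below one for `σ > -1/6`. -/
theorem summable_cosetLabel_bound {σ : ℝ} (hσ : -1 / 6 < σ) {C : ℝ} (hC : 0 ≤ C) :
    Summable fun i : Σ n, CosetLabel p n => C * (((p : ℕ) : ℝ) ^ i.1) ^ (-6 * (σ + 1 / 2)) := by
  have hp1 : (1 : ℝ) < (p : ℕ) := by exact_mod_cast p.2.one_lt
  have hp0 : (0 : ℝ) < (p : ℕ) := zero_lt_one.trans hp1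
  have hne : ∀ k, NeZero ((p : ℕ) ^ k) := fun k => ⟨pow_ne_zero _ p.2.ne_zero⟩
  refine (summable_sigma_of_nonneg fun i => by positivity).2 ⟨fun n => Summable.of_finite, ?_⟩
  have hterm : ∀ n : ℕ, ∑' _ : CosetLabel p n, C * (((p : ℕ) : ℝ) ^ n) ^ (-6 * (σ + 1 / 2)) =
      C * ((p : ℕ) : ℝ) ^ 3 * (((p : ℕ) : ℝ) ^ (-1 - 6 * σ)) ^ n := by
    intro n
    rw [tsum_const, Nat.card_prod, Nat.card_prod, Nat.card_zmod, Nat.card_zmod, nsmul_eq_mul,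
      ← Real.rpow_natCast, ← Real.rpow_natCast,
      ← Real.rpow_natCast, ← Real.rpow_mul hp0.le, ← Real.rpow_mul hp0.le]
    push_cast
    rw [← Real.rpow_natCast, pow_one, mul_left_comm, mul_assoc C]
    congr 1
    have h2 : ((p : ℕ) : ℝ) * (p : ℕ) = ((p : ℕ) : ℝ) ^ (2 : ℝ) := by
      rw [← sq, ← Real.rpow_natCast]
      norm_num
    rw [h2, ← Real.rpow_add hp0, ← Real.rpow_add hp0, ← Real.rpow_add hp0]
    congr 1
    push_cast
    ring
  simp only [hterm]
  refine (summable_geometric_of_lt_one (Real.rpow_nonneg hp0.le _) ?_).mul_left _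
  exact Real.rpow_lt_one_of_one_lt_of_neg hp1 (by linarith)

/-- A function on `U(1,1)(ℚ_p)` that is right invariant under the rational subgroup and dominated
on the support by a power of the absolute value of the upper left entry is integrable. -/
theorem integrable_of_inSupport {μ : Measure (Ftilde₁ d ℚ_[p])} [μ.IsMulLeftInvariant]
    (hμ0 : μ (rationalSubgroup d p : Set (Ftilde₁ d ℚ_[p])) ≠ 0)
    (hμ1 : μ (rationalSubgroup d p : Set (Ftilde₁ d ℚ_[p])) ≠ ⊤) {F : Ftilde₁ d ℚ_[p] → ℂ}
    (hF : ∀ h, ∀ k ∈ rationalSubgroup d p, F (h * k) = F h) (hS : ∀ h, F h ≠ 0 → InSupport h)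
    {σ C : ℝ} (hσ : -1 / 6 < σ) (hC : 0 ≤ C)
    (hb : ∀ h, F h ≠ 0 → ‖F h‖ ≤ C * qabs (umat h 0 0) ^ (-6 * (σ + 1 / 2))) :
    Integrable F μ := by
  choose! e he using fun (h : Ftilde₁ d ℚ_[p]) (hh : InSupport h) => exists_qabs_eq_pow hh.one_le
  refine integrable_of_coset_bound isOpen_rationalSubgroup hμ0 hμ1 hF
    (fun h => (⟨e h, cosetLabel (e h) h⟩ : Σ n, CosetLabel p n)) (summable_cosetLabel_bound hσ hC)
    (fun g h hg hh hgh => ?_) fun h hh => ?_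
  · obtain ⟨e1, e2⟩ := Sigma.mk.inj_iff.1 hgh
    have hgn := he g (hS g hg)
    rw [e1] at e2 hgn
    exact inv_mul_mem_rationalSubgroup_of_cosetLabel_eq (hS g hg) (hS h hh) hgn (he h (hS h hh))
      (eq_of_heq e2)
  · exact (hb h hh).trans_eq (by rw [he h (hS h hh)])

end Convergence

/-! ### The local integral -/

section Integral

variable {d : ℕ} {p : Nat.Primes} [InertAt d p] {Λ : (LAlg d ℚ_[p])ˣ →* Circle} {s : ℂ}
  {V : Ftilde₁ d ℚ_[p] → ℂ} {μ : Measure (Ftilde₁ d ℚ_[p])} [μ.IsMulLeftInvariant]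

theorem supportIntegrand_of_mem (hΛ : IsAdmissible Λ)
    (hV : ∀ h, ∀ k ∈ lowerSubgroup d p, V (h * k) = V h) {h : Ftilde₁ d ℚ_[p]}
    (hh : h ∈ rationalSubgroup d p) : supportIntegrand Λ s V h = V 1 := by
  have h1 := qabs_eq_one_of_mem_lowerSubgroup (rationalSubgroup_le hh)
  have h2 := hV 1 h (rationalSubgroup_le hh)
  rw [one_mul] at h2
  rw [supportIntegrand, h2, h1, hΛ.charFun_eq_one h1 (hh.1 0 0).2]
  simp

theorem norm_supportIntegrand_le {C : ℝ} (hC : ∀ h, ‖V h‖ ≤ C) {h : Ftilde₁ d ℚ_[p]}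
    (hh : InSupport h) :
    ‖supportIntegrand Λ s V h‖ ≤ C * qabs (umat h 0 0) ^ (-6 * (s.re + 1 / 2)) := by
  have hx := qabs_pos hh.ne_zero
  have hre : (-6 * (s + 1 / 2)).re = -6 * (s.re + 1 / 2) := by
    simp
  rw [supportIntegrand, norm_mul, norm_mul, norm_inv, norm_charFun hh.ne_zero, inv_one, one_mul,
    Complex.norm_cpow_eq_rpow_re_of_pos hx, hre, mul_comm]
  exact mul_le_mul_of_nonneg_right (hC h) (Real.rpow_nonneg hx.le _)

open Classical in
theorem integrable_ite_supportIntegrand (hΛ : IsAdmissible Λ)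
    (hV : ∀ h, ∀ k ∈ lowerSubgroup d p, V (h * k) = V h) {C : ℝ} (hC : ∀ h, ‖V h‖ ≤ C)
    (hμ0 : μ (rationalSubgroup d p : Set (Ftilde₁ d ℚ_[p])) ≠ 0)
    (hμ1 : μ (rationalSubgroup d p : Set (Ftilde₁ d ℚ_[p])) ≠ ⊤) (hs : -1 / 6 < s.re)
    {T : Ftilde₁ d ℚ_[p] → Prop}
    (hT : ∀ h, InSupport h → ∀ k ∈ rationalSubgroup d p, (T (h * k) ↔ T h)) :
    Integrable (fun h => if InSupport h ∧ T h then supportIntegrand Λ s V h else 0) μ := by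
  refine integrable_of_inSupport hμ0 hμ1 (fun h k hk => ?_) (fun h hh => ?_) hs
    ((norm_nonneg (V 1)).trans (hC 1)) fun h hh => ?_
  · have hcond : (InSupport (h * k) ∧ T (h * k)) ↔ (InSupport h ∧ T h) := by
      rw [inSupport_mul_iff (rationalSubgroup_le hk)]
      exact and_congr_right fun hh => hT h hh k hk
    simp only [hcond]
    exact if_ctx_congr Iff.rfl (fun hh => supportIntegrand_mul hΛ hV hh.1 hk) fun _ => rfl
  · by_contra hn
    exact hh (if_neg fun h1 => hn h1.1)
  · have hn : InSupport h ∧ T h := by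
      by_contra hn
      exact hh (if_neg hn)
    rw [if_pos hn]
    exact norm_supportIntegrand_le hC hn.1

-- For `|x| > 1` the inverse of `x` is divisible by `p`, so the rationality condition is automatic
-- and this part is stable under the torus; it contributes zero. The rest is the rational subgroup,
-- where the integrand is constant. Integrability serves to split the integral.
open Classical in
theorem integral_nearRational_supportIntegrand (hΛ : IsAdmissible Λ)
    (hV : ∀ h, ∀ k ∈ lowerSubgroup d p, V (h * k) = V h)
    (hμ0 : μ (rationalSubgroup d p : Set (Ftilde₁ d ℚ_[p])) ≠ 0)
    (hμ1 : μ (rationalSubgroup d p : Set (Ftilde₁ d ℚ_[p])) ≠ ⊤)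
    (hint : Integrable (fun h => if InSupport h ∧ (umat h 0 0)⁻¹ ∈ nearRational d p then
      supportIntegrand Λ s V h else 0) μ) :
    ∫ h, (if InSupport h ∧ (umat h 0 0)⁻¹ ∈ nearRational d p then
      supportIntegrand Λ s V h else 0) ∂μ =
      (μ (rationalSubgroup d p : Set (Ftilde₁ d ℚ_[p]))).toReal * V 1 := by
  have hm : MeasurableSet (rationalSubgroup d p : Set (Ftilde₁ d ℚ_[p])) :=
    isOpen_rationalSubgroup.measurableSet
  have hind : Integrable ((rationalSubgroup d p : Set (Ftilde₁ d ℚ_[p])).indicator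
      fun _ => V 1) μ := (integrable_indicator_iff hm).2 (integrableOn_const hμ1)
  have hsplit : (fun h => if InSupport h ∧ (umat h 0 0)⁻¹ ∈ nearRational d p then
      supportIntegrand Λ s V h else 0) =
      fun h => (rationalSubgroup d p : Set (Ftilde₁ d ℚ_[p])).indicator (fun _ => V 1) h +
        if InSupport h ∧ 1 < qabs (umat h 0 0) then supportIntegrand Λ s V h else 0 := by
    funext h
    by_cases hh : InSupport h
    · rcases lt_or_eq_of_le hh.one_le with hlt | heq
      · have hnear : (umat h 0 0)⁻¹ ∈ nearRational d p :=
          nearRational_of_qabs_lt (by rw [qabs_inv]; exact inv_lt_one_of_one_lt₀ hlt)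
        have hmem : h ∉ (rationalSubgroup d p : Set (Ftilde₁ d ℚ_[p])) := fun hm =>
          hlt.ne' (mem_rationalSubgroup_iff.1 hm).2.1
        rw [if_pos ⟨hh, hnear⟩, if_pos ⟨hh, hlt⟩, Set.indicator_of_notMem hmem, zero_add]
      · rw [if_neg (c := _ ∧ 1 < _) fun h1 => h1.2.ne heq, add_zero]
        by_cases hnear : (umat h 0 0)⁻¹ ∈ nearRational d p
        · have hmem : h ∈ rationalSubgroup d p := mem_rationalSubgroup_iff.2 ⟨hh, heq.symm, hnear⟩
          rw [if_pos ⟨hh, hnear⟩, Set.indicator_of_mem hmem, supportIntegrand_of_mem hΛ hV hmem]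
        · rw [if_neg fun h1 => hnear h1.2, Set.indicator_of_notMem]
          exact fun hm => hnear (mem_rationalSubgroup_iff.1 hm).2.2
    · rw [if_neg fun h1 => hh h1.1, if_neg fun h1 => hh h1.1, Set.indicator_of_notMem, add_zero]
      exact fun hm => hh (mem_rationalSubgroup_iff.1 hm).1
  have hrest : Integrable (fun h : Ftilde₁ d ℚ_[p] =>
      if InSupport h ∧ 1 < qabs (umat h 0 0) then supportIntegrand Λ s V h else 0) μ := by
    have := hint.sub hind
    rw [hsplit] at this
    refine this.congr (.of_forall fun h => ?_)
    simp
  rw [hsplit, integral_add hind hrest, integral_supportIntegrand_eq_zero hΛ hV hμ0 (fun t => 1 < t),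
    add_zero, integral_indicator_const _ hm, Complex.real_smul]
  rfl

theorem zetaIntegrand_eq (b : ℤ) (hΛ : IsAdmissible Λ) (Wp : Ftilde d ℚ_[p] → ℂ)
    (g : Ftilde d ℚ_[p]) {k : Matrix (Fin 2 ⊕ Fin 2) (Fin 2 ⊕ Fin 2) (LAlg d ℚ_[p])}
    {h : Ftilde₁ d ℚ_[p]} (hh : InSupport h)
    (hU : Upsilon b Λ s (Qmat _ * iota k (umat h)) = supportValue Λ s (umat h 0 0)) :
    zetaIntegrand b Λ Wp g k s h = supportIntegrand Λ s (fun h => Wp (g * h.1)) h := by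
  rw [zetaIntegrand, hU, charFun_det hΛ hh.ne_zero, supportValue, supportIntegrand]
  have := charFun_ne_zero (Λ := Λ) hh.ne_zero
  field_simp

end Integral

end

end Pullback

/-! ### The proposition -/

open Pullback
open Classical in
theorem propositionp
    (N ℓ : ℕ) (hN : Squarefree N) (hℓ : 0 < ℓ) (hℓ2 : Even ℓ) (f : CuspForms N ℓ)
    (d : ℕ) (hd : 0 < d) (a b : ℤ) (hab : -(d : ℤ) = b ^ 2 - 4 * a)
    (p : Nat.Primes) (hpN : ¬ (p : ℕ) ∣ N) (hp2 : (p : ℕ) ≠ 2)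
    (hinert : legendreSym p (-(d : ℤ)) = -1)
    (Λ : (LAlg d ℚ_[p])ˣ →* Circle) (hΛ : IsAdmissible Λ)
    (ψ : AddChar Adele Circle) (hψ : IsStandardChar ψ)
    (ν : Measure AdeleQuot) [ν.IsAddHaarMeasure] [IsProbabilityMeasure ν]
    (Wp : Ftilde d ℚ_[p] → ℂ) (hWp : IsLocalComponent p (whittaker f ψ ν) Wp)
    (μ : Measure (Ftilde₁ d ℚ_[p])) [μ.IsHaarMeasure] (hμ : μ (KF₁ d p) = 1)
    (g : Ftilde d ℚ_[p])
    (k : Matrix (Fin 2 ⊕ Fin 2) (Fin 2 ⊕ Fin 2) (LAlg d ℚ_[p])) (hk : k ∈ Y d b p) (s : ℂ) :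
    (-1 / 6 < s.re → Integrable (zetaIntegrand b Λ Wp g k s) μ) ∧
    (Integrable (zetaIntegrand b Λ Wp g k s) μ →
      localZeta b Λ μ Wp g k s =
        if k = 1 ∨ k = Theta d b p then Wp g / ((p : ℕ) + 1 : ℂ) ^ 2 else 0) := by
  have : InertAt d p := ⟨hp2, hinert⟩
  obtain ⟨hμ0, hμ1, hμv⟩ := measure_rationalSubgroup hμ
  obtain ⟨C, hC⟩ := hWp.exists_norm_le hN.ne_zero hℓ2
  set V : Ftilde₁ d ℚ_[p] → ℂ := fun h => Wp (g * h.1) with hVdef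
  have hV : ∀ h, ∀ k ∈ lowerSubgroup d p, V (h * k) = V h := by
    intro h k hk
    have := hWp.apply_mul hpN (g * h.1) (qabs_eq_one_of_mem_lowerSubgroup hk) (hk.1 0 1) (hk.1 1 0)
    rw [mul_assoc] at this
    exact this
  have hVC : ∀ h, ‖V h‖ ≤ C := fun h => hC _
  rcases Upsilon_Y b hΛ s hk with ⟨hk', hU⟩ | ⟨hk', hU⟩ | ⟨hk', hU⟩
  · have hF : zetaIntegrand b Λ Wp g k s = fun h =>
        if InSupport h ∧ (umat h 0 0)⁻¹ ∈ nearRational d p then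
          supportIntegrand Λ s V h else 0 := by
      funext h
      by_cases hh : InSupport h ∧ (umat h 0 0)⁻¹ ∈ nearRational d p
      · rw [if_pos hh, zetaIntegrand_eq b hΛ Wp g hh.1]
        rw [hU, if_pos ⟨hh.1, hh.1.norm_im_lt_iff.2 hh.2⟩]
      · rw [if_neg hh, zetaIntegrand, hU, if_neg fun h1 => hh ⟨h1.1, h1.1.norm_im_lt_iff.1 h1.2⟩,
          zero_mul, zero_mul]
    rw [localZeta, hF, if_pos hk']
    refine ⟨fun hs => integrable_ite_supportIntegrand hΛ hV hVC hμ0 hμ1 hs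
      fun h hh k hk => hh.inv_mem_nearRational_mul_iff hk, fun hint => ?_⟩
    rw [integral_nearRational_supportIntegrand hΛ hV hμ0 hμ1 hint, hμv, hVdef]
    simp only [OneMemClass.coe_one, mul_one]
    push_cast
    ring
  -- A condition on `|x|` that always holds, kept opaque, brings the integrand along `s₁` into the
  -- shape of the vanishing lemma on the whole support.
  · obtain ⟨T, hT⟩ : ∃ T : ℝ → Prop, ∀ t, T t := ⟨fun _ => True, fun _ => trivial⟩
    have hF : zetaIntegrand b Λ Wp g k s = fun h =>
        if InSupport h ∧ T (qabs (umat h 0 0)) then supportIntegrand Λ s V h else 0 := by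
      funext h
      by_cases hh : InSupport h
      · rw [if_pos ⟨hh, hT _⟩, zetaIntegrand_eq b hΛ Wp g hh]
        rw [hU, if_pos hh]
      · rw [if_neg fun h1 => hh h1.1, zetaIntegrand, hU, if_neg hh, zero_mul, zero_mul]
    rw [localZeta, hF, if_neg hk']
    exact ⟨fun hs => integrable_ite_supportIntegrand hΛ hV hVC hμ0 hμ1 hs
      fun h hh k hk => iff_of_true (hT _) (hT _), fun _ =>
        integral_supportIntegrand_eq_zero hΛ hV hμ0 T⟩
  · have hF : zetaIntegrand b Λ Wp g k s = fun _ => 0 := by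
      funext h
      rw [zetaIntegrand, hU, zero_mul, zero_mul]
    rw [localZeta, hF, if_neg hk']
    exact ⟨fun _ => integrable_zero _ _ _, fun _ => integral_zero _ _⟩
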